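/- **Setting.** Let $n\ge 2$ and let $\mathcal M$ be a manifold diffeomorphic to $\mathbb R^n$, given in a coordinate representation as an open set $U\subset\mathbb R^n$. For every parameter value $\theta$ let $dp(x|\theta)=\rho(x|\theta)\,dx$ be a probability distribution on $U$ with smooth positive density, and let $g(\cdot|\theta)$ be a smooth Riemannian metric on $U$ that solves $$g_{ij}=-\frac{\partial^2\log\rho}{\partial x^i\partial x^j}+\Gamma^k_{ij}\frac{\partial\log\rho}{\partial x^k}+\frac{\partial\Gamma^k_{jk}}{\partial x^i}-\Gamma^k_{ij}\Gamma^l_{kl},$$ where $\Gamma^k_{ij}$ are the Levi-Civita symbols of $g$. Put $d\mu=\sqrt{|g_{ij}/2\pi|}\,dx$ (invariant volume), $\omega=\rho\sqrt{|2\pi g^{ij}|}$ (probabilistic weight), $\mathcal S=\log\omega$ (information potential), and assume that $\omega$ vanishes at the boundary of $\mathcal M$, i.e. $\omega(x|\theta)\to0$ whenever $x$ leaves every compact subset of $U$. Such a triple $(U,\rho,g)$ (in any dimension) is called a statistical manifold. For a Riemannian manifold $(W,h)$ and a point $c\in W$ let $\ell(a,c)$ be the Riemannian distance, $\mathcal Z=\int_W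 e^{-\frac12\ell^2(a,c)}d\mu$ the gaussian partition function and $\mathcal P=-\log\mathcal Z$ the gaussian potential. The distribution $dp(x|\theta)$ has a *reducible statistical dependence* if there is a smooth coordinate change $\check x=\phi(x)$ of $U$ onto a product of $n$ open intervals in which $dp(\check x|\theta)=\prod_{i=1}^n dp^{(i)}(\check x^i|\theta)$, where each $dp^{(i)}$ is a probability distribution with smooth positive density on the $i$-th interval. A *Cartesian decomposition* $\mathcal M=\mathcal A^{(1)}\otimes\cdots\otimes\mathcal A^{(l)}$, $l\ge2$, is a smooth coordinate change from $U$ onto a product of open sets (coordinate representations of manifolds $\mathcal A^{(k)}$ of positive dimension, with coordinates $a_k$) in which $ds^2=\sum_{k=1}^l ds^2_{(k)}$ for Riemannian metrics $ds^2_{(k)}=g^{(k)}_{i_kj_k}(a_k|\theta)\,da_k^{i_k}da_k^{j_k}$ on the factors. **Proposition.** For each $\theta$, the distribution $dp(x|\theta)$ has a reducible statistical dependence if and only if $(\mathcal M,g(\cdot|\theta))$ admits a Cartesian decomposition. Moreover, for every Cartesian decomposition, $\mathcal S(\cdot|\theta)$ has a unique point of maximum $\bar x$ and, with $\bar a_k$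 its component in $\mathcal A^{(k)}$, $\mathcal Z(\theta),\mathcal P(\theta)$ computed with centre $\bar x$, and $\mathcal Z^{(k)}(\theta),\mathcal P^{(k)}(\theta)$ computed in $\mathcal A^{(k)}$ with centre $\bar a_k$: 1. $dp^{(k)}(a_k|\theta)=\frac1{\mathcal Z^{(k)}(\theta)}\exp[-\frac12\ell^2_\theta(a_k,\bar a_k)]\,d\mu^{(k)}(a_k|\theta)$ makes each $\mathcal A^{(k)}$ a statistical manifold, whose information potential is $\mathcal S^{(k)}(a_k|\theta)=\mathcal P^{(k)}(\theta)-\frac12\ell_\theta^2(a_k,\bar a_k)$; 2. $\ell^2_\theta(x,\bar x)=\sum_k\ell^2_\theta(a_k,\bar a_k)$ and $d\mu(x|\theta)=\prod_k d\mu^{(k)}(a_k|\theta)$; 3. $dp(x|\theta)=\prod_k dp^{(k)}(a_k|\theta)$; 4. $\mathcal Z(\theta)=\prod_k\mathcal Z^{(k)}(\theta)$, $\mathcal P(\theta)=\sum_k\mathcal P^{(k)}(\theta)$ and $\mathcal S(x|\theta)=\sum_k\mathcal S^{(k)}(a_k|\theta)$. -/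

import Mathlib

open MeasureTheory Set Filter Topology
open scoped ContDiff

noncomputable section

namespace FluctuationGeometry

variable {ι : Type*} [Fintype ι] [DecidableEq ι]

/-- Partial derivative `∂f/∂xⁱ` at the point `x` of the real space with coordinates `(xⁱ)`. -/
def pderiv (i : ι) (f : (ι → ℝ) → ℝ) (x : ι → ℝ) : ℝ :=
  fderiv ℝ f x (Pi.single i 1)

/-- A coordinate change `φ : U → V` (a smooth diffeomorphism between the coordinate representations
`U` and `V`), with inverse `ψ : V → U`. -/
structure IsCoordChange (U V : Set (ι → ℝ)) (φ ψ : (ι → ℝ) → (ι → ℝ)) : Prop where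
  smooth : ContDiffOn ℝ ∞ φ U
  smooth_inv : ContDiffOn ℝ ∞ ψ V
  mapsTo : MapsTo φ U V
  mapsTo_inv : MapsTo ψ V U
  left_inv : ∀ x ∈ U, ψ (φ x) = x
  right_inv : ∀ y ∈ V, φ (ψ y) = y

/-- Probability density in the new coordinates `y = φ x`, where `ψ` is the inverse of `φ`:
`ρ(x) |∂x/∂y|` with `x = ψ y`. -/
def changeDensity (ψ : (ι → ℝ) → (ι → ℝ)) (ρ : (ι → ℝ) → ℝ) (y : ι → ℝ) : ℝ :=
  ρ (ψ y) * |(fderiv ℝ ψ y).det|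

/-- Metric tensor in the new coordinates `y = φ x`, where `ψ` is the inverse of `φ`:
`∑ (∂xⁱ/∂yᵏ) (∂xʲ/∂yˡ) g_ij(x)` with `x = ψ y`. -/
def changeMetric (ψ : (ι → ℝ) → (ι → ℝ)) (g : (ι → ℝ) → Matrix ι ι ℝ) (y : ι → ℝ) :
    Matrix ι ι ℝ := fun k l =>
  ∑ i, ∑ j, pderiv k (fun z => ψ z i) y * pderiv l (fun z => ψ z j) y * g (ψ y) i j

/-- `g` is a smooth Riemannian metric on the region `U`. -/
structure IsRiemannianMetric (U : Set (ι → ℝ)) (g : (ι → ℝ) → Matrix ι ι ℝ) : Prop where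
  smooth : ∀ i j, ContDiffOn ℝ ∞ (fun x => g x i j) U
  posDef : ∀ x ∈ U, (g x).PosDef

/-- Levi-Civita symbols `Γᵏ_ij = ½ gᵏᵐ (∂_j g_im + ∂_i g_jm - ∂_m g_ij)`. -/
def christoffel (g : (ι → ℝ) → Matrix ι ι ℝ) (k i j : ι) (x : ι → ℝ) : ℝ :=
  ∑ m, (g x)⁻¹ k m * (1 / 2) *
    (pderiv j (fun z => g z i m) x + pderiv i (fun z => g z j m) x
      - pderiv m (fun z => g z i j) x)

/-- Density `√|g_ij / 2π|` of the invariant volume element `dμ` with respect to `dx`. -/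
def volDensity (g : (ι → ℝ) → Matrix ι ι ℝ) (x : ι → ℝ) : ℝ :=
  Real.sqrt ((2 * Real.pi)⁻¹ • g x).det

/-- Probabilistic weight `ω = ρ √|2π gⁱʲ|`. -/
def weight (ρ : (ι → ℝ) → ℝ) (g : (ι → ℝ) → Matrix ι ι ℝ) (x : ι → ℝ) : ℝ :=
  ρ x * Real.sqrt ((2 * Real.pi) • (g x)⁻¹).det

/-- Information potential `S = log ω`. -/
def infoPotential (ρ : (ι → ℝ) → ℝ) (g : (ι → ℝ) → Matrix ι ι ℝ) (x : ι → ℝ) : ℝ :=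
  Real.log (weight ρ g x)

/-- A statistical manifold in the coordinate representation `U`: a manifold diffeomorphic to the
real space, carrying a smooth positive probability density `ρ` and a Riemannian metric `g` that
solves
`g_ij = - ∂_i ∂_j log ρ + Γᵏ_ij ∂_k log ρ + ∂_i Γᵏ_jk - Γᵏ_ij Γˡ_kl`,
the probabilistic weight vanishing at the boundary of the manifold (that is, along every way
of leaving all the compact subsets of `U`). -/
structure IsStatisticalManifold (U : Set (ι → ℝ)) (ρ : (ι → ℝ) → ℝ)
    (g : (ι → ℝ) → Matrix ι ι ℝ) : Prop where
  isOpen : IsOpen U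
  diffeo : ∃ φ ψ : (ι → ℝ) → (ι → ℝ), IsCoordChange U univ φ ψ
  density_smooth : ContDiffOn ℝ ∞ ρ U
  density_pos : ∀ x ∈ U, 0 < ρ x
  density_integral : ∫ x in U, ρ x = 1
  metric : IsRiemannianMetric U g
  metric_eq : ∀ x ∈ U, ∀ i j,
    g x i j = - pderiv i (pderiv j (fun z => Real.log (ρ z))) x
      + ∑ k, christoffel g k i j x * pderiv k (fun z => Real.log (ρ z)) x
      + ∑ k, pderiv i (christoffel g k j k) x
      - ∑ k, ∑ l, christoffel g k i j x * christoffel g l k l x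
  weight_boundary : Tendsto (fun x : U => weight ρ g (x : ι → ℝ)) (cocompact U) (𝓝 0)

/-- Length of the curve `γ` restricted to `[0, 1]`. -/
def curveLength (g : (ι → ℝ) → Matrix ι ι ℝ) (γ : ℝ → (ι → ℝ)) : ℝ :=
  ∫ t in (0 : ℝ)..1,
    Real.sqrt (∑ i, ∑ j, g (γ t) i j * deriv γ t i * deriv γ t j)

/-- Separation distance `ℓ(x, y)` of the Riemannian manifold `(U, g)`: infimum of the lengths of
the continuously differentiable curves in `U` that join `x` and `y`. -/
def sepDist (U : Set (ι → ℝ)) (g : (ι → ℝ) → Matrix ι ι ℝ) (x y : ι → ℝ) : ℝ :=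
  sInf {L | ∃ γ : ℝ → (ι → ℝ), ContDiff ℝ 1 γ ∧ γ 0 = x ∧ γ 1 = y ∧
    (∀ t ∈ Icc (0 : ℝ) 1, γ t ∈ U) ∧ L = curveLength g γ}

/-- Gaussian partition function `Z = ∫ exp(-½ ℓ²(x, c)) dμ(x)`, where `c` is the centre. -/
def gaussZ (U : Set (ι → ℝ)) (g : (ι → ℝ) → Matrix ι ι ℝ) (c : ι → ℝ) : ℝ :=
  ∫ x in U, Real.exp (-(1 / 2) * sepDist U g x c ^ 2) * volDensity g x

/-- Gaussian potential `P = - log Z`. -/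
def gaussPotential (U : Set (ι → ℝ)) (g : (ι → ℝ) → Matrix ι ι ℝ) (c : ι → ℝ) : ℝ :=
  - Real.log (gaussZ U g c)

/-- Density (with respect to `dx`) of the Riemannian gaussian distribution
`Z⁻¹ exp(-½ ℓ²(x, c)) dμ(x)`. -/
def gaussDensity (U : Set (ι → ℝ)) (g : (ι → ℝ) → Matrix ι ι ℝ) (c x : ι → ℝ) : ℝ :=
  1 / gaussZ U g c * Real.exp (-(1 / 2) * sepDist U g x c ^ 2) * volDensity g x

/-- `r` is a smooth positive probability density on the open interval `I` of the real line. -/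
structure IsLineDensity (I : Set ℝ) (r : ℝ → ℝ) : Prop where
  isOpen : IsOpen I
  interval : I.OrdConnected
  smooth : ContDiffOn ℝ ∞ r I
  pos : ∀ t ∈ I, 0 < r t
  integral : ∫ t in I, r t = 1

/-- Reducible statistical dependence of the distribution `ρ(x) dx` on `U`: after some coordinate
change it is a product of independent distributions, one for each coordinate. -/
def HasReducibleDependence (U : Set (ι → ℝ)) (ρ : (ι → ℝ) → ℝ) : Prop :=
  ∃ (V : Set (ι → ℝ)) (φ ψ : (ι → ℝ) → (ι → ℝ)) (I : ι → Set ℝ) (r : ι → ℝ → ℝ),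
    IsCoordChange U V φ ψ ∧ (∀ i, IsLineDensity (I i) (r i)) ∧ V = univ.pi I ∧
    ∀ y ∈ V, changeDensity ψ ρ y = ∏ i, r i (y i)

/-- The coordinates of `y` whose index lies in the `k`-th block of the partition `b`. -/
def block {l : ℕ} (b : ι → Fin l) (k : Fin l) (y : ι → ℝ) : {i // b i = k} → ℝ :=
  fun i => y i

/-- A Cartesian decomposition of the Riemannian manifold `(U, g)` into two or more Riemannian
manifolds `(W k, G k)` of positive dimension. The coordinates of the product are split into
the blocks `{i | b i = k}`, the coordinates of the `k`-th factor. -/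
structure CartesianDecomposition (U : Set (ι → ℝ)) (g : (ι → ℝ) → Matrix ι ι ℝ) where
  /-- number of factors -/
  l : ℕ
  two_le : 2 ≤ l
  /-- block of each coordinate -/
  b : ι → Fin l
  surj : Function.Surjective b
  /-- coordinate representations of the factors -/
  W : (k : Fin l) → Set ({i // b i = k} → ℝ)
  W_open : ∀ k, IsOpen (W k)
  /-- metrics of the factors -/
  G : (k : Fin l) → ({i // b i = k} → ℝ) → Matrix {i // b i = k} {i // b i = k} ℝ
  G_metric : ∀ k, IsRiemannianMetric (W k) (G k)
  /-- the coordinate change from `U` to the product of the factors -/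
  φ : (ι → ℝ) → (ι → ℝ)
  /-- its inverse -/
  ψ : (ι → ℝ) → (ι → ℝ)
  change : IsCoordChange U {y | ∀ k, block b k y ∈ W k} φ ψ
  /-- the metric has block form, the `k`-th block depending on the `k`-th coordinates only -/
  metric_eq : ∀ y, (∀ k, block b k y ∈ W k) → ∀ i j,
    changeMetric ψ g y i j =
      if h : b j = b i then G (b i) (block b (b i) y) ⟨i, rfl⟩ ⟨j, h⟩ else 0

end FluctuationGeometry

end

/-! The contracted Levi-Civita symbols are the logarithmic derivatives of the volume density, so the
equation for the metric says exactly that `f = -S` has covariant Hessian `g`. The vanishing of the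
weight at the boundary makes the sublevel sets of `f` compact. These two facts (`IsMetricPotential`)
force `(U, g)` to be a Euclidean space and `f` to be half the squared distance to its minimum, up to
a constant.

Indeed, the gradient `X` of `f` is homothetic, `L_X g = 2g`, whence `|X|² = 2(f - f(c))` at a
minimum `c`. Along a geodesic from `c` with initial velocity `v` one has `f = f(c) + t²|v|²/2`, so
it stays in a compact sublevel set and lives on all of `[0, 1]`. Equality in Cauchy–Schwarz shows
that it arrives with velocity `X`. Thus the exponential map `Ψ` at `c` satisfies `dΨ_v(v) = X(Ψ v)`;
it carries the radial field to `X`, and homothety makes the pulled-back metric constant along rays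
(`pullback_const`). It is injective by uniqueness of geodesics run backwards, and its range is open
and relatively closed in `U` (`exists_isometry`).

In the resulting chart (`IsGaussianChart`) the distribution is the standard normal law:
normalisation gives `S(c) = 0`, `Z = 1`, `P = 0`. Both sides of the equivalence therefore hold for
every statistical manifold of dimension at least two, the Cartesian coordinates of the chart serving
for both.

For an arbitrary Cartesian decomposition the mixed Levi-Civita symbols vanish, hence so do the mixed
second derivatives of `f`, and `f` is a sum of functions of the separate blocks
(`potential_eq_sum`). The slices through `c` are tangent to `X`, so the restriction of `f` to a
slice is again a metric potential (`isMetricPotential_factor`). Each factor thus has a gaussian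
chart of its own, from which all the product formulas follow. -/

noncomputable section

universe u

namespace FluctuationGeometry

/-! ### Smoothness of composition operators on spaces of continuous functions. -/

section Nemytskii

variable {K : Type*} [TopologicalSpace K] [CompactSpace K]

/-- Pointwise application `(A, h) ↦ (t ↦ A t (h t))` as a continuous bilinear map. -/
def pointwiseApply (K : Type*) [TopologicalSpace K] [CompactSpace K] (P Q : Type*)
    [NormedAddCommGroup P] [NormedSpace ℝ P] [NormedAddCommGroup Q] [NormedSpace ℝ Q] :
    C(K, P →L[ℝ] Q) →L[ℝ] C(K, P) →L[ℝ] C(K, Q) :=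
  LinearMap.mkContinuous₂
    (LinearMap.mk₂ ℝ (fun (A : C(K, P →L[ℝ] Q)) (h : C(K, P)) =>
        (⟨fun t => A t (h t), by fun_prop⟩ : C(K, Q)))
      (by intros; ext; simp) (by intros; ext; simp) (by intros; ext; simp)
      (by intros; ext; simp)) 1 (by
        intro A h
        rw [one_mul]
        refine (ContinuousMap.norm_le _ (by positivity)).2 fun t => ?_
        exact ((A t).le_opNorm _).trans
          (mul_le_mul (A.norm_coe_le_norm t) (h.norm_coe_le_norm t) (by positivity)
            (by positivity)))

@[simp] lemma pointwiseApply_apply {P Q : Type*}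
    [NormedAddCommGroup P] [NormedSpace ℝ P] [NormedAddCommGroup Q] [NormedSpace ℝ Q]
    (A : C(K, P →L[ℝ] Q)) (h : C(K, P)) (t : K) :
    pointwiseApply K P Q A h t = A t (h t) := rfl

/-- Continuity of `v ↦ W' ∘ v` in the sup norm provides one `δ` valid for all `t`; the mean value
inequality on the ball of radius `δ` about `u t` then gives an error bound uniform in `t`. -/
lemma hasFDerivAt_postcomp {P Q : Type*}
    [NormedAddCommGroup P] [NormedSpace ℝ P] [NormedAddCommGroup Q] [NormedSpace ℝ Q]
    (W : C(P, Q)) (W' : C(P, P →L[ℝ] Q)) (h : ∀ p, HasFDerivAt W (W' p) p) (u : C(K, P)) :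
    HasFDerivAt (fun v : C(K, P) => W.comp v) (pointwiseApply K P Q (W'.comp u)) u := by
  rw [hasFDerivAt_iff_isLittleO_nhds_zero, Asymptotics.isLittleO_iff]
  intro ε hε
  have hc : ContinuousAt (fun v : C(K, P) => W'.comp v) u :=
    (ContinuousMap.continuous_postcomp W').continuousAt
  obtain ⟨δ, hδ, H⟩ :=
    (Metric.continuousAt_iff (f := fun v : C(K, P) => W'.comp v) (a := u)).1 hc ε hε
  filter_upwards [Metric.ball_mem_nhds (0 : C(K, P)) hδ] with k hk
  rw [mem_ball_zero_iff] at hk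
  refine (ContinuousMap.norm_le _ (by positivity)).2 fun t => ?_
  have hkt : ‖k t‖ < δ := (k.norm_coe_le_norm t).trans_lt hk
  have key : ∀ y ∈ Metric.ball (u t) δ, ‖W' y - W' (u t)‖ ≤ ε := by
    intro y hy
    -- Translating `u` by the constant `y - u t` gives a function close to `u` that takes the value
    -- `y` at `t`, so the uniform estimate applies to `W' y`.
    have h1 : dist (u + ContinuousMap.const K (y - u t)) u < δ := by
      rw [dist_eq_norm, add_sub_cancel_left]
      refine (ContinuousMap.norm_lt_iff _ hδ).2 fun s => ?_
      simpa [← dist_eq_norm] using hy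
    have h2 := (ContinuousMap.dist_apply_le_dist (f := W'.comp (u + ContinuousMap.const K (y - u t)))
      (g := W'.comp u) t).trans (H h1).le
    simpa [dist_eq_norm] using h2
  have := (convex_ball (u t) δ).norm_image_sub_le_of_norm_hasFDerivWithin_le' (f := W)
    (f' := fun y => W' y) (φ := W' (u t)) (C := ε) (x := u t) (y := u t + k t)
    (fun y _ => (h y).hasFDerivWithinAt) key (Metric.mem_ball_self hδ)
    (by simpa [dist_eq_norm] using hkt)
  simp only [add_sub_cancel_left] at this
  refine this.trans ?_
  gcongr
  exact k.norm_coe_le_norm t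

/-- Composition with a smooth map is a smooth operator between spaces of continuous functions. -/
lemma contDiff_postcomp {P : Type u} {Q : Type u}
    [NormedAddCommGroup P] [NormedSpace ℝ P] [NormedAddCommGroup Q] [NormedSpace ℝ Q]
    (W : C(P, Q)) (hW : ContDiff ℝ ∞ W) :
    ContDiff ℝ ∞ (fun v : C(K, P) => W.comp v) := by
  rw [contDiff_infty]
  intro n
  -- The target must vary: the derivative is governed by composition with `fderiv ℝ W`, whose values
  -- are in `P →L[ℝ] Q`.
  induction n generalizing Q with
  | zero =>
    exact contDiff_zero.2 (ContinuousMap.continuous_postcomp W)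
  | succ n ih =>
    have hd : ContDiff ℝ ∞ (fderiv ℝ W) := hW.fderiv_right (m := ∞) (by simp)
    let W' : C(P, P →L[ℝ] Q) := ⟨fderiv ℝ W, hd.continuous⟩
    refine contDiff_succ_iff_hasFDerivAt.2
      ⟨fun u => pointwiseApply K P Q (W'.comp u), ?_, fun u => ?_⟩
    · exact (pointwiseApply K P Q).contDiff.comp (ih W' hd)
    · exact hasFDerivAt_postcomp W W'
        (fun p => (hW.differentiable (by simp) p).hasFDerivAt) u

end Nemytskii

/-! ### Volterra integral operators. -/

section Volterra

variable {P : Type*} [NormedAddCommGroup P]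

lemma continuous_Icc_extend (u : C(Icc (0 : ℝ) 1, P)) :
    Continuous (IccExtend (zero_le_one' ℝ) u) := u.continuous.Icc_extend'

lemma norm_IccExtend_le (u : C(Icc (0 : ℝ) 1, P)) (s : ℝ) :
    ‖IccExtend (zero_le_one' ℝ) u s‖ ≤ ‖u‖ := u.norm_coe_le_norm _

variable [NormedSpace ℝ P]

/-- The primitive `u ↦ (t ↦ ∫₀ᵗ u)`. -/
def primitive (P : Type*) [NormedAddCommGroup P] [NormedSpace ℝ P] :
    C(Icc (0 : ℝ) 1, P) →L[ℝ] C(Icc (0 : ℝ) 1, P) :=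
  LinearMap.mkContinuous
    { toFun := fun u => ⟨fun t => ∫ s in (0 : ℝ)..t, IccExtend (zero_le_one' ℝ) u s,
        (intervalIntegral.continuous_primitive
          (fun a b => (continuous_Icc_extend u).intervalIntegrable a b) 0).comp
          continuous_subtype_val⟩
      map_add' := by
        intro u v
        ext t
        simp only [ContinuousMap.coe_mk, ContinuousMap.add_apply]
        rw [← intervalIntegral.integral_add ((continuous_Icc_extend u).intervalIntegrable _ _)
          ((continuous_Icc_extend v).intervalIntegrable _ _)]
        rfl
      map_smul' := by
        intro c u
        ext t
        simp only [ContinuousMap.coe_mk, ContinuousMap.smul_apply, RingHom.id_apply]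
        rw [← intervalIntegral.integral_smul]
        rfl } 1 (by
      intro u
      refine (ContinuousMap.norm_le _ (by positivity)).2 fun t => ?_
      have h := intervalIntegral.norm_integral_le_of_norm_le_const (a := 0) (b := (t : ℝ))
        (f := IccExtend (zero_le_one' ℝ) u) (C := ‖u‖) (fun s _ => norm_IccExtend_le u s)
      refine h.trans ?_
      rw [sub_zero, abs_of_nonneg t.2.1, mul_comm]
      exact mul_le_mul_of_nonneg_right t.2.2 (norm_nonneg _))

lemma primitive_apply (u : C(Icc (0 : ℝ) 1, P)) (t : Icc (0 : ℝ) 1) :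
    primitive P u t = ∫ s in (0 : ℝ)..t, IccExtend (zero_le_one' ℝ) u s := rfl

/-- Each application integrates the previous bound, and the repeated integrals of powers of `s`
produce the factorial. -/
lemma volterra_pow_bound (B : C(Icc (0 : ℝ) 1, P →L[ℝ] P)) (u : C(Icc (0 : ℝ) 1, P)) (n : ℕ)
    (t : Icc (0 : ℝ) 1) :
    ‖(((primitive P).comp (pointwiseApply _ P P B)) ^ n) u t‖
      ≤ (‖B‖ * t) ^ n / n.factorial * ‖u‖ := by
  induction n generalizing t with
  | zero => simpa using u.norm_coe_le_norm t
  | succ n ih =>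
    rw [pow_succ', mul_apply_eq_comp]
    set w := (((primitive P).comp (pointwiseApply _ P P B)) ^ n) u
    rw [ContinuousLinearMap.comp_apply, primitive_apply]
    have hb : ∀ s ∈ Ioc (0 : ℝ) t,
        ‖IccExtend (zero_le_one' ℝ) (pointwiseApply _ P P B w) s‖
          ≤ ‖B‖ * ((‖B‖ * s) ^ n / n.factorial * ‖u‖) := by
      intro s hs
      have hs' : s ∈ Icc (0 : ℝ) 1 := ⟨hs.1.le, hs.2.trans t.2.2⟩
      rw [IccExtend_of_mem _ _ hs', pointwiseApply_apply]
      refine ((B _).le_opNorm _).trans ?_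
      gcongr
      · exact B.norm_coe_le_norm _
      · exact ih ⟨s, hs'⟩
    refine (intervalIntegral.norm_integral_le_of_norm_le t.2.1
      (Eventually.of_forall hb) (Continuous.intervalIntegrable (by fun_prop) _ _)).trans ?_
    rw [show (fun s : ℝ => ‖B‖ * ((‖B‖ * s) ^ n / n.factorial * ‖u‖))
      = fun s => (‖B‖ ^ (n + 1) / n.factorial * ‖u‖) * s ^ n by
        funext s; rw [mul_pow]; ring]
    rw [intervalIntegral.integral_const_mul, integral_pow, Nat.factorial_succ]
    apply le_of_eq
    push_cast
    field_simp
    simp [mul_pow]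
    ring

/-- A high power `T ^ n` has norm below one by the factorial bound, so `1 - T ^ n` is a unit. It is
the product of `1 - T` with a geometric sum commuting with it, so `1 - T` is a unit too. -/
lemma isUnit_one_sub_volterra [CompleteSpace P] (B : C(Icc (0 : ℝ) 1, P →L[ℝ] P)) :
    IsUnit (1 - (primitive P).comp (pointwiseApply _ P P B)) := by
  set T := (primitive P).comp (pointwiseApply _ P P B) with hT
  have hlim := FloorSemiring.tendsto_pow_div_factorial_atTop (‖B‖)
  obtain ⟨n, hn⟩ := ((hlim.eventually_lt_const (zero_lt_one' ℝ))).exists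
  have hTn : ‖T ^ n‖ < 1 := by
    refine lt_of_le_of_lt (ContinuousLinearMap.opNorm_le_bound _ (by positivity) fun u => ?_) hn
    refine (ContinuousMap.norm_le _ (by positivity)).2 fun t => ?_
    refine (volterra_pow_bound B u n t).trans ?_
    gcongr
    · exact mul_nonneg (norm_nonneg B) t.2.1
    · exact mul_le_of_le_one_right (norm_nonneg B) t.2.2
  have hu : IsUnit (1 - T ^ n) := by
    exact isUnit_one_sub_of_norm_lt_one (R := C(Icc (0 : ℝ) 1, P) →L[ℝ] C(Icc (0 : ℝ) 1, P)) hTn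
  rw [← mul_neg_geom_sum] at hu
  refine ((Commute.isUnit_mul_iff ?_).1 hu).1
  refine Commute.sub_left (Commute.one_left _) ?_
  exact Commute.sum_right _ _ _ fun i _ => (Commute.refl T).pow_right i

end Volterra

/-! ### Flows of vector fields and smooth dependence on the initial point. -/

section Flow

lemma eqOn_of_hasDerivWithinAt_of_eq_zero {P : Type*} [NormedAddCommGroup P] [NormedSpace ℝ P]
    {V : P → P} {K : NNReal} (hK : LipschitzWith K V) {α β : ℝ → P}
    (hα : ∀ t ∈ Icc (0 : ℝ) 1, HasDerivWithinAt α (V (α t)) (Icc 0 1) t)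
    (hβ : ∀ t ∈ Icc (0 : ℝ) 1, HasDerivWithinAt β (V (β t)) (Icc 0 1) t) (h0 : α 0 = β 0) :
    EqOn α β (Icc 0 1) := by
  refine ODE_solution_unique_of_mem_Icc_right (v := fun _ => V) (s := fun _ => univ) (K := K)
    (fun _ _ => hK.lipschitzOnWith) (fun t ht => (hα t ht).continuousWithinAt)
    (fun t ht => ?_) (fun _ _ => mem_univ _) (fun t ht => (hβ t ht).continuousWithinAt)
    (fun t ht => ?_) (fun _ _ => mem_univ _) h0
  · exact (hα t (Ico_subset_Icc_self ht)).mono_of_mem_nhdsWithin (Icc_mem_nhdsGE_of_mem ht)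
  · exact (hβ t (Ico_subset_Icc_self ht)).mono_of_mem_nhdsWithin (Icc_mem_nhdsGE_of_mem ht)

/-- Backward uniqueness. It serves twice: a trajectory cannot reach a zero of the field that it did
not start from, and geodesics with the same terminal data coincide. -/
lemma eqOn_of_hasDerivWithinAt_of_eq_right {P : Type*} [NormedAddCommGroup P] [NormedSpace ℝ P]
    {V : P → P} {K : NNReal} (hK : LipschitzWith K V) {α β : ℝ → P} {b : ℝ}
    (hα : ∀ t ∈ Icc (0 : ℝ) b, HasDerivWithinAt α (V (α t)) (Icc 0 b) t)
    (hβ : ∀ t ∈ Icc (0 : ℝ) b, HasDerivWithinAt β (V (β t)) (Icc 0 b) t) (h1 : α b = β b) :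
    EqOn α β (Icc 0 b) := by
  refine ODE_solution_unique_of_mem_Icc_left (v := fun _ => V) (s := fun _ => univ) (K := K)
    (fun _ _ => hK.lipschitzOnWith) (fun t ht => (hα t ht).continuousWithinAt)
    (fun t ht => ?_) (fun _ _ => mem_univ _) (fun t ht => (hβ t ht).continuousWithinAt)
    (fun t ht => ?_) (fun _ _ => mem_univ _) h1
  · exact (hα t (Ioc_subset_Icc_self ht)).mono_of_mem_nhdsWithin (Icc_mem_nhdsLE_of_mem ht)
  · exact (hβ t (Ioc_subset_Icc_self ht)).mono_of_mem_nhdsWithin (Icc_mem_nhdsLE_of_mem ht)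

lemma exists_integralCurve {P : Type*} [NormedAddCommGroup P] [NormedSpace ℝ P] [CompleteSpace P]
    {V : P → P} {K : NNReal} (hK : LipschitzWith K V) {L : ℝ} (hL : ∀ p, ‖V p‖ ≤ L) (p : P) :
    ∃ α : ℝ → P, α 0 = p ∧
      ∀ t ∈ Icc (0 : ℝ) 1, HasDerivWithinAt α (V (α t)) (Icc 0 1) t := by
  have hL0 : 0 ≤ L := (norm_nonneg _).trans (hL p)
  lift L to NNReal using hL0
  -- A curve of speed at most `L` stays within distance `L` of its start during unit time, so the
  -- ball of radius `L` suffices and a solution exists on the whole interval.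
  have := IsPicardLindelof.of_time_independent (f := V) (tmin := 0) (tmax := 1)
    (t₀ := ⟨0, by simp⟩) (x₀ := p) (a := L) (r := 0) (L := L) (K := K) (fun x _ => hL x)
    hK.lipschitzOnWith (by simp)
  exact this.exists_eq_forall_mem_Icc_hasDerivWithinAt₀

/-- A solution of the integral equation is an integral curve. -/
lemma hasDerivWithinAt_of_sub_primitive {P : Type*} [NormedAddCommGroup P] [NormedSpace ℝ P]
    [CompleteSpace P] (V : C(P, P)) (u : C(Icc (0 : ℝ) 1, P)) (p : P)
    (h : u - primitive P (V.comp u) = ContinuousMap.const _ p) :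
    IccExtend (zero_le_one' ℝ) u 0 = p ∧ ∀ t ∈ Icc (0 : ℝ) 1,
      HasDerivWithinAt (IccExtend (zero_le_one' ℝ) u) (V (IccExtend (zero_le_one' ℝ) u t))
        (Icc 0 1) t := by
  have hc : Continuous (IccExtend (zero_le_one' ℝ) (V.comp u)) := (V.comp u).continuous.Icc_extend'
  have heq : ∀ t ∈ Icc (0 : ℝ) 1, IccExtend (zero_le_one' ℝ) u t
      = p + ∫ s in (0 : ℝ)..t, IccExtend (zero_le_one' ℝ) (V.comp u) s := by
    intro t ht
    have := congrArg (fun w : C(Icc (0 : ℝ) 1, P) => w ⟨t, ht⟩) h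
    simp only [ContinuousMap.sub_apply, primitive_apply, ContinuousMap.const_apply] at this
    rw [IccExtend_of_mem _ _ ht, ← this]
    simp
  refine ⟨by simpa using heq 0 (by simp), fun t ht => ?_⟩
  have hd : HasDerivAt (fun t => p + ∫ s in (0 : ℝ)..t, IccExtend (zero_le_one' ℝ) (V.comp u) s)
      (IccExtend (zero_le_one' ℝ) (V.comp u) t) t :=
    (intervalIntegral.integral_hasDerivAt_right (hc.intervalIntegrable _ _)
      (hc.stronglyMeasurableAtFilter _ _) hc.continuousAt).const_add p
  exact hd.hasDerivWithinAt.congr heq (heq t ht)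

/-- An integral curve solves the integral equation. -/
lemma sub_primitive_of_hasDerivWithinAt {P : Type*} [NormedAddCommGroup P] [NormedSpace ℝ P]
    [CompleteSpace P] (V : C(P, P)) (α : ℝ → P)
    (hα : ∀ t ∈ Icc (0 : ℝ) 1, HasDerivWithinAt α (V (α t)) (Icc 0 1) t)
    (u : C(Icc (0 : ℝ) 1, P)) (hu : ∀ t, u t = α t) :
    u - primitive P (V.comp u) = ContinuousMap.const _ (α 0) := by
  ext t
  simp only [ContinuousMap.sub_apply, primitive_apply, ContinuousMap.const_apply, hu]
  have hsub : Icc (0 : ℝ) t ⊆ Icc 0 1 := Icc_subset_Icc_right t.2.2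
  have h1 : ∫ s in (0 : ℝ)..t, IccExtend (zero_le_one' ℝ) (V.comp u) s = α t - α 0 := by
    refine intervalIntegral.integral_eq_sub_of_hasDerivAt_of_le t.2.1
      (fun s hs => ((hα s (hsub hs)).continuousWithinAt).mono hsub) (fun s hs => ?_)
      (((V.comp u).continuous.Icc_extend').intervalIntegrable _ _)
    have hs' : s ∈ Icc (0 : ℝ) 1 := hsub (Ioo_subset_Icc_self hs)
    have := (hα s hs').hasDerivAt (Icc_mem_nhds hs.1 (hs.2.trans_le t.2.2))
    rw [IccExtend_of_mem _ _ hs']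
    simpa [hu] using this
  rw [h1]
  abel

/-- The flow of a compactly supported smooth vector field depends smoothly on the initial point. -/
theorem exists_smooth_flow {P : Type u} [NormedAddCommGroup P] [NormedSpace ℝ P] [CompleteSpace P]
    {V : P → P} (hV : ContDiff ℝ ∞ V) (hc : HasCompactSupport V) :
    ∃ Fl : P → ℝ → P, (∀ p, Fl p 0 = p) ∧
      (∀ p, ∀ t ∈ Icc (0 : ℝ) 1, HasDerivWithinAt (Fl p) (V (Fl p t)) (Icc 0 1) t) ∧
      ContDiff ℝ ∞ (fun p => Fl p 1) := by
  obtain ⟨K, hK⟩ := ContDiff.lipschitzWith_of_hasCompactSupport hc hV (by simp)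
  obtain ⟨L, hL⟩ := hV.continuous.bounded_above_of_compact_support hc
  choose Fl hFl0 hFl using exists_integralCurve hK hL
  refine ⟨Fl, hFl0, hFl, contDiff_iff_contDiffAt.2 fun p₀ => ?_⟩
  let Vc : C(P, P) := ⟨V, hV.continuous⟩
  let V' : C(P, P →L[ℝ] P) := ⟨fderiv ℝ V, hV.continuous_fderiv (by simp)⟩
  let u₀ : C(Icc (0 : ℝ) 1, P) := ⟨fun t => Fl p₀ t, by
    exact continuousOn_iff_continuous_domRestrict.1
      (fun t ht => (hFl p₀ t ht).continuousWithinAt : ContinuousOn (Fl p₀) (Icc 0 1))⟩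
  -- Integral curves issuing from `p` are the solutions of `𝓖 u = const p`. The derivative of `𝓖` at
  -- a curve is one minus a Volterra operator, so the inverse function theorem in the space of
  -- curves gives solutions that depend smoothly on `p`.
  let 𝓖 : C(Icc (0 : ℝ) 1, P) → C(Icc (0 : ℝ) 1, P) := fun u => u - primitive P (Vc.comp u)
  have h𝓖 : ContDiff ℝ ∞ 𝓖 :=
    contDiff_id.sub ((primitive P).contDiff.comp (contDiff_postcomp Vc hV))
  obtain ⟨e, he⟩ := isUnit_one_sub_volterra (V'.comp u₀)
  let e' := ContinuousLinearEquiv.ofUnit e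
  have hd : HasFDerivAt 𝓖 (e' : C(Icc (0 : ℝ) 1, P) →L[ℝ] C(Icc (0 : ℝ) 1, P)) u₀ := by
    have h1 : (e' : C(Icc (0 : ℝ) 1, P) →L[ℝ] C(Icc (0 : ℝ) 1, P))
        = 1 - (primitive P).comp (pointwiseApply _ P P (V'.comp u₀)) := he
    rw [h1]
    exact (hasFDerivAt_id u₀).sub ((primitive P).hasFDerivAt.comp u₀
      (hasFDerivAt_postcomp Vc V' (fun p => (hV.differentiable (by simp) p).hasFDerivAt) u₀))
  have hs : HasStrictFDerivAt 𝓖 (e' : C(Icc (0 : ℝ) 1, P) →L[ℝ] C(Icc (0 : ℝ) 1, P)) u₀ :=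
    h𝓖.contDiffAt.hasStrictFDerivAt' hd (by simp)
  have h𝓖u : 𝓖 u₀ = ContinuousMap.const _ p₀ := by
    have := sub_primitive_of_hasDerivWithinAt Vc (Fl p₀) (hFl p₀) u₀ (fun _ => rfl)
    rwa [hFl0] at this
  have hinv := hs.eventually_right_inverse
  have hsm : ContDiffAt ℝ ∞ (h𝓖.contDiffAt.localInverse hd (by simp)) (𝓖 u₀) :=
    h𝓖.contDiffAt.to_localInverse hd (by simp)
  set g := h𝓖.contDiffAt.localInverse hd (by simp) with hg
  rw [h𝓖u] at hinv hsm
  let cst : P →L[ℝ] C(Icc (0 : ℝ) 1, P) := ContinuousLinearMap.const ℝ _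
  have hcst : Tendsto cst (𝓝 p₀) (𝓝 (ContinuousMap.const _ p₀)) := cst.continuous.tendsto p₀
  -- Uniqueness identifies the curves given by the local inverse with those of `Fl`; evaluation at
  -- time one is linear and continuous.
  have hev : (fun p => Fl p 1) =ᶠ[𝓝 p₀] fun p => ContinuousMap.evalCLM ℝ (⟨1, by simp⟩ : Icc (0:ℝ) 1)
      (g (cst p)) := by
    filter_upwards [hcst.eventually hinv] with p hp
    obtain ⟨h0, h1⟩ := hasDerivWithinAt_of_sub_primitive Vc (g (cst p)) p hp
    have := eqOn_of_hasDerivWithinAt_of_eq_zero hK (hFl p) h1 (by rw [hFl0, h0])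
    rw [this (right_mem_Icc.2 zero_le_one)]
    exact IccExtend_of_mem _ _ _
  refine ContDiffAt.congr_of_eventuallyEq ?_ hev
  exact (ContinuousMap.evalCLM ℝ _).contDiff.contDiffAt.comp p₀
    (ContDiffAt.comp p₀ hsm cst.contDiff.contDiffAt)

end Flow

/-! ### Potentials whose Hessian is the metric: the homothetic gradient. -/

section Core

set_option maxSynthPendingDepth 3

variable {E : Type u} [NormedAddCommGroup E] [NormedSpace ℝ E]

/-- `f` is a potential on the region `U` whose covariant Hessian with respect to the Riemannian
metric `G` is `G` itself, all the sublevel sets of `f` being compact. -/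
structure IsMetricPotential (U : Set E) (G : E → E →L[ℝ] E →L[ℝ] ℝ) (f : E → ℝ) : Prop where
  isOpen : IsOpen U
  preconnected : IsPreconnected U
  nonempty : U.Nonempty
  smooth_metric : ContDiffOn ℝ ∞ G U
  smooth : ContDiffOn ℝ ∞ f U
  symm : ∀ x ∈ U, ∀ a b, G x a b = G x b a
  pos : ∀ x ∈ U, ∀ a, a ≠ 0 → 0 < G x a a
  hess : ∀ x ∈ U, ∀ X, (∀ e, G x X e = fderiv ℝ f x e) → ∀ a b,
    G x a b = fderiv ℝ (fderiv ℝ f) x a b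
      - 1 / 2 * (fderiv ℝ G x a b X + fderiv ℝ G x b a X - fderiv ℝ G x X a b)
  compact : ∀ r, IsCompact {x ∈ U | f x ≤ r}

/-- The gradient of `f` with respect to the metric `G`. -/
def metricGradient (G : E → E →L[ℝ] E →L[ℝ] ℝ) (f : E → ℝ) (x : E) : E :=
  (G x).inverse (fderiv ℝ f x)

/-- The vector `Γᵏ_ij wⁱ wʲ`. -/
def geodesicTerm (G : E → E →L[ℝ] E →L[ℝ] ℝ) (p : E × E) : E :=
  (G p.1).inverse (fderiv ℝ G p.1 p.2 p.2
    - (1 / 2 : ℝ) • ((fderiv ℝ G p.1).flip p.2).flip p.2)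

/-- The geodesic vector field on the tangent bundle. -/
def geodesicField (G : E → E →L[ℝ] E →L[ℝ] ℝ) (p : E × E) : E × E :=
  (p.2, -geodesicTerm G p)

namespace IsMetricPotential

variable {U : Set E} {G : E → E →L[ℝ] E →L[ℝ] ℝ} {f : E → ℝ} (h : IsMetricPotential U G f)
include h

lemma eq_of_forall {x : E} (hx : x ∈ U) {a b : E} (hab : ∀ e, G x a e = G x b e) : a = b := by
  by_contra hne
  have := h.pos x hx (a - b) (sub_ne_zero.2 hne)
  have h2 : G x (a - b) = 0 := by ext e; simp [hab]
  simp [h2] at this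

lemma hasFDerivAt_metric {x : E} (hx : x ∈ U) : HasFDerivAt G (fderiv ℝ G x) x :=
  ((h.smooth_metric.contDiffAt (h.isOpen.mem_nhds hx)).differentiableAt (by simp)).hasFDerivAt

lemma hasFDerivAt_potential {x : E} (hx : x ∈ U) : HasFDerivAt f (fderiv ℝ f x) x :=
  ((h.smooth.contDiffAt (h.isOpen.mem_nhds hx)).differentiableAt (by simp)).hasFDerivAt

lemma hasFDerivAt_fderiv {x : E} (hx : x ∈ U) :
    HasFDerivAt (fderiv ℝ f) (fderiv ℝ (fderiv ℝ f) x) x :=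
  (((h.smooth.contDiffAt (h.isOpen.mem_nhds hx)).fderiv_right (m := ∞)
    (by simp)).differentiableAt (by simp)).hasFDerivAt

lemma hasDerivWithinAt_metric {γ a b : ℝ → E} {γ' a' b' : E} {s : Set ℝ} {t : ℝ}
    (hγ : HasDerivWithinAt γ γ' s t) (hγU : γ t ∈ U)
    (ha : HasDerivWithinAt a a' s t) (hb : HasDerivWithinAt b b' s t) :
    HasDerivWithinAt (fun t => G (γ t) (a t) (b t))
      (fderiv ℝ G (γ t) γ' (a t) (b t) + G (γ t) a' (b t) + G (γ t) (a t) b') s t := by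
  have h1 : HasDerivWithinAt (fun t => G (γ t)) (fderiv ℝ G (γ t) γ') s t :=
    (h.hasFDerivAt_metric hγU).comp_hasDerivWithinAt t hγ
  have h2 := (h1.clm_apply ha).clm_apply hb
  simpa using h2

lemma fderiv_metric_symm {x : E} (hx : x ∈ U) (v a b : E) :
    fderiv ℝ G x v a b = fderiv ℝ G x v b a := by
  have hl : HasDerivWithinAt (fun t : ℝ => x + t • v) v univ 0 := by
    simpa using (((hasDerivAt_id (0 : ℝ)).smul_const v).const_add x).hasDerivWithinAt (s := univ)
  have h1 := h.hasDerivWithinAt_metric hl (by simpa using hx) (hasDerivWithinAt_const _ _ a)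
    (hasDerivWithinAt_const _ _ b)
  have h2 := h.hasDerivWithinAt_metric hl (by simpa using hx) (hasDerivWithinAt_const _ _ b)
    (hasDerivWithinAt_const _ _ a)
  simp only [hasDerivWithinAt_univ, map_zero, zero_smul, add_zero,
    zero_apply] at h1 h2
  refine (h1.congr_of_eventuallyEq ?_).unique h2
  have hc : ContinuousAt (fun t : ℝ => x + t • v) 0 := by fun_prop
  have : ∀ᶠ t : ℝ in 𝓝 0, x + t • v ∈ U :=
    hc.eventually (h.isOpen.mem_nhds (by simpa using hx))
  filter_upwards [this] with t ht
  exact h.symm _ ht _ _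

lemma fderiv_fderiv_symm {x : E} (hx : x ∈ U) (a b : E) :
    fderiv ℝ (fderiv ℝ f) x a b = fderiv ℝ (fderiv ℝ f) x b a := by
  have := (h.smooth.contDiffAt (h.isOpen.mem_nhds hx)).isSymmSndFDerivAt
    (by simp; exact ENat.LEInfty.out)
  exact this a b

variable [FiniteDimensional ℝ E]

lemma exists_equiv {x : E} (hx : x ∈ U) :
    ∃ e : E ≃L[ℝ] (E →L[ℝ] ℝ), (e : E →L[ℝ] (E →L[ℝ] ℝ)) = G x := by
  have hinj : Function.Injective (G x : E →ₗ[ℝ] (E →L[ℝ] ℝ)) := fun a b hab =>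
    h.eq_of_forall hx fun e => by
      have : G x a = G x b := hab
      rw [this]
  have hfr : Module.finrank ℝ E = Module.finrank ℝ (E →L[ℝ] ℝ) := by
    rw [← LinearEquiv.finrank_eq (LinearMap.toContinuousLinearMap (𝕜 := ℝ) (E := E) (F' := ℝ))]
    exact Subspace.dual_finrank_eq.symm
  refine ⟨(LinearEquiv.ofInjectiveOfFinrankEq _ hinj hfr).toContinuousLinearEquiv, ?_⟩
  ext a b
  rfl

lemma apply_inverse {x : E} (hx : x ∈ U) (L : E →L[ℝ] ℝ) : G x ((G x).inverse L) = L := by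
  obtain ⟨e, he⟩ := h.exists_equiv hx
  rw [← he, ContinuousLinearMap.inverse_equiv]
  simp

lemma contDiffOn_inverse : ContDiffOn ℝ ∞ (fun x => (G x).inverse) U := by
  intro x hx
  obtain ⟨e, he⟩ := h.exists_equiv hx
  have := contDiffAt_map_inverse (𝕜 := ℝ) (n := ∞) e
  rw [he] at this
  exact this.comp_contDiffWithinAt x (h.smooth_metric x hx)

lemma gradient_apply {x : E} (hx : x ∈ U) (e : E) :
    G x (metricGradient G f x) e = fderiv ℝ f x e := by
  rw [metricGradient, h.apply_inverse hx]

lemma contDiffOn_gradient : ContDiffOn ℝ ∞ (metricGradient G f) U :=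
  h.contDiffOn_inverse.clm_apply (h.smooth.fderiv_of_isOpen h.isOpen (by simp))

lemma hasFDerivAt_gradient {x : E} (hx : x ∈ U) :
    HasFDerivAt (metricGradient G f) (fderiv ℝ (metricGradient G f) x) x :=
  ((h.contDiffOn_gradient.contDiffAt (h.isOpen.mem_nhds hx)).differentiableAt
    (by simp)).hasFDerivAt

lemma geodesicTerm_apply {p : E × E} (hx : p.1 ∈ U) (e : E) :
    G p.1 (geodesicTerm G p) e
      = fderiv ℝ G p.1 p.2 p.2 e - 1 / 2 * fderiv ℝ G p.1 e p.2 p.2 := by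
  rw [geodesicTerm, h.apply_inverse hx]
  simp

/-- Quadratic homogeneity in the velocity is what allows geodesics to be rescaled in time
(`geodesic_smul`). -/
lemma geodesicTerm_smul {x : E} (hx : x ∈ U) (s : ℝ) (w : E) :
    geodesicTerm G (x, s • w) = (s * s) • geodesicTerm G (x, w) := by
  refine h.eq_of_forall hx fun e => ?_
  have h1 := h.geodesicTerm_apply (p := (x, s • w)) hx e
  have h2 := h.geodesicTerm_apply (p := (x, w)) hx e
  simp only [map_smul, smul_apply, smul_eq_mul] at h1 h2 ⊢
  rw [h1, h2]
  ring

lemma contDiffOn_geodesicField : ContDiffOn ℝ ∞ (geodesicField G) (U ×ˢ univ) := by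
  have hfst : ContDiffOn ℝ ∞ (Prod.fst : E × E → E) (U ×ˢ univ) := contDiff_fst.contDiffOn
  have hsnd : ContDiffOn ℝ ∞ (Prod.snd : E × E → E) (U ×ˢ univ) := contDiff_snd.contDiffOn
  have hm : MapsTo (Prod.fst : E × E → E) (U ×ˢ univ) U := fun p hp => hp.1
  have h1 : ContDiffOn ℝ ∞ (fun p : E × E => fderiv ℝ G p.1) (U ×ˢ univ) :=
    (h.smooth_metric.fderiv_of_isOpen h.isOpen (m := ∞) (by simp)).comp hfst hm
  have hflip : ContDiffOn ℝ ∞ (fun p : E × E => (fderiv ℝ G p.1).flip) (U ×ˢ univ) :=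
    (ContinuousLinearMap.flipₗᵢ ℝ E E (E →L[ℝ] ℝ)).contDiff.comp_contDiffOn h1
  have hflip2 : ContDiffOn ℝ ∞ (fun p : E × E => ((fderiv ℝ G p.1).flip p.2).flip) (U ×ˢ univ) :=
    (ContinuousLinearMap.flipₗᵢ ℝ E E ℝ).contDiff.comp_contDiffOn (hflip.clm_apply hsnd)
  have h2 := ((h1.clm_apply hsnd).clm_apply hsnd).sub
    ((hflip2.clm_apply hsnd).const_smul (1 / 2 : ℝ))
  exact hsnd.prodMk (((h.contDiffOn_inverse.comp hfst hm).clm_apply h2).neg)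

/-- Derivative of the relation that defines the gradient. -/
lemma fderiv_gradient_apply {x : E} (hx : x ∈ U) (a e : E) :
    fderiv ℝ G x a (metricGradient G f x) e + G x (fderiv ℝ (metricGradient G f) x a) e
      = fderiv ℝ (fderiv ℝ f) x a e := by
  have h1 := ((h.hasFDerivAt_metric hx).clm_apply (h.hasFDerivAt_gradient hx)).clm_apply
    (hasFDerivAt_const e x)
  have h2 := (h.hasFDerivAt_fderiv hx).clm_apply (hasFDerivAt_const e x)
  have h3 : (fun y => G y (metricGradient G f y) e) =ᶠ[𝓝 x] fun y => fderiv ℝ f y e := by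
    filter_upwards [h.isOpen.mem_nhds hx] with y hy using h.gradient_apply hy e
  have := congrArg (fun L : E →L[ℝ] ℝ => L a) (h1.unique (h2.congr_of_eventuallyEq h3))
  simp only [add_apply, ContinuousLinearMap.comp_apply,
    ContinuousLinearMap.flip_apply, zero_apply, map_zero, zero_add] at this
  linarith

/-- The gradient is a homothetic vector field. -/
lemma homothety {x : E} (hx : x ∈ U) (a b : E) :
    2 * G x a b = G x (fderiv ℝ (metricGradient G f) x a) b
      + G x a (fderiv ℝ (metricGradient G f) x b)
      + fderiv ℝ G x (metricGradient G f x) a b := by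
  -- Differentiating `G X = df` along `a` and along `b` expresses the second derivative of `f` in
  -- two ways; substituting their sum in twice the Hessian equation leaves the Lie derivative of `G`
  -- along `X`.
  have h0 := h.hess x hx _ (h.gradient_apply hx) a b
  have h1 := h.fderiv_gradient_apply hx a b
  have h2 := h.fderiv_gradient_apply hx b a
  rw [h.fderiv_fderiv_symm hx b a] at h2
  rw [h.fderiv_metric_symm hx a] at h1
  rw [h.fderiv_metric_symm hx b] at h2
  rw [h.symm x hx a (fderiv ℝ (metricGradient G f) x b)]
  linarith

/-- Homothety with the gradient as one of its arguments: the left side is the differential of `df(X)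
= |X|²`, which thus equals `2 df`. -/
lemma fderiv_energy {x : E} (hx : x ∈ U) (a : E) :
    fderiv ℝ (fderiv ℝ f) x a (metricGradient G f x)
      + fderiv ℝ f x (fderiv ℝ (metricGradient G f) x a) = 2 * fderiv ℝ f x a := by
  have h0 := h.homothety hx a (metricGradient G f x)
  have h1 := h.fderiv_gradient_apply hx (metricGradient G f x) a
  have e1 := h.gradient_apply hx a
  have e2 := h.gradient_apply hx (fderiv ℝ (metricGradient G f) x a)
  rw [h.symm x hx] at e1 e2
  rw [h.fderiv_fderiv_symm hx] at h1
  rw [h.fderiv_metric_symm hx] at h1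
  rw [h.symm x hx _ a] at h1
  linarith

omit [FiniteDimensional ℝ E] in
lemma exists_isMin : ∃ c ∈ U, ∀ x ∈ U, f c ≤ f x := by
  obtain ⟨x₀, hx₀⟩ := h.nonempty
  obtain ⟨c, hc, hmin⟩ := (h.compact (f x₀)).exists_isMinOn ⟨x₀, hx₀, le_rfl⟩
    (h.smooth.continuousOn.mono fun x hx => hx.1)
  refine ⟨c, hc.1, fun x hx => ?_⟩
  by_cases hxx : f x ≤ f x₀
  · exact hmin ⟨hx, hxx⟩
  · exact hc.2.trans (le_of_not_ge hxx)

lemma gradient_eq_zero {c : E} (hc : c ∈ U) (hmin : ∀ x ∈ U, f c ≤ f x) :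
    metricGradient G f c = 0 := by
  have hl : IsLocalMin f c := by
    filter_upwards [h.isOpen.mem_nhds hc] with x hx using hmin x hx
  refine h.eq_of_forall hc fun e => ?_
  rw [h.gradient_apply hc, hl.fderiv_eq_zero]
  simp

/-- By `fderiv_energy` the function `|X|² - 2f` has zero derivative, so it is constant on the
preconnected region; at the minimum `X` vanishes. -/
lemma energy {c : E} (hc : c ∈ U) (hmin : ∀ x ∈ U, f c ≤ f x) {x : E} (hx : x ∈ U) :
    fderiv ℝ f x (metricGradient G f x) = 2 * (f x - f c) := by
  have hd : ∀ y ∈ U, HasFDerivAt (fun y => fderiv ℝ f y (metricGradient G f y) - 2 * f y)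
      (0 : E →L[ℝ] ℝ) y := by
    intro y hy
    have h1 := ((h.hasFDerivAt_fderiv hy).clm_apply (h.hasFDerivAt_gradient hy)).sub
      ((h.hasFDerivAt_potential hy).const_mul 2)
    refine h1.congr_fderiv ?_
    ext a
    have := h.fderiv_energy hy a
    simp
    linarith
  have := h.isOpen.is_const_of_fderiv_eq_zero h.preconnected
    (fun y hy => (hd y hy).differentiableAt.differentiableWithinAt)
    (fun y hy => (hd y hy).fderiv) hx hc
  rw [h.gradient_eq_zero hc hmin, map_zero] at this
  linarith

end IsMetricPotential
end Core

/-! ### Geodesics issuing from a critical point of the potential. -/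

section Geodesics

set_option maxSynthPendingDepth 3

lemma monotoneOn_Icc_of_hasDerivWithinAt {g g' : ℝ → ℝ}
    (hg : ∀ t ∈ Icc (0 : ℝ) 1, HasDerivWithinAt g (g' t) (Icc 0 1) t)
    (h0 : ∀ t ∈ Icc (0 : ℝ) 1, 0 ≤ g' t) : MonotoneOn g (Icc 0 1) :=
  monotoneOn_of_hasDerivWithinAt_nonneg (convex_Icc 0 1)
    (fun t ht => (hg t ht).continuousWithinAt)
    (fun t ht => (hg t (interior_subset ht)).mono interior_subset)
    (fun t ht => h0 t (interior_subset ht))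

lemma eq_of_hasDerivWithinAt_zero {g g' : ℝ → ℝ}
    (hg : ∀ t ∈ Icc (0 : ℝ) 1, HasDerivWithinAt g (g' t) (Icc 0 1) t)
    (h0 : ∀ t ∈ Icc (0 : ℝ) 1, g' t = 0) {t : ℝ} (ht : t ∈ Icc (0 : ℝ) 1) : g t = g 0 := by
  have h0' : (0 : ℝ) ∈ Icc (0 : ℝ) 1 := by simp
  refine le_antisymm ?_ (monotoneOn_Icc_of_hasDerivWithinAt hg (fun s hs => (h0 s hs).ge) h0' ht ht.1)
  have := monotoneOn_Icc_of_hasDerivWithinAt (fun s hs => (hg s hs).neg)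
    (fun s hs => by rw [h0 s hs, neg_zero]) h0' ht ht.1
  simpa using this

variable {E : Type u} [NormedAddCommGroup E] [NormedSpace ℝ E]

/-- `α = (γ, γ')` is a geodesic of the metric `G` in `U` on the unit interval, issuing from the
tangent vector `p`. -/
def IsGeodesicFrom (U : Set E) (G : E → E →L[ℝ] E →L[ℝ] ℝ) (p : E × E) (α : ℝ → E × E) : Prop :=
  α 0 = p ∧ ∀ t ∈ Icc (0 : ℝ) 1, (α t).1 ∈ U ∧
    HasDerivWithinAt α (geodesicField G (α t)) (Icc 0 1) t

namespace IsMetricPotential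

variable [FiniteDimensional ℝ E]
variable {U : Set E} {G : E → E →L[ℝ] E →L[ℝ] ℝ} {f : E → ℝ} (h : IsMetricPotential U G f)
include h

omit [FiniteDimensional ℝ E] in
lemma metric_nonneg {c : E} (hc : c ∈ U) (v : E) : 0 ≤ G c v v := by
  by_cases hz : v = 0
  · simp [hz]
  · exact (h.pos _ hc _ hz).le

/-! ### Estimates along integral curves of the geodesic field multiplied by a scalar factor. -/

section Reparametrized

variable {α : ℝ → E × E} {χ : ℝ → ℝ}
    (hα : ∀ t ∈ Icc (0 : ℝ) 1, (α t).1 ∈ U ∧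
      HasDerivWithinAt α (χ t • geodesicField G (α t)) (Icc 0 1) t)
include hα

omit h [FiniteDimensional ℝ E] in
lemma hasDerivWithinAt_fst {t : ℝ} (ht : t ∈ Icc (0 : ℝ) 1) :
    HasDerivWithinAt (fun t => (α t).1) (χ t • (α t).2) (Icc 0 1) t :=
  (hasFDerivAt_fst (𝕜 := ℝ) (p := α t)).comp_hasDerivWithinAt t (hα t ht).2

omit h [FiniteDimensional ℝ E] in
lemma hasDerivWithinAt_snd {t : ℝ} (ht : t ∈ Icc (0 : ℝ) 1) :
    HasDerivWithinAt (fun t => (α t).2) (-(χ t • geodesicTerm G (α t))) (Icc 0 1) t := by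
  have := (hasFDerivAt_snd (𝕜 := ℝ) (p := α t)).comp_hasDerivWithinAt t (hα t ht).2
  exact this.congr_deriv (by simp [geodesicField])

/-- The two acceleration terms cancel the derivative of the metric, by the definition of
`geodesicTerm`; the factor `χ` merely multiplies the whole derivative. -/
lemma speed_const {t : ℝ} (ht : t ∈ Icc (0 : ℝ) 1) :
    G (α t).1 (α t).2 (α t).2 = G (α 0).1 (α 0).2 (α 0).2 := by
  refine eq_of_hasDerivWithinAt_zero (fun s hs => h.hasDerivWithinAt_metric
    (hasDerivWithinAt_fst hα hs) (hα s hs).1 (hasDerivWithinAt_snd hα hs)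
    (hasDerivWithinAt_snd hα hs)) (fun s hs => ?_) ht
  have h1 := h.geodesicTerm_apply (hα s hs).1 (α s).2
  have h2 := h.symm _ (hα s hs).1 (α s).2 (geodesicTerm G (α s))
  simp only [map_smul, map_neg, smul_apply, neg_apply, smul_eq_mul]
  rw [h2, h1]
  ring

/-- Pairing the geodesic term with the gradient of `f` turns the derivative into the covariant
Hessian on the velocity, which is the metric itself. -/
lemma hasDerivWithinAt_fderiv_snd {t : ℝ} (ht : t ∈ Icc (0 : ℝ) 1) :
    HasDerivWithinAt (fun t => fderiv ℝ f (α t).1 (α t).2)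
      (χ t * G (α t).1 (α t).2 (α t).2) (Icc 0 1) t := by
  have hU := (hα t ht).1
  have h0 : HasDerivWithinAt (fun t => fderiv ℝ f (α t).1)
      (fderiv ℝ (fderiv ℝ f) (α t).1 (χ t • (α t).2)) (Icc 0 1) t :=
    (h.hasFDerivAt_fderiv hU).comp_hasDerivWithinAt t (hasDerivWithinAt_fst hα ht)
  refine (h0.clm_apply (hasDerivWithinAt_snd hα ht)).congr_deriv ?_
  have h1 := h.geodesicTerm_apply hU (metricGradient G f (α t).1)
  rw [h.symm _ hU, h.gradient_apply hU] at h1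
  have h2 := h.hess _ hU _ (h.gradient_apply hU) (α t).2 (α t).2
  simp only [map_smul, map_neg, smul_apply, smul_eq_mul]
  rw [h1, h2]
  ring

omit [FiniteDimensional ℝ E] in
lemma hasDerivWithinAt_potential {t : ℝ} (ht : t ∈ Icc (0 : ℝ) 1) :
    HasDerivWithinAt (fun t => f (α t).1) (χ t * fderiv ℝ f (α t).1 (α t).2) (Icc 0 1) t := by
  have := (h.hasFDerivAt_potential (hα t ht).1).comp_hasDerivWithinAt t
    (hasDerivWithinAt_fst hα ht)
  rw [map_smul, smul_eq_mul] at this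
  exact this

/-- Two integrations: `df(w)` grows at rate `χ H ≤ H`, so it is at most `t H`, and `f` grows at rate
`χ df(w) ≤ t H`. The bound must be available for all factors in `[0, 1]`, since it is used to show
that a cut-off factor equals one along the curve. -/
lemma potential_le (hχ : ∀ t, χ t ∈ Icc (0 : ℝ) 1) (hcrit : fderiv ℝ f (α 0).1 = 0)
    {t : ℝ} (ht : t ∈ Icc (0 : ℝ) 1) :
    f (α t).1 ≤ f (α 0).1 + G (α 0).1 (α 0).2 (α 0).2 / 2 := by
  set H := G (α 0).1 (α 0).2 (α 0).2 with hH
  have h0' : (0 : ℝ) ∈ Icc (0 : ℝ) 1 := by simp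
  have hH0 : 0 ≤ H := h.metric_nonneg (hα 0 h0').1 _
  have ha : ∀ s ∈ Icc (0 : ℝ) 1, fderiv ℝ f (α s).1 (α s).2 ≤ s * H := by
    intro s hs
    have := monotoneOn_Icc_of_hasDerivWithinAt
      (fun r hr => ((hasDerivWithinAt_id r (Icc (0 : ℝ) 1)).mul_const H).sub
        (h.hasDerivWithinAt_fderiv_snd hα hr))
      (fun r hr => by
        rw [h.speed_const hα hr]
        have := (hχ r).2
        nlinarith) h0' hs hs.1
    simp [hcrit] at this
    linarith
  have := monotoneOn_Icc_of_hasDerivWithinAt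
      (fun r hr => (((hasDerivWithinAt_id r (Icc (0 : ℝ) 1)).pow 2).mul_const (H / 2)).sub
        (h.hasDerivWithinAt_potential hα hr))
      (fun r hr => by
        have h1 := ha r hr
        have h2 := hχ r
        have h3 : 0 ≤ r * H := mul_nonneg hr.1 hH0
        have : χ r * fderiv ℝ f (α r).1 (α r).2 ≤ r * H := by
          rcases le_total (fderiv ℝ f (α r).1 (α r).2) 0 with h4 | h4
          · nlinarith [h2.1]
          · nlinarith [h2.1, h2.2]
        simp
        linarith) h0' ht ht.1
  simp at this
  have h5 : t ^ 2 * (H / 2) ≤ H / 2 := by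
    have : t ^ 2 ≤ 1 := pow_le_one₀ ht.1 ht.2
    nlinarith
  linarith

end Reparametrized

section Geodesic

variable {c v : E} {α : ℝ → E × E} (hα : IsGeodesicFrom U G (c, v) α)
  (hcrit : fderiv ℝ f c = 0)

omit h [FiniteDimensional ℝ E] in
lemma _root_.FluctuationGeometry.IsGeodesicFrom.reparam (hα : IsGeodesicFrom U G (c, v) α) :
    ∀ t ∈ Icc (0 : ℝ) 1, (α t).1 ∈ U ∧
      HasDerivWithinAt α ((fun _ => (1 : ℝ)) t • geodesicField G (α t)) (Icc 0 1) t := by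
  simpa using hα.2

include hα

lemma geodesic_speed {t : ℝ} (ht : t ∈ Icc (0 : ℝ) 1) :
    G (α t).1 (α t).2 (α t).2 = G c v v := by
  have := h.speed_const hα.reparam ht
  rwa [hα.1] at this

include hcrit

lemma geodesic_potential_le {t : ℝ} (ht : t ∈ Icc (0 : ℝ) 1) :
    f (α t).1 ≤ f c + G c v v / 2 := by
  have := h.potential_le hα.reparam (fun _ => by simp) (by rwa [hα.1]) ht
  rwa [hα.1] at this

lemma geodesic_fderiv {t : ℝ} (ht : t ∈ Icc (0 : ℝ) 1) :
    fderiv ℝ f (α t).1 (α t).2 = t * G c v v := by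
  have := eq_of_hasDerivWithinAt_zero
    (fun r hr => (h.hasDerivWithinAt_fderiv_snd hα.reparam hr).sub
      ((hasDerivWithinAt_id r (Icc (0 : ℝ) 1)).mul_const (G c v v)))
    (fun r hr => by rw [h.geodesic_speed hα hr]; ring) ht
  simp [hα.1, hcrit] at this
  linarith

/-- Along a geodesic the second derivative of `f` is the constant squared speed, and the first
derivative vanishes at the critical point. -/
lemma geodesic_potential {t : ℝ} (ht : t ∈ Icc (0 : ℝ) 1) :
    f (α t).1 = f c + t ^ 2 * G c v v / 2 := by
  have := eq_of_hasDerivWithinAt_zero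
    (fun r hr => (h.hasDerivWithinAt_potential hα.reparam hr).sub
      (((hasDerivWithinAt_id r (Icc (0 : ℝ) 1)).pow 2).mul_const (G c v v / 2)))
    (fun r hr => by rw [h.geodesic_fderiv hα hcrit hr]; simp; ring) ht
  simp [hα.1] at this
  linarith

end Geodesic

/-! ### A compactly supported cut-off of the geodesic field. -/

section Cutoff

/-- The metric has a positive minimum on the compact product of a sublevel set with the unit sphere;
homogeneity does the rest. -/
lemma exists_pos_le_metric (r : ℝ) :
    ∃ m > 0, ∀ x ∈ U, f x ≤ r → ∀ w, m * ‖w‖ ^ 2 ≤ G x w w := by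
  have hcpt : IsCompact ({x ∈ U | f x ≤ r} ×ˢ Metric.sphere (0 : E) 1) :=
    (h.compact r).prod (isCompact_sphere 0 1)
  have hcont : ContinuousOn (fun p : E × E => G p.1 p.2 p.2)
      ({x ∈ U | f x ≤ r} ×ˢ Metric.sphere (0 : E) 1) := by
    have h1 : ContinuousOn (fun p : E × E => G p.1) ({x ∈ U | f x ≤ r} ×ˢ Metric.sphere (0 : E) 1) :=
      h.smooth_metric.continuousOn.comp continuousOn_fst fun p hp => hp.1.1
    exact (h1.clm_apply continuousOn_snd).clm_apply continuousOn_snd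
  have key : ∃ m > 0, ∀ x ∈ U, f x ≤ r → ∀ w, ‖w‖ = 1 → m ≤ G x w w := by
    rcases (({x ∈ U | f x ≤ r} ×ˢ Metric.sphere (0 : E) 1)).eq_empty_or_nonempty with he | hne
    · refine ⟨1, one_pos, fun x hx hxr w hw => ?_⟩
      have : (x, w) ∈ ({x ∈ U | f x ≤ r} ×ˢ Metric.sphere (0 : E) 1) := ⟨⟨hx, hxr⟩, by simpa using hw⟩
      rw [he] at this
      exact this.elim
    · obtain ⟨p, hp, hmin⟩ := hcpt.exists_isMinOn hne hcont
      refine ⟨G p.1 p.2 p.2, h.pos _ hp.1.1 _ fun h0 => ?_, fun x hx hxr w hw => ?_⟩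
      · have := hp.2
        rw [h0] at this
        simp at this
      · exact hmin (a := (x, w)) ⟨⟨hx, hxr⟩, by simpa using hw⟩
  obtain ⟨m, hm, H⟩ := key
  refine ⟨m, hm, fun x hx hxr w => ?_⟩
  by_cases hw : w = 0
  · simp [hw]
  · have hn : ‖w‖ ≠ 0 := norm_ne_zero_iff.2 hw
    have := H x hx hxr (‖w‖⁻¹ • w) (by rw [norm_smul, norm_inv, norm_norm, inv_mul_cancel₀ hn])
    simp only [map_smul, smul_apply, smul_eq_mul] at this
    calc m * ‖w‖ ^ 2 ≤ (‖w‖⁻¹ * (‖w‖⁻¹ * G x w w)) * ‖w‖ ^ 2 := by gcongr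
      _ = G x w w := by field_simp

variable {c : E}

/-- The geodesic field agrees with a compactly supported field on the tangent vectors of bounded
length over a sublevel set. -/
lemma exists_cutoff (R : ℝ) :
    ∃ χ : E × E → ℝ, (∀ p, χ p ∈ Icc (0 : ℝ) 1) ∧
      ContDiff ℝ ∞ (fun p => χ p • geodesicField G p) ∧
      HasCompactSupport (fun p => χ p • geodesicField G p) ∧
      (∀ p, p.1 ∉ U → χ p = 0) ∧
      ∀ p : E × E, p.1 ∈ U → f p.1 ≤ f c + R / 2 → G p.1 p.2 p.2 ≤ R → χ p = 1 := by
  obtain ⟨m, hm, H⟩ := h.exists_pos_le_metric (f c + R / 2)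
  -- The radius is chosen so that `m‖w‖² ≤ G(w, w) ≤ R` places `w` in the ball.
  set T : Set (E × E) := {x ∈ U | f x ≤ f c + R / 2} ×ˢ Metric.closedBall (0 : E) (√(R / m)) with hT
  have hTc : IsCompact T := (h.compact _).prod (isCompact_closedBall _ _)
  have hTU : T ⊆ U ×ˢ univ := fun p hp => ⟨hp.1.1, mem_univ _⟩
  have hUo : IsOpen (U ×ˢ (univ : Set E)) := h.isOpen.prod isOpen_univ
  -- The cut-off vanishes off a compact `T'` inside `U ×ˢ univ`, so the product extends smoothly by
  -- zero where the geodesic field is not known to be smooth.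
  obtain ⟨T', hT'c, hTT', hT'U⟩ := exists_compact_between hTc hUo hTU
  obtain ⟨χ, hχ1, hχ0, hχI⟩ := exists_contMDiffMap_one_nhds_of_subset_interior
    (modelWithCornersSelf ℝ (E × E)) (n := (⊤ : ℕ∞)) hTc.isClosed hTT'
  have hχs : ContDiff ℝ ∞ χ := χ.contMDiff.contDiff
  refine ⟨χ, hχI, ?_, ?_, fun p hp => hχ0 p fun hpT => hp (hT'U hpT).1, fun p hpU hpf hpG => ?_⟩
  · rw [contDiff_iff_contDiffAt]
    intro p
    by_cases hp : p ∈ U ×ˢ (univ : Set E)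
    · exact hχs.contDiffAt.smul (h.contDiffOn_geodesicField.contDiffAt (hUo.mem_nhds hp))
    · have hp' : p ∈ T'ᶜ := fun hpT => hp (hT'U hpT)
      refine (contDiffAt_const (c := (0 : E × E))).congr_of_eventuallyEq ?_
      filter_upwards [hT'c.isClosed.isOpen_compl.mem_nhds hp'] with q hq
      rw [hχ0 q hq, zero_smul]
  · exact HasCompactSupport.intro hT'c fun p hp => by rw [hχ0 p hp, zero_smul]
  · refine hχ1.self_of_nhdsSet p ⟨⟨hpU, hpf⟩, ?_⟩
    rw [mem_closedBall_zero_iff]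
    refine Real.le_sqrt_of_sq_le ?_
    rw [le_div_iff₀ hm, mul_comm]
    exact (H _ hpU hpf _).trans hpG

end Cutoff

/-! ### Completeness at the critical point and the exponential map. -/

section Exp

variable {c : E} (hc : c ∈ U) (hcrit : fderiv ℝ f c = 0)
include hc hcrit

/-- The cut-off field has a smooth flow on the unit interval. The a priori bounds on speed and
potential confine its trajectories from `(c, v)`, with squared length of `v` at most `R`, to the
region where the cut-off is one, so they are true geodesics. -/
lemma exists_flow (R : ℝ) :
    ∃ (W : E × E → E × E) (K : NNReal) (Fl : E × E → ℝ → E × E), LipschitzWith K W ∧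
      ContDiff ℝ ∞ (fun p => Fl p 1) ∧
      (∀ v α, G c v v ≤ R → IsGeodesicFrom U G (c, v) α →
        ∀ t ∈ Icc (0 : ℝ) 1, geodesicField G (α t) = W (α t)) ∧
      ∀ v, G c v v ≤ R → IsGeodesicFrom U G (c, v) (Fl (c, v)) := by
  obtain ⟨χ, hχI, hWs, hWc, hχU, hχ1⟩ := h.exists_cutoff (c := c) R
  obtain ⟨Fl, hFl0, hFl, hFls⟩ := exists_smooth_flow hWs hWc
  obtain ⟨K, hK⟩ := ContDiff.lipschitzWith_of_hasCompactSupport hWc hWs (by simp)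
  refine ⟨_, K, Fl, hK, hFls, fun v α hv hα t ht => ?_, fun v hv => ?_⟩
  · rw [hχ1 (α t) (hα.2 t ht).1, one_smul]
    · exact (h.geodesic_potential_le hα hcrit ht).trans (by linarith)
    · rw [h.geodesic_speed hα ht]; exact hv
  -- Over a point outside `U` the cut-off field vanishes, so the constant curve is a solution; by
  -- backward uniqueness the trajectory would have started there, whereas it starts over `c ∈ U`.
  · have hU : ∀ t ∈ Icc (0 : ℝ) 1, (Fl (c, v) t).1 ∈ U := by
      intro t ht
      by_contra hn
      have hsub : Icc (0 : ℝ) t ⊆ Icc 0 1 := Icc_subset_Icc_right ht.2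
      have := eqOn_of_hasDerivWithinAt_of_eq_right hK (b := t) (α := Fl (c, v))
        (β := fun _ => Fl (c, v) t) (fun s hs => (hFl (c, v) s (hsub hs)).mono hsub)
        (fun s _ => by
          rw [hχU _ hn, zero_smul]
          exact hasDerivWithinAt_const _ _ _) rfl (left_mem_Icc.2 ht.1)
      rw [hFl0] at this
      simp only at this
      rw [← this] at hn
      exact hn hc
    have hre : ∀ t ∈ Icc (0 : ℝ) 1, (Fl (c, v) t).1 ∈ U ∧ HasDerivWithinAt (Fl (c, v))
        ((fun t => χ (Fl (c, v) t)) t • geodesicField G (Fl (c, v) t)) (Icc 0 1) t :=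
      fun t ht => ⟨hU t ht, hFl _ t ht⟩
    refine ⟨hFl0 _, fun t ht => ⟨hU t ht, ?_⟩⟩
    have h1 : χ (Fl (c, v) t) = 1 := by
      refine hχ1 _ (hU t ht) ?_ ?_
      · have := h.potential_le hre (fun _ => hχI _) (by rwa [hFl0]) ht
        rw [hFl0] at this
        simp only at this
        linarith
      · rw [h.speed_const hre ht, hFl0]
        exact hv
    have := hFl (c, v) t ht
    rwa [h1, one_smul] at this

lemma geodesic_unique {v : E} {α β : ℝ → E × E} (hα : IsGeodesicFrom U G (c, v) α)
    (hβ : IsGeodesicFrom U G (c, v) β) : EqOn α β (Icc 0 1) := by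
  obtain ⟨W, K, Fl, hK, -, hW, -⟩ := h.exists_flow hc hcrit (G c v v)
  refine eqOn_of_hasDerivWithinAt_of_eq_zero hK (fun t ht => ?_) (fun t ht => ?_)
    (hα.1.trans hβ.1.symm)
  · rw [← hW v α le_rfl hα t ht]; exact (hα.2 t ht).2
  · rw [← hW v β le_rfl hβ t ht]; exact (hβ.2 t ht).2

lemma geodesic_unique_of_end {v w : E} {α β : ℝ → E × E} (hα : IsGeodesicFrom U G (c, v) α)
    (hβ : IsGeodesicFrom U G (c, w) β) (h1 : α 1 = β 1) : v = w := by
  obtain ⟨W, K, Fl, hK, -, hW, -⟩ := h.exists_flow hc hcrit (max (G c v v) (G c w w))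
  have := eqOn_of_hasDerivWithinAt_of_eq_right hK (fun t ht => by
      rw [← hW v α (le_max_left _ _) hα t ht]; exact (hα.2 t ht).2)
    (fun t ht => by
      rw [← hW w β (le_max_right _ _) hβ t ht]; exact (hβ.2 t ht).2) h1
    (left_mem_Icc.2 zero_le_one)
  rw [hα.1, hβ.1] at this
  exact congrArg Prod.snd this

/-- The exponential map at a critical point is defined on the whole tangent space and smooth. -/
lemma exists_exp : ∃ γ : E → ℝ → E × E, (∀ v, IsGeodesicFrom U G (c, v) (γ v)) ∧
    ContDiff ℝ ∞ (fun v => (γ v 1).1) := by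
  have hex : ∀ v, ∃ α, IsGeodesicFrom U G (c, v) α := fun v => by
    obtain ⟨W, K, Fl, -, -, -, hFl⟩ := h.exists_flow hc hcrit (G c v v)
    exact ⟨_, hFl v le_rfl⟩
  choose γ hγ using hex
  refine ⟨γ, hγ, contDiff_iff_contDiffAt.2 fun v₀ => ?_⟩
  -- The margin of one lets a single smooth flow compute the geodesics of all `v` close to `v₀`.
  obtain ⟨W, K, Fl, -, hs, -, hFl⟩ := h.exists_flow hc hcrit (G c v₀ v₀ + 1)
  have hcont : ContinuousAt (fun v => G c v v) v₀ := by fun_prop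
  have hev : ∀ᶠ v in 𝓝 v₀, G c v v < G c v₀ v₀ + 1 :=
    hcont.eventually (gt_mem_nhds (lt_add_one _))
  refine ContDiffAt.congr_of_eventuallyEq (f := fun v => (Fl (c, v) 1).1) ?_ ?_
  · exact (contDiff_fst.comp (hs.comp (contDiff_prodMk_right c))).contDiffAt
  · filter_upwards [hev] with v hv
    rw [h.geodesic_unique hc hcrit (hγ v) (hFl v hv.le) (right_mem_Icc.2 zero_le_one)]

omit hc hcrit in
lemma geodesic_smul {v : E} {α : ℝ → E × E} (hα : IsGeodesicFrom U G (c, v) α) {s : ℝ}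
    (hs : s ∈ Icc (0 : ℝ) 1) :
    IsGeodesicFrom U G (c, s • v) (fun t => ((α (s * t)).1, s • (α (s * t)).2)) := by
  refine ⟨by simp [hα.1], fun t ht => ?_⟩
  have hst : s * t ∈ Icc (0 : ℝ) 1 := ⟨mul_nonneg hs.1 ht.1, mul_le_one₀ hs.2 ht.1 ht.2⟩
  have hm : MapsTo (fun t => s * t) (Icc (0 : ℝ) 1) (Icc 0 1) := fun r hr =>
    ⟨mul_nonneg hs.1 hr.1, mul_le_one₀ hs.2 hr.1 hr.2⟩
  have hl : HasDerivWithinAt (fun t : ℝ => s * t) s (Icc 0 1) t := by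
    simpa using (hasDerivWithinAt_id t (Icc (0 : ℝ) 1)).const_mul s
  have hU := (hα.2 _ hst).1
  refine ⟨hU, ?_⟩
  have h1 := (hasDerivWithinAt_fst hα.reparam hst).scomp t hl hm
  have h2 := ((hasDerivWithinAt_snd hα.reparam hst).scomp t hl hm).const_smul s
  refine (h1.prodMk h2).congr_deriv ?_
  have h3 := h.geodesicTerm_smul hU s (α (s * t)).2
  simp only [geodesicField, Prod.mk.injEq, one_smul, true_and, Prod.mk.eta] at h3 ⊢
  rw [h3, smul_neg, smul_neg, smul_smul]

end Exp

end IsMetricPotential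
end Geodesics

/-! ### The exponential map at the minimum is a global isometry. -/

section Chart

set_option maxSynthPendingDepth 3

namespace IsMetricPotential

variable {E : Type u} [NormedAddCommGroup E] [NormedSpace ℝ E] [FiniteDimensional ℝ E]
variable {U : Set E} {G : E → E →L[ℝ] E →L[ℝ] ℝ} {f : E → ℝ} (h : IsMetricPotential U G f)
include h

/-- Geodesics issuing from the minimum of the potential, and the exponential map. -/
lemma exists_radial {c : E} (hc : c ∈ U) (hmin : ∀ x ∈ U, f c ≤ f x) :
    ∃ Ψ : E → E, ContDiff ℝ ∞ Ψ ∧ Ψ 0 = c ∧ fderiv ℝ Ψ 0 = ContinuousLinearMap.id ℝ E ∧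
      (∀ v, Ψ v ∈ U) ∧ (∀ v, f (Ψ v) = f c + G c v v / 2) ∧
      (∀ v, fderiv ℝ Ψ v v = metricGradient G f (Ψ v)) ∧ Function.Injective Ψ := by
  have hcrit : fderiv ℝ f c = 0 := by
    have hl : IsLocalMin f c := by
      filter_upwards [h.isOpen.mem_nhds hc] with x hx using hmin x hx
    exact hl.fderiv_eq_zero
  obtain ⟨γ, hγ, hs⟩ := h.exists_exp hc hcrit
  have h1m : (1 : ℝ) ∈ Icc (0 : ℝ) 1 := by simp
  have h0m : (0 : ℝ) ∈ Icc (0 : ℝ) 1 := by simp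
  have hray : ∀ v, ∀ s ∈ Icc (0 : ℝ) 1, (γ (s • v) 1).1 = (γ v s).1 := by
    intro v s hs
    have := h.geodesic_unique hc hcrit (hγ (s • v)) (h.geodesic_smul (hγ v) hs) h1m
    rw [this]
    simp
  -- The curve `s ↦ exp(s v)` is the geodesic of `v`; its velocity is computed in two ways.
  have hrd : ∀ v, ∀ s ∈ Icc (0 : ℝ) 1,
      fderiv ℝ (fun v => (γ v 1).1) (s • v) v = (γ v s).2 := by
    intro v s hs'
    have e1 : HasDerivWithinAt (fun s : ℝ => (γ (s • v) 1).1)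
        (fderiv ℝ (fun v => (γ v 1).1) (s • v) v) (Icc 0 1) s := by
      have hl : HasDerivWithinAt (fun s : ℝ => s • v) v (Icc 0 1) s := by
        simpa using (hasDerivWithinAt_id s (Icc (0 : ℝ) 1)).smul_const v
      exact ((hs.differentiable (by simp) (s • v)).hasFDerivAt).comp_hasDerivWithinAt s hl
    have e2 : HasDerivWithinAt (fun s : ℝ => (γ (s • v) 1).1) ((γ v s).2) (Icc 0 1) s := by
      have := hasDerivWithinAt_fst (hγ v).reparam hs'
      rw [one_smul] at this
      exact this.congr (fun r hr => hray v r hr) (hray v s hs')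
    exact (uniqueDiffOn_Icc zero_lt_one s hs').eq_deriv _ e1 e2
  -- With `w` the terminal velocity, `|w|²`, `G(X, w) = df(w)` and `|X|² = 2(f - f(c))` are all
  -- equal to `G c v v`, so `|w - X|² = 0`.
  have hend : ∀ v, (γ v 1).2 = metricGradient G f (γ v 1).1 := by
    intro v
    have hU := ((hγ v).2 1 h1m).1
    have k1 := h.geodesic_speed (hγ v) h1m
    have k2 := h.geodesic_fderiv (hγ v) hcrit h1m
    have k3 := h.geodesic_potential (hγ v) hcrit h1m
    have k4 := h.energy hc hmin hU
    have k5 := h.gradient_apply hU (γ v 1).2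
    have k6 := h.gradient_apply hU (metricGradient G f (γ v 1).1)
    have k7 := h.symm _ hU (γ v 1).2 (metricGradient G f (γ v 1).1)
    by_contra hne
    have := h.pos _ hU _ (sub_ne_zero.2 hne)
    simp only [map_sub, sub_apply] at this
    linarith
  refine ⟨fun v => (γ v 1).1, hs, ?_, ?_, fun v => ((hγ v).2 1 h1m).1, fun v => ?_, fun v => ?_,
    fun v w hvw => ?_⟩
  · have := hray 0 0 h0m
    simpa [(hγ 0).1] using this
  · ext v
    have := hrd v 0 h0m
    rw [zero_smul, (hγ v).1] at this
    simpa using this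
  · have := h.geodesic_potential (hγ v) hcrit h1m
    simpa using this
  · have := hrd v 1 h1m
    rw [one_smul] at this
    rw [this, hend]
  -- The end point determines the terminal velocity, which is the gradient there, and backward
  -- uniqueness recovers the initial one.
  · refine h.geodesic_unique_of_end hc hcrit (hγ v) (hγ w) (Prod.ext hvw ?_)
    rw [hend v, hend w]
    exact congrArg _ hvw

/-- The exponential map at the minimum of the potential is an isometry. -/
lemma pullback_const {c : E} {Ψ : E → E} (hs : ContDiff ℝ ∞ Ψ) (h0 : Ψ 0 = c)
    (hd0 : fderiv ℝ Ψ 0 = ContinuousLinearMap.id ℝ E) (hU : ∀ v, Ψ v ∈ U)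
    (hX : ∀ v, fderiv ℝ Ψ v v = metricGradient G f (Ψ v)) (v a b : E) :
    G (Ψ v) (fderiv ℝ Ψ v a) (fderiv ℝ Ψ v b) = G c a b := by
  have hdΨ : ∀ p, HasFDerivAt Ψ (fderiv ℝ Ψ p) p := fun p =>
    (hs.differentiable (by simp) p).hasFDerivAt
  have hs' : ContDiff ℝ ∞ (fderiv ℝ Ψ) := hs.fderiv_right (by simp)
  have hd2 : ∀ p, HasFDerivAt (fderiv ℝ Ψ) (fderiv ℝ (fderiv ℝ Ψ) p) p := fun p =>
    (hs'.differentiable (by simp) p).hasFDerivAt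
  have hsymm : ∀ p a b, fderiv ℝ (fderiv ℝ Ψ) p a b = fderiv ℝ (fderiv ℝ Ψ) p b a := fun p a b =>
    (hs.contDiffAt (x := p)).isSymmSndFDerivAt (by simp; exact ENat.LEInfty.out) a b
  -- Obtained by differentiating `dΨ_p(p) = X(Ψ p)` in `p`.
  have hlin : ∀ p a, fderiv ℝ (fderiv ℝ Ψ) p p a
      = fderiv ℝ (metricGradient G f) (Ψ p) (fderiv ℝ Ψ p a) - fderiv ℝ Ψ p a := by
    intro p a
    have e1 := (hd2 p).clm_apply (hasFDerivAt_id p)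
    have e2 : HasFDerivAt (fun v => fderiv ℝ Ψ v v)
        ((fderiv ℝ (metricGradient G f) (Ψ p)).comp (fderiv ℝ Ψ p)) p := by
      simp only [hX]
      exact (h.hasFDerivAt_gradient (hU p)).comp p (hdΨ p)
    have := congrArg (fun L : E →L[ℝ] E => L a) (e1.unique e2)
    simp at this
    rw [hsymm p p a, ← this]
    abel
  have hderiv : ∀ s : ℝ, HasDerivAt (fun s : ℝ => G (Ψ (s • v)) (fderiv ℝ Ψ (s • v) a)
      (fderiv ℝ Ψ (s • v) b)) (fderiv ℝ G (Ψ (s • v)) (fderiv ℝ Ψ (s • v) v)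
        (fderiv ℝ Ψ (s • v) a) (fderiv ℝ Ψ (s • v) b)
      + G (Ψ (s • v)) (fderiv ℝ (fderiv ℝ Ψ) (s • v) v a) (fderiv ℝ Ψ (s • v) b)
      + G (Ψ (s • v)) (fderiv ℝ Ψ (s • v) a) (fderiv ℝ (fderiv ℝ Ψ) (s • v) v b)) s := by
    intro s
    have hl : HasDerivAt (fun s : ℝ => s • v) v s := by
      simpa using (hasDerivAt_id s).smul_const v
    have q1 : HasDerivAt (fun s : ℝ => Ψ (s • v)) (fderiv ℝ Ψ (s • v) v) s :=
      (hdΨ (s • v)).comp_hasDerivAt s hl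
    have q2 : HasDerivAt (fun s : ℝ => fderiv ℝ Ψ (s • v)) (fderiv ℝ (fderiv ℝ Ψ) (s • v) v) s :=
      (hd2 (s • v)).comp_hasDerivAt s hl
    have q3 : ∀ a, HasDerivAt (fun s : ℝ => fderiv ℝ Ψ (s • v) a)
        (fderiv ℝ (fderiv ℝ Ψ) (s • v) v a) s := fun a => by
      simpa using q2.clm_apply (hasDerivAt_const s a)
    have := h.hasDerivWithinAt_metric (s := univ) q1.hasDerivWithinAt (hU _)
      (q3 a).hasDerivWithinAt (q3 b).hasDerivWithinAt
    rwa [hasDerivWithinAt_univ] at this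
  -- Multiplied by `s`, the derivative along the ray becomes the Lie derivative of `G` along `X`
  -- minus `2G`, evaluated on the pushed-forward vectors; homothety makes it zero. The endpoint `s =
  -- 0`, where this factor is useless, is left to the mean value theorem.
  have hzero : ∀ s ∈ Ioo (0 : ℝ) 1, deriv (fun s : ℝ => G (Ψ (s • v)) (fderiv ℝ Ψ (s • v) a)
      (fderiv ℝ Ψ (s • v) b)) s = 0 := by
    intro s hs0
    rw [(hderiv s).deriv]
    refine (mul_eq_zero.1 ?_).resolve_left hs0.1.ne'
    set p := s • v with hp
    have hh := h.homothety (hU p) (fderiv ℝ Ψ p a) (fderiv ℝ Ψ p b)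
    have l1 : s • fderiv ℝ Ψ p v = metricGradient G f (Ψ p) := by rw [← map_smul, ← hp, hX]
    have l2 : ∀ a, s • fderiv ℝ (fderiv ℝ Ψ) p v a
        = fderiv ℝ (metricGradient G f) (Ψ p) (fderiv ℝ Ψ p a) - fderiv ℝ Ψ p a := by
      intro a
      rw [← smul_apply, ← map_smul, ← hp, hlin]
    rw [mul_add, mul_add]
    have t1 : s * fderiv ℝ G (Ψ p) (fderiv ℝ Ψ p v) (fderiv ℝ Ψ p a) (fderiv ℝ Ψ p b)
        = fderiv ℝ G (Ψ p) (metricGradient G f (Ψ p)) (fderiv ℝ Ψ p a) (fderiv ℝ Ψ p b) := by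
      rw [← l1]; simp
    have t2 : s * G (Ψ p) (fderiv ℝ (fderiv ℝ Ψ) p v a) (fderiv ℝ Ψ p b)
        = G (Ψ p) (fderiv ℝ (metricGradient G f) (Ψ p) (fderiv ℝ Ψ p a) - fderiv ℝ Ψ p a)
          (fderiv ℝ Ψ p b) := by
      rw [← l2]; simp
    have t3 : s * G (Ψ p) (fderiv ℝ Ψ p a) (fderiv ℝ (fderiv ℝ Ψ) p v b)
        = G (Ψ p) (fderiv ℝ Ψ p a)
          (fderiv ℝ (metricGradient G f) (Ψ p) (fderiv ℝ Ψ p b) - fderiv ℝ Ψ p b) := by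
      rw [← l2]; simp
    rw [t1, t2, t3]
    simp only [map_sub, sub_apply]
    linarith
  obtain ⟨ξ, hξ, hξe⟩ := exists_deriv_eq_slope (fun s : ℝ => G (Ψ (s • v)) (fderiv ℝ Ψ (s • v) a)
      (fderiv ℝ Ψ (s • v) b)) zero_lt_one
    (fun s _ => (hderiv s).continuousAt.continuousWithinAt)
    (fun s _ => (hderiv s).differentiableAt.differentiableWithinAt)
  rw [hzero ξ hξ] at hξe
  simp [h0, hd0] at hξe
  linarith

/-- A region that carries a metric potential is isometric to the Euclidean space: the exponential
map at the minimum of the potential is a global isometry. -/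
theorem exists_isometry : ∃ c ∈ U, ∃ Ψ : E → E, ContDiff ℝ ∞ Ψ ∧ Ψ 0 = c ∧ (∀ v, Ψ v ∈ U) ∧
    (∀ v, f (Ψ v) = f c + G c v v / 2) ∧
    (∀ v a b, G (Ψ v) (fderiv ℝ Ψ v a) (fderiv ℝ Ψ v b) = G c a b) ∧
    (∀ v, ∃ e : E ≃L[ℝ] E, (e : E →L[ℝ] E) = fderiv ℝ Ψ v) ∧
    Function.Injective Ψ ∧ ∀ x ∈ U, ∃ v, Ψ v = x := by
  obtain ⟨c, hc, hmin⟩ := h.exists_isMin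
  obtain ⟨Ψ, hs, h0, hd0, hU, hf, hX, hinj⟩ := h.exists_radial hc hmin
  have hiso := h.pullback_const hs h0 hd0 hU hX
  have hequiv : ∀ v, ∃ e : E ≃L[ℝ] E, (e : E →L[ℝ] E) = fderiv ℝ Ψ v := by
    intro v
    have hi : Function.Injective (fderiv ℝ Ψ v : E →ₗ[ℝ] E) := by
      rw [← LinearMap.ker_eq_bot, LinearMap.ker_eq_bot']
      intro a ha
      have ha' : fderiv ℝ Ψ v a = 0 := ha
      by_contra hne
      have := h.pos c hc a hne
      rw [← hiso v, ha'] at this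
      simp at this
    refine ⟨(LinearEquiv.ofInjectiveEndo _ hi).toContinuousLinearEquiv, ?_⟩
    ext a
    rfl
  refine ⟨c, hc, Ψ, hs, h0, hU, hf, hiso, hequiv, hinj, ?_⟩
  choose e he using hequiv
  have hopen : IsOpenMap Ψ := isOpenMap_of_hasStrictFDerivAt_equiv (f' := e) fun v => by
    rw [he]
    exact (hs.contDiffAt (x := v)).hasStrictFDerivAt (by simp)
  -- The range is open, so by connectedness it remains to see that it contains its limit points
  -- lying in `U`.
  have hsub : U ⊆ range Ψ := by
    refine h.preconnected.subset_of_closure_inter_subset hopen.isOpen_range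
      ⟨c, hc, 0, h0⟩ ?_
    rintro x ⟨hx, hxU⟩
    obtain ⟨m, hm, H⟩ := h.exists_pos_le_metric (f c)
    -- Near `x` the potential is below `f x + 1`; as `f (Ψ v) = f c + G c v v / 2` and `m‖v‖² ≤ G c
    -- v v`, the preimages of nearby points lie in this ball, whose image is compact.
    set B := Metric.closedBall (0 : E) (√(2 * (f x + 1 - f c) / m))
    have hB : IsCompact (Ψ '' B) := (isCompact_closedBall _ _).image hs.continuous
    have hxB : x ∈ closure (Ψ '' B) := by
      rw [mem_closure_iff_nhds] at hx ⊢
      intro t ht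
      have hnf : ∀ᶠ y in 𝓝 x, f y < f x + 1 :=
        (h.smooth.contDiffAt (h.isOpen.mem_nhds hxU)).continuousAt.eventually
          (gt_mem_nhds (lt_add_one _))
      obtain ⟨y, ⟨hyt, hyf⟩, v, rfl⟩ := hx _ (inter_mem ht hnf)
      refine ⟨Ψ v, hyt, v, ?_, rfl⟩
      rw [mem_closedBall_zero_iff]
      refine Real.le_sqrt_of_sq_le ?_
      rw [le_div_iff₀ hm, mul_comm]
      have h1 := H c hc le_rfl v
      have h2 : f (Ψ v) < f x + 1 := hyf
      rw [hf] at h2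
      linarith
    rw [hB.isClosed.closure_eq] at hxB
    obtain ⟨v, -, rfl⟩ := hxB
    exact mem_range_self v
  exact fun x hx => hsub hx

end IsMetricPotential
end Chart

/-! ### From metric tensors in coordinates to bilinear forms. -/

section MetricForm

set_option linter.unusedSectionVars false

set_option maxSynthPendingDepth 3

variable {ι : Type*} [Fintype ι] [DecidableEq ι]

/-- Jacobi's formula. In the differentiated Leibniz expansion the terms where column `i` is
differentiated form the determinant with that column replaced, which Cramer's rule expresses by the
adjugate. -/
lemma hasFDerivAt_det {E : Type*} [NormedAddCommGroup E] [NormedSpace ℝ E]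
    {M : E → Matrix ι ι ℝ} {M' : ι → ι → E →L[ℝ] ℝ} {x : E}
    (hM : ∀ i j, HasFDerivAt (fun y => M y i j) (M' i j) x) :
    HasFDerivAt (fun y => (M y).det) (∑ i, ∑ j, (M x).adjugate i j • M' j i) x := by
  have h1 : HasFDerivAt (fun y => (M y).det) (∑ σ : Equiv.Perm ι, ((Equiv.Perm.sign σ : ℤ) : ℝ) •
      ∑ i, (∏ j ∈ Finset.univ.erase i, M x (σ j) j) • M' (σ i) i) x := by
    simp only [Matrix.det_apply']
    refine HasFDerivAt.fun_sum fun σ _ => HasFDerivAt.const_mul ?_ _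
    exact HasFDerivAt.finsetProd fun i _ => hM (σ i) i
  refine h1.congr_fderiv ?_
  ext e
  have h2 : ∀ i, ∑ j, (M x).adjugate i j * M' j i e
      = ((M x).updateCol i (fun j => M' j i e)).det := by
    intro i
    rw [← Matrix.cramer_apply, Matrix.cramer_eq_adjugate_mulVec]
    rfl
  simp only [sum_apply, smul_apply, smul_eq_mul, h2, Finset.mul_sum]
  rw [Finset.sum_comm]
  refine Finset.sum_congr rfl fun i _ => ?_
  rw [Matrix.det_apply']
  refine Finset.sum_congr rfl fun σ _ => ?_
  rw [← Finset.mul_prod_erase _ _ (Finset.mem_univ i), Matrix.updateCol_self, mul_comm (M' _ _ _)]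
  congr 2
  refine Finset.prod_congr rfl fun j hj => ?_
  rw [Matrix.updateCol_ne (Finset.ne_of_mem_erase hj)]

/-- The metric tensor as a bilinear form. -/
def metricForm (g : (ι → ℝ) → Matrix ι ι ℝ) (x : ι → ℝ) : (ι → ℝ) →L[ℝ] (ι → ℝ) →L[ℝ] ℝ :=
  ∑ i, ∑ j, g x i j • (ContinuousLinearMap.proj (R := ℝ) (φ := fun _ : ι => ℝ) i).smulRight
    (ContinuousLinearMap.proj (R := ℝ) (φ := fun _ : ι => ℝ) j)

lemma metricForm_apply (g : (ι → ℝ) → Matrix ι ι ℝ) (x a b : ι → ℝ) :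
    metricForm g x a b = ∑ i, ∑ j, g x i j * a i * b j := by
  simp [metricForm, mul_assoc]

lemma metricForm_single (g : (ι → ℝ) → Matrix ι ι ℝ) (x : ι → ℝ) (i j : ι) :
    metricForm g x (Pi.single i 1) (Pi.single j 1) = g x i j := by
  rw [metricForm_apply]
  simp [Pi.single_apply]

lemma metricForm_eq_dotProduct (g : (ι → ℝ) → Matrix ι ι ℝ) (x a b : ι → ℝ) :
    metricForm g x a b = a ⬝ᵥ (g x).mulVec b := by
  simp only [metricForm_apply, dotProduct, Matrix.mulVec, Finset.mul_sum]
  refine Finset.sum_congr rfl fun i _ => Finset.sum_congr rfl fun j _ => by ring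

lemma bilin_ext {A B : (ι → ℝ) →L[ℝ] (ι → ℝ) →L[ℝ] ℝ}
    (h : ∀ i j, A (Pi.single i 1) (Pi.single j 1) = B (Pi.single i 1) (Pi.single j 1)) : A = B := by
  have h1 : ∀ i, A (Pi.single i 1) = B (Pi.single i 1) := fun i =>
    ContinuousLinearMap.coe_injective (LinearMap.pi_ext' fun j => LinearMap.ext_ring (h i j))
  exact ContinuousLinearMap.coe_injective (LinearMap.pi_ext' fun j => LinearMap.ext_ring (h1 j))

variable {U : Set (ι → ℝ)} {g : (ι → ℝ) → Matrix ι ι ℝ}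

lemma IsRiemannianMetric.contDiffOn_metricForm (hg : IsRiemannianMetric U g) :
    ContDiffOn ℝ ∞ (metricForm g) U :=
  ContDiffOn.sum fun i _ => ContDiffOn.sum fun j _ => (hg.smooth i j).smul contDiffOn_const

lemma IsRiemannianMetric.symm (hg : IsRiemannianMetric U g) {x : ι → ℝ} (hx : x ∈ U) (i j : ι) :
    g x i j = g x j i := by
  simpa using (hg.posDef x hx).1.apply j i

lemma IsRiemannianMetric.inv_symm (hg : IsRiemannianMetric U g) {x : ι → ℝ} (hx : x ∈ U)
    (i j : ι) : (g x)⁻¹ i j = (g x)⁻¹ j i := by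
  simpa using (hg.posDef x hx).1.inv.apply j i

lemma IsRiemannianMetric.metricForm_symm (hg : IsRiemannianMetric U g) {x : ι → ℝ} (hx : x ∈ U)
    (a b : ι → ℝ) : metricForm g x a b = metricForm g x b a := by
  rw [metricForm_apply, metricForm_apply, Finset.sum_comm]
  refine Finset.sum_congr rfl fun i _ => Finset.sum_congr rfl fun j _ => ?_
  rw [hg.symm hx]
  ring

lemma IsRiemannianMetric.metricForm_pos (hg : IsRiemannianMetric U g) {x : ι → ℝ} (hx : x ∈ U)
    (a : ι → ℝ) (ha : a ≠ 0) : 0 < metricForm g x a a := by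
  rw [metricForm_eq_dotProduct]
  simpa using (hg.posDef x hx).dotProduct_mulVec_pos ha

lemma IsRiemannianMetric.isUnit_det (hg : IsRiemannianMetric U g) {x : ι → ℝ} (hx : x ∈ U) :
    IsUnit (g x).det := (hg.posDef x hx).det_pos.ne'.isUnit

lemma IsRiemannianMetric.hasFDerivAt (hg : IsRiemannianMetric U g) (hU : IsOpen U) {x : ι → ℝ}
    (hx : x ∈ U) (i j : ι) : HasFDerivAt (fun z => g z i j) (fderiv ℝ (fun z => g z i j) x) x :=
  (((hg.smooth i j).contDiffAt (hU.mem_nhds hx)).differentiableAt (by simp)).hasFDerivAt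

lemma IsRiemannianMetric.fderiv_metricForm (hg : IsRiemannianMetric U g) (hU : IsOpen U)
    {x : ι → ℝ} (hx : x ∈ U) (v a b : ι → ℝ) :
    fderiv ℝ (metricForm g) x v a b = ∑ i, ∑ j, fderiv ℝ (fun z => g z i j) x v * a i * b j := by
  have h1 : HasFDerivAt (metricForm g) (∑ i, ∑ j, (fderiv ℝ (fun z => g z i j) x).smulRight
      ((ContinuousLinearMap.proj (R := ℝ) (φ := fun _ : ι => ℝ) i).smulRight
        (ContinuousLinearMap.proj (R := ℝ) (φ := fun _ : ι => ℝ) j))) x :=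
    HasFDerivAt.fun_sum fun i _ => HasFDerivAt.fun_sum fun j _ =>
      (hg.hasFDerivAt hU hx i j).smul_const _
  rw [h1.fderiv]
  simp [mul_assoc]

lemma IsRiemannianMetric.fderiv_metricForm_single (hg : IsRiemannianMetric U g) (hU : IsOpen U)
    {x : ι → ℝ} (hx : x ∈ U) (m i j : ι) :
    fderiv ℝ (metricForm g) x (Pi.single m 1) (Pi.single i 1) (Pi.single j 1)
      = pderiv m (fun z => g z i j) x := by
  rw [hg.fderiv_metricForm hU hx]
  simp [Pi.single_apply, pderiv]

lemma pderiv_pderiv {f : (ι → ℝ) → ℝ} {x : ι → ℝ} (hf : ContDiffAt ℝ ∞ f x) (i j : ι) :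
    pderiv i (pderiv j f) x
      = fderiv ℝ (fderiv ℝ f) x (Pi.single i 1) (Pi.single j 1) := by
  have h1 : HasFDerivAt (fderiv ℝ f) (fderiv ℝ (fderiv ℝ f) x) x :=
    ((hf.fderiv_right (m := ∞) (by simp)).differentiableAt (by simp)).hasFDerivAt
  have h2 := h1.clm_apply (hasFDerivAt_const (Pi.single j (1 : ℝ)) x)
  have h3 : pderiv j f = fun y => fderiv ℝ f y (Pi.single j 1) := rfl
  rw [pderiv, h3, h2.fderiv]
  simp

/-- The covariant Hessian of `f` with respect to `g` is equal to `g` at the point `x`. -/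
def HessianEq (g : (ι → ℝ) → Matrix ι ι ℝ) (f : (ι → ℝ) → ℝ) (x : ι → ℝ) : Prop :=
  ∀ i j, g x i j = pderiv i (pderiv j f) x - ∑ k, christoffel g k i j x * pderiv k f x

/-- The Hessian equation with the gradient `X` in place of the Levi-Civita symbols. -/
lemma HessianEq.metricForm_eq {f : (ι → ℝ) → ℝ} {x : ι → ℝ} (h : HessianEq g f x)
    (hU : IsOpen U) (hg : IsRiemannianMetric U g) (hf : ContDiffOn ℝ ∞ f U) (hx : x ∈ U)
    {X : ι → ℝ} (hX : ∀ e, metricForm g x X e = fderiv ℝ f x e) (a b : ι → ℝ) :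
    metricForm g x a b = fderiv ℝ (fderiv ℝ f) x a b
      - 1 / 2 * (fderiv ℝ (metricForm g) x a b X + fderiv ℝ (metricForm g) x b a X
        - fderiv ℝ (metricForm g) x X a b) := by
  set D := fderiv ℝ (metricForm g) x with hD
  let P : (ι → ℝ) →L[ℝ] (ι → ℝ) →L[ℝ] ℝ :=
    (ContinuousLinearMap.compL ℝ (ι → ℝ) ((ι → ℝ) →L[ℝ] ℝ) ℝ
      (ContinuousLinearMap.apply ℝ ℝ X)).comp D
  have key : metricForm g x = fderiv ℝ (fderiv ℝ f) x - (1 / 2 : ℝ) • (P + P.flip - D X) := by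
    refine bilin_ext fun i j => ?_
    -- The inverse metric in the Levi-Civita symbols raises the index of `df`; only first-kind
    -- symbols contracted with the gradient remain.
    have hXm : ∀ m, ∑ k, (g x)⁻¹ k m * pderiv k f x = X m := by
      intro m
      have h1 : ∀ k, pderiv k f x = ∑ l, X l * g x l k := by
        intro k
        rw [pderiv, ← hX, metricForm_apply]
        simp [Pi.single_apply, mul_comm]
      simp only [h1, Finset.mul_sum]
      rw [Finset.sum_comm]
      have h2 : ∀ l, ∑ k, (g x)⁻¹ k m * (X l * g x l k) = X l * (1 : Matrix ι ι ℝ) l m := by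
        intro l
        rw [← Matrix.mul_nonsing_inv _ (hg.isUnit_det hx), Matrix.mul_apply, Finset.mul_sum]
        exact Finset.sum_congr rfl fun k _ => by ring
      simp only [h2]
      simp [Matrix.one_apply]
    have hsum : ∑ k, christoffel g k i j x * pderiv k f x
        = ∑ m, 1 / 2 * (pderiv j (fun z => g z i m) x + pderiv i (fun z => g z j m) x
          - pderiv m (fun z => g z i j) x) * X m := by
      simp only [christoffel, Finset.sum_mul]
      rw [Finset.sum_comm]
      refine Finset.sum_congr rfl fun m _ => ?_
      rw [← hXm, Finset.mul_sum]
      exact Finset.sum_congr rfl fun k _ => by ring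
    have hXs : X = ∑ m, X m • (Pi.single m 1 : ι → ℝ) := pi_eq_sum_univ' X
    have e1 : ∀ i j, D (Pi.single i 1) (Pi.single j 1) X = ∑ m, pderiv i (fun z => g z j m) x * X m := by
      intro i j
      conv_lhs => rw [hXs]
      rw [map_sum]
      refine Finset.sum_congr rfl fun m _ => ?_
      rw [map_smul, hD, hg.fderiv_metricForm_single hU hx, smul_eq_mul, mul_comm]
    have e2 : D X (Pi.single i 1) (Pi.single j 1) = ∑ m, pderiv m (fun z => g z i j) x * X m := by
      conv_lhs => rw [hXs]
      rw [map_sum, sum_apply, sum_apply]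
      refine Finset.sum_congr rfl fun m _ => ?_
      rw [map_smul, smul_apply, smul_apply, hD, hg.fderiv_metricForm_single hU hx, smul_eq_mul,
        mul_comm]
    rw [metricForm_single, h i j, hsum, pderiv_pderiv (hf.contDiffAt (hU.mem_nhds hx))]
    simp only [sub_apply, smul_apply, add_apply, ContinuousLinearMap.flip_apply, smul_eq_mul]
    have e3 : ∀ i j, P (Pi.single i 1) (Pi.single j 1) = D (Pi.single i 1) (Pi.single j 1) X :=
      fun i j => rfl
    rw [e3, e3, e1, e1, e2]
    congr 1
    rw [← Finset.sum_add_distrib, ← Finset.sum_sub_distrib, Finset.mul_sum]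
    exact Finset.sum_congr rfl fun m _ => by ring
  have := congrArg (fun L : (ι → ℝ) →L[ℝ] (ι → ℝ) →L[ℝ] ℝ => L a b) key
  simpa [P] using this

end MetricForm

/-! ### The information potential and the Hessian equation. -/

section Potential

set_option linter.unusedSectionVars false
set_option maxSynthPendingDepth 3

variable {ι : Type*} [Fintype ι] [DecidableEq ι]

lemma contDiffOn_det {E : Type*} [NormedAddCommGroup E] [NormedSpace ℝ E] {s : Set E}
    {M : E → Matrix ι ι ℝ} (hM : ∀ i j, ContDiffOn ℝ ∞ (fun y => M y i j) s) :
    ContDiffOn ℝ ∞ (fun y => (M y).det) s := by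
  simp only [Matrix.det_apply']
  exact ContDiffOn.sum fun σ _ => contDiffOn_const.mul (contDiffOn_prod fun i _ => hM (σ i) i)

lemma contDiffOn_pderiv {U : Set (ι → ℝ)} (hU : IsOpen U) {f : (ι → ℝ) → ℝ}
    (hf : ContDiffOn ℝ ∞ f U) (i : ι) : ContDiffOn ℝ ∞ (pderiv i f) U :=
  (hf.fderiv_of_isOpen hU (m := ∞) (by simp)).clm_apply contDiffOn_const

lemma differentiableAt_of_contDiffOn {E F : Type*} [NormedAddCommGroup E] [NormedSpace ℝ E]
    [NormedAddCommGroup F] [NormedSpace ℝ F] {U : Set E} (hU : IsOpen U) {f : E → F}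
    (hf : ContDiffOn ℝ ∞ f U) {x : E} (hx : x ∈ U) : DifferentiableAt ℝ f x :=
  (hf.contDiffAt (hU.mem_nhds hx)).differentiableAt (by simp)

lemma pderiv_congr {U : Set (ι → ℝ)} (hU : IsOpen U) {f g : (ι → ℝ) → ℝ}
    (h : ∀ x ∈ U, f x = g x) {x : ι → ℝ} (hx : x ∈ U) (i : ι) : pderiv i f x = pderiv i g x := by
  have : f =ᶠ[𝓝 x] g := by filter_upwards [hU.mem_nhds hx] with y hy using h y hy
  rw [pderiv, pderiv, this.fderiv_eq]

variable {U : Set (ι → ℝ)} {g : (ι → ℝ) → Matrix ι ι ℝ}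

lemma HessianEq.congr (hU : IsOpen U) {f f' : (ι → ℝ) → ℝ} (h : ∀ x ∈ U, f x = f' x)
    {x : ι → ℝ} (hx : x ∈ U) (hf : HessianEq g f x) : HessianEq g f' x := by
  intro i j
  rw [hf i j, pderiv_congr hU (fun y hy => pderiv_congr hU h hy j) hx i]
  simp only [pderiv_congr hU h hx]

lemma IsRiemannianMetric.contDiffOn_inv (hg : IsRiemannianMetric U g) (i j : ι) :
    ContDiffOn ℝ ∞ (fun x => (g x)⁻¹ i j) U := by
  have h1 : ∀ x ∈ U, (g x)⁻¹ i j = ((g x).det)⁻¹ * (g x).adjugate i j := by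
    intro x hx
    rw [Matrix.inv_def, Matrix.smul_apply, Ring.inverse_eq_inv', smul_eq_mul]
  refine ContDiffOn.congr (ContDiffOn.mul ((contDiffOn_det hg.smooth).inv
    fun x hx => (hg.posDef x hx).det_pos.ne') ?_) h1
  simp only [Matrix.adjugate_apply]
  refine contDiffOn_det fun k l => ?_
  by_cases hk : k = j
  · subst hk
    simp only [Matrix.updateRow_self]
    exact contDiffOn_const
  · simp only [Matrix.updateRow_ne hk]
    exact hg.smooth k l

lemma IsRiemannianMetric.contDiffOn_christoffel (hg : IsRiemannianMetric U g) (hU : IsOpen U)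
    (k i j : ι) : ContDiffOn ℝ ∞ (christoffel g k i j) U :=
  ContDiffOn.sum fun m _ => ((hg.contDiffOn_inv k m).mul contDiffOn_const).mul
    (((contDiffOn_pderiv hU (hg.smooth i m) j).add (contDiffOn_pderiv hU (hg.smooth j m) i)).sub
      (contDiffOn_pderiv hU (hg.smooth i j) m))

lemma IsRiemannianMetric.volDensity_pos (hg : IsRiemannianMetric U g) {x : ι → ℝ} (hx : x ∈ U) :
    0 < volDensity g x := by
  rw [volDensity, Matrix.det_smul]
  have := (hg.posDef x hx).det_pos
  have := Real.pi_pos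
  positivity

lemma IsRiemannianMetric.contDiffOn_volDensity (hg : IsRiemannianMetric U g) :
    ContDiffOn ℝ ∞ (volDensity g) U := by
  refine ContDiffOn.sqrt (contDiffOn_det fun i j => contDiffOn_const.mul (hg.smooth i j))
    fun x hx => ?_
  exact (Real.sqrt_pos.1 (hg.volDensity_pos hx)).ne'

lemma IsRiemannianMetric.log_volDensity (hg : IsRiemannianMetric U g) {x : ι → ℝ} (hx : x ∈ U) :
    Real.log (volDensity g x)
      = 1 / 2 * (Fintype.card ι * Real.log (2 * Real.pi)⁻¹) + 1 / 2 * Real.log (g x).det := by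
  have h1 := (hg.posDef x hx).det_pos
  have h2 := Real.pi_pos
  rw [volDensity, Matrix.det_smul, Real.log_sqrt (by positivity),
    Real.log_mul (by positivity) h1.ne', Real.log_pow]
  ring

/-- The contracted Levi-Civita symbols are the logarithmic derivatives of the volume density. -/
lemma IsRiemannianMetric.pderiv_log_volDensity (hg : IsRiemannianMetric U g) (hU : IsOpen U)
    {x : ι → ℝ} (hx : x ∈ U) (j : ι) :
    pderiv j (fun z => Real.log (volDensity g z)) x = ∑ k, christoffel g k j k x := by
  have hdet := (hg.posDef x hx).det_pos
  have h1 := (((hasFDerivAt_det (fun i j => hg.hasFDerivAt hU hx i j)).log hdet.ne').const_mul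
    (1 / 2 : ℝ)).const_add (1 / 2 * (Fintype.card ι * Real.log (2 * Real.pi)⁻¹))
  rw [pderiv_congr hU (fun z hz => hg.log_volDensity hz) hx, pderiv, h1.fderiv]
  have h2 : ∀ i k, (g x)⁻¹ i k = ((g x).det)⁻¹ * (g x).adjugate i k := fun i k => by
    rw [Matrix.inv_def, Matrix.smul_apply, Ring.inverse_eq_inv', smul_eq_mul]
  -- By symmetry of the inverse, exchanging `k` and `m` cancels two of the three terms of the
  -- contracted symbols.
  have h3 : ∑ k, ∑ m, (g x)⁻¹ k m * pderiv k (fun z => g z j m) x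
      = ∑ k, ∑ m, (g x)⁻¹ k m * pderiv m (fun z => g z j k) x := by
    rw [Finset.sum_comm]
    refine Finset.sum_congr rfl fun k _ => Finset.sum_congr rfl fun m _ => ?_
    rw [hg.inv_symm hx]
  have h4 : ∑ k, christoffel g k j k x
      = 1 / 2 * ∑ k, ∑ m, (g x)⁻¹ k m * pderiv j (fun z => g z k m) x
        + 1 / 2 * (∑ k, ∑ m, (g x)⁻¹ k m * pderiv k (fun z => g z j m) x
          - ∑ k, ∑ m, (g x)⁻¹ k m * pderiv m (fun z => g z j k) x) := by
    simp only [christoffel, Finset.mul_sum, ← Finset.sum_add_distrib, ← Finset.sum_sub_distrib]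
    exact Finset.sum_congr rfl fun k _ => Finset.sum_congr rfl fun m _ => by ring
  rw [h4, h3, sub_self, mul_zero, add_zero]
  simp only [smul_apply, sum_apply, smul_eq_mul, Finset.mul_sum, h2]
  refine Finset.sum_congr rfl fun k _ => Finset.sum_congr rfl fun m _ => ?_
  rw [pderiv, show (fun z => g z m k) = (fun z => g z m k) from rfl]
  have h5 : fderiv ℝ (fun z => g z m k) x = fderiv ℝ (fun z => g z k m) x := by
    have : (fun z => g z m k) =ᶠ[𝓝 x] fun z => g z k m := by
      filter_upwards [hU.mem_nhds hx] with y hy using hg.symm hy m k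
    exact this.fderiv_eq
  rw [h5]
  ring

/-- The matrices under the two roots are inverse to each other, including the factors of `2π`. -/
lemma IsRiemannianMetric.weight_mul_volDensity (hg : IsRiemannianMetric U g) {x : ι → ℝ}
    (hx : x ∈ U) (ρ : (ι → ℝ) → ℝ) : weight ρ g x * volDensity g x = ρ x := by
  have h1 := (hg.posDef x hx).det_pos
  have h2 := Real.pi_pos
  rw [weight, volDensity, mul_assoc, ← Real.sqrt_mul, ← Matrix.det_mul, Matrix.smul_mul,
    Matrix.mul_smul, Matrix.nonsing_inv_mul _ (hg.isUnit_det hx), smul_smul,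
    mul_inv_cancel₀ (by positivity), one_smul, Matrix.det_one, Real.sqrt_one, mul_one]
  rw [Matrix.det_smul, Matrix.det_nonsing_inv, Ring.inverse_eq_inv']
  positivity

lemma IsRiemannianMetric.weight_pos (hg : IsRiemannianMetric U g) {x : ι → ℝ}
    (hx : x ∈ U) {ρ : (ι → ℝ) → ℝ} (hρ : 0 < ρ x) : 0 < weight ρ g x := by
  have h1 := hg.weight_mul_volDensity hx ρ
  have h2 := hg.volDensity_pos hx
  exact pos_of_mul_pos_left (h1 ▸ hρ) h2.le

lemma IsRiemannianMetric.infoPotential_eq (hg : IsRiemannianMetric U g) {x : ι → ℝ}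
    (hx : x ∈ U) {ρ : (ι → ℝ) → ℝ} (hρ : 0 < ρ x) :
    infoPotential ρ g x = Real.log (ρ x) - Real.log (volDensity g x) := by
  have h1 := hg.weight_mul_volDensity hx ρ
  have h2 := hg.volDensity_pos hx
  have h3 := hg.weight_pos hx hρ
  rw [infoPotential, ← h1, Real.log_mul h3.ne' h2.ne']
  ring

lemma IsRiemannianMetric.contDiffOn_infoPotential (hg : IsRiemannianMetric U g)
    {ρ : (ι → ℝ) → ℝ} (hρ : ∀ x ∈ U, 0 < ρ x) (hρs : ContDiffOn ℝ ∞ ρ U) :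
    ContDiffOn ℝ ∞ (infoPotential ρ g) U :=
  ((hρs.log fun x hx => (hρ x hx).ne').sub (hg.contDiffOn_volDensity.log
    fun _ hx => (hg.volDensity_pos hx).ne')).congr fun x hx => hg.infoPotential_eq hx (hρ x hx)

/-- The covariant equation for the metric tensor says that the Hessian of the information potential
is the opposite of the metric. -/
lemma IsRiemannianMetric.hessianEq_iff (hg : IsRiemannianMetric U g) (hU : IsOpen U)
    {ρ : (ι → ℝ) → ℝ} (hρ : ∀ x ∈ U, 0 < ρ x) (hρs : ContDiffOn ℝ ∞ ρ U) {x : ι → ℝ} (hx : x ∈ U) :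
    HessianEq g (fun z => -infoPotential ρ g z) x ↔ ∀ i j,
      g x i j = - pderiv i (pderiv j (fun z => Real.log (ρ z))) x
      + ∑ k, christoffel g k i j x * pderiv k (fun z => Real.log (ρ z)) x
      + ∑ k, pderiv i (christoffel g k j k) x
      - ∑ k, ∑ l, christoffel g k i j x * christoffel g l k l x := by
  have hlog : ContDiffOn ℝ ∞ (fun z => Real.log (ρ z)) U := hρs.log fun x hx => (hρ x hx).ne'
  have hvol : ContDiffOn ℝ ∞ (fun z => Real.log (volDensity g z)) U :=
    hg.contDiffOn_volDensity.log fun x hx => (hg.volDensity_pos hx).ne'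
  -- As `-S` is `log (volDensity g) - log ρ`, its gradient brings in the contracted symbols;
  -- substitution yields the last two sums of the metric equation.
  have h1 : ∀ y ∈ U, ∀ j, pderiv j (fun z => -infoPotential ρ g z) y
      = ∑ k, christoffel g k j k y - pderiv j (fun z => Real.log (ρ z)) y := by
    intro y hy j
    rw [← hg.pderiv_log_volDensity hU hy, pderiv_congr hU
      (g := fun z => Real.log (volDensity g z) - Real.log (ρ z))
      (fun z hz => by rw [hg.infoPotential_eq hz (hρ z hz)]; ring) hy]
    rw [pderiv, fderiv_fun_sub (differentiableAt_of_contDiffOn hU hvol hy)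
      (differentiableAt_of_contDiffOn hU hlog hy)]
    rfl
  have h2 : ∀ i j, pderiv i (pderiv j (fun z => -infoPotential ρ g z)) x
      = ∑ k, pderiv i (christoffel g k j k) x
        - pderiv i (pderiv j (fun z => Real.log (ρ z))) x := by
    intro i j
    rw [pderiv_congr hU (fun y hy => h1 y hy j) hx, pderiv,
      fderiv_fun_sub (DifferentiableAt.fun_sum fun k _ => differentiableAt_of_contDiffOn hU
        (hg.contDiffOn_christoffel hU k j k) hx)
      (differentiableAt_of_contDiffOn hU (contDiffOn_pderiv hU hlog j) hx),
      fderiv_fun_sum fun k _ => differentiableAt_of_contDiffOn hU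
        (hg.contDiffOn_christoffel hU k j k) hx, sub_apply, sum_apply]
    rfl
  refine forall_congr' fun i => forall_congr' fun j => ?_
  rw [h2]
  simp only [h1 x hx, mul_sub, Finset.sum_sub_distrib, Finset.mul_sum]
  constructor <;> intro h <;> linarith

/-- Half the squared norm of an isometry to the Euclidean space solves the Hessian equation. -/
lemma IsRiemannianMetric.hessianEq_of_isometry (hg : IsRiemannianMetric U g) (hU : IsOpen U)
    {Θ : (ι → ℝ) → (ι → ℝ)} (hΘ : ContDiffOn ℝ ∞ Θ U)
    (hiso : ∀ x ∈ U, ∀ i j, g x i j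
      = ∑ k, pderiv i (fun z => Θ z k) x * pderiv j (fun z => Θ z k) x) {x : ι → ℝ} (hx : x ∈ U)
    (r : ℝ) : HessianEq g (fun z => r + 1 / 2 * ∑ k, Θ z k ^ 2) x := by
  have hT : ∀ k, ContDiffOn ℝ ∞ (fun z => Θ z k) U := contDiffOn_pi.1 hΘ
  have hd : ∀ y ∈ U, ∀ k, HasFDerivAt (fun z => Θ z k) (fderiv ℝ (fun z => Θ z k) y) y :=
    fun y hy k => (differentiableAt_of_contDiffOn hU (hT k) hy).hasFDerivAt
  have hdd : ∀ i k, HasFDerivAt (pderiv i (fun z => Θ z k))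
      (fderiv ℝ (pderiv i (fun z => Θ z k)) x) x := fun i k =>
    (differentiableAt_of_contDiffOn hU (contDiffOn_pderiv hU (hT k) i) hx).hasFDerivAt
  have hsymm : ∀ i j k, pderiv i (pderiv j (fun z => Θ z k)) x
      = pderiv j (pderiv i (fun z => Θ z k)) x := by
    intro i j k
    have hc := (hT k).contDiffAt (hU.mem_nhds hx)
    rw [pderiv_pderiv hc, pderiv_pderiv hc]
    exact hc.isSymmSndFDerivAt (by simp; exact ENat.LEInfty.out) _ _
  have hgd : ∀ m i j, pderiv m (fun z => g z i j) x
      = ∑ k, (pderiv m (pderiv i (fun z => Θ z k)) x * pderiv j (fun z => Θ z k) x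
        + pderiv i (fun z => Θ z k) x * pderiv m (pderiv j (fun z => Θ z k)) x) := by
    intro m i j
    rw [pderiv_congr hU (fun y hy => hiso y hy i j) hx, pderiv,
      (HasFDerivAt.fun_sum fun k _ => (hdd i k).fun_mul (hdd j k)).fderiv, sum_apply]
    refine Finset.sum_congr rfl fun k _ => ?_
    simp only [add_apply, smul_apply, smul_eq_mul, pderiv]
    ring
  have hf1 : ∀ y ∈ U, ∀ j, pderiv j (fun z => r + 1 / 2 * ∑ k, Θ z k ^ 2) y
      = ∑ k, Θ y k * pderiv j (fun z => Θ z k) y := by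
    intro y hy j
    rw [pderiv, (((HasFDerivAt.fun_sum (u := Finset.univ)
      fun k _ => (hd y hy k).pow 2).const_mul (1 / 2 : ℝ)).const_add r).fderiv]
    simp only [smul_apply, sum_apply, smul_eq_mul, Finset.mul_sum, pderiv]
    refine Finset.sum_congr rfl fun k _ => ?_
    simp
    ring
  have hf2 : ∀ i j, pderiv i (pderiv j (fun z => r + 1 / 2 * ∑ k, Θ z k ^ 2)) x
      = ∑ k, (pderiv i (fun z => Θ z k) x * pderiv j (fun z => Θ z k) x
        + Θ x k * pderiv i (pderiv j (fun z => Θ z k)) x) := by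
    intro i j
    rw [pderiv_congr hU (fun y hy => hf1 y hy j) hx, pderiv,
      (HasFDerivAt.fun_sum fun k _ => (hd x hx k).fun_mul (hdd j k)).fderiv, sum_apply]
    refine Finset.sum_congr rfl fun k _ => ?_
    simp only [add_apply, smul_apply, smul_eq_mul, pderiv]
    ring
  -- The Jacobian matrix of `Θ`; the isometry condition reads `g = JᵀJ`.
  let J : Matrix ι ι ℝ := Matrix.of fun q k => pderiv k (fun z => Θ z q) x
  have hJ : g x = J.transpose * J := by
    ext i j
    rw [hiso x hx, Matrix.mul_apply]
    rfl
  have hJ1 : J * ((g x)⁻¹ * J.transpose) = 1 := by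
    rw [mul_eq_one_comm, Matrix.mul_assoc, ← hJ,
      Matrix.nonsing_inv_mul _ (hg.isUnit_det hx)]
  intro i j
  set u : ι → ℝ := fun k => pderiv i (pderiv j (fun z => Θ z k)) x with hu
  -- In the combination of derivatives of `JᵀJ` all terms cancel except those with `u = ∂_i∂_jΘ`.
  -- Contracted with `df = JᵀΘ`, the symbols give `Θ · u` because `J g⁻¹ Jᵀ = 1`.
  have hΓ : ∀ k, christoffel g k i j x = ((g x)⁻¹).mulVec (J.transpose.mulVec u) k := by
    intro k
    rw [christoffel, Matrix.mulVec, dotProduct]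
    refine Finset.sum_congr rfl fun m _ => ?_
    rw [mul_assoc]
    congr 1
    rw [hgd, hgd, hgd, ← Finset.sum_add_distrib, ← Finset.sum_sub_distrib, Finset.mul_sum,
      Matrix.mulVec, dotProduct]
    refine Finset.sum_congr rfl fun p _ => ?_
    rw [hsymm j i, hsymm j m, hsymm m i]
    simp only [J, hu, Matrix.transpose_apply, Matrix.of_apply]
    ring
  have hsum : ∑ k, christoffel g k i j x * pderiv k (fun z => r + 1 / 2 * ∑ k, Θ z k ^ 2) x
      = ∑ q, Θ x q * u q := by
    have e1 : ∀ k, pderiv k (fun z => r + 1 / 2 * ∑ k, Θ z k ^ 2) x = J.transpose.mulVec (Θ x) k := by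
      intro k
      rw [hf1 x hx, Matrix.mulVec, dotProduct]
      exact Finset.sum_congr rfl fun q _ => mul_comm _ _
    simp only [hΓ, e1]
    change ((g x)⁻¹).mulVec (J.transpose.mulVec u) ⬝ᵥ J.transpose.mulVec (Θ x) = Θ x ⬝ᵥ u
    rw [dotProduct_comm, Matrix.mulVec_transpose J (Θ x), ← Matrix.dotProduct_mulVec,
      Matrix.mulVec_mulVec, Matrix.mulVec_mulVec, Matrix.mul_assoc, hJ1, Matrix.one_mulVec]
  rw [hsum, hf2, hiso x hx, ← Finset.sum_sub_distrib]
  exact Finset.sum_congr rfl fun k _ => by ring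

end Potential

/-! ### Gaussian charts: global Euclidean coordinates centred at the minimum. -/

section GaussianChart

set_option linter.unusedSectionVars false

set_option maxSynthPendingDepth 3

variable {ι : Type*} [Fintype ι] [DecidableEq ι]

section

open scoped MatrixOrder

lemma exists_eq_transpose_mul_self {A : Matrix ι ι ℝ} (hA : A.PosDef) :
    ∃ B : Matrix ι ι ℝ, A = B.transpose * B := by
  have h0 : 0 ≤ A := Matrix.nonneg_iff_posSemidef.2 hA.posSemidef
  refine ⟨CFC.sqrt A, ?_⟩
  have h1 : (CFC.sqrt A).PosSemidef := Matrix.nonneg_iff_posSemidef.1 (CFC.sqrt_nonneg A)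
  have h2 : (CFC.sqrt A).transpose = CFC.sqrt A := by
    have := h1.1
    rwa [Matrix.IsHermitian, Matrix.conjTranspose_eq_transpose_of_trivial] at this
  rw [h2, CFC.sqrt_mul_sqrt_self A h0]

end

/-- Global isometric coordinates `Φ : U → ℝⁿ`, with inverse `Ψ`, in which the potential `f` is
`f(c) + ½ |Φ|²`. -/
structure IsGaussianChart (U : Set (ι → ℝ)) (g : (ι → ℝ) → Matrix ι ι ℝ) (f : (ι → ℝ) → ℝ)
    (c : ι → ℝ) (Φ Ψ : (ι → ℝ) → (ι → ℝ)) : Prop where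
  change : IsCoordChange U univ Φ Ψ
  center_mem : c ∈ U
  center : Φ c = 0
  potential : ∀ x ∈ U, f x = f c + 1 / 2 * ∑ k, Φ x k ^ 2
  metric : ∀ v a b, metricForm g (Ψ v) (fderiv ℝ Ψ v a) (fderiv ℝ Ψ v b) = a ⬝ᵥ b

/-- The inverse of the exponential map is followed by the linear map `B` with `g(c) = BᵀB`, which
turns the scalar product at `c` into the standard one. -/
lemma exists_gaussianChart {U : Set (ι → ℝ)} {g : (ι → ℝ) → Matrix ι ι ℝ} {f : (ι → ℝ) → ℝ}
    (hg : IsRiemannianMetric U g) (h : IsMetricPotential U (metricForm g) f) :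
    ∃ c Φ Ψ, IsGaussianChart U g f c Φ Ψ := by
  obtain ⟨c, hc, Ψ, hs, h0, hΨU, hf, hiso, hequiv, hinj, hsurj⟩ := h.exists_isometry
  obtain ⟨B, hB⟩ := exists_eq_transpose_mul_self (hg.posDef c hc)
  have hBu : IsUnit B.det := by
    have := (hg.isUnit_det hc)
    rw [hB, Matrix.det_mul, Matrix.det_transpose] at this
    exact isUnit_of_mul_isUnit_left this
  have hBB : ∀ v, B.mulVec (B⁻¹.mulVec v) = v := fun v => by
    rw [Matrix.mulVec_mulVec, Matrix.mul_nonsing_inv _ hBu, Matrix.one_mulVec]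
  have hBB' : ∀ v, B⁻¹.mulVec (B.mulVec v) = v := fun v => by
    rw [Matrix.mulVec_mulVec, Matrix.nonsing_inv_mul _ hBu, Matrix.one_mulVec]
  have hGc : ∀ a b, metricForm g c (B⁻¹.mulVec a) (B⁻¹.mulVec b) = a ⬝ᵥ b := by
    intro a b
    rw [metricForm_eq_dotProduct, hB, ← Matrix.mulVec_mulVec, hBB, Matrix.dotProduct_mulVec,
      Matrix.vecMul_transpose, hBB]
  let L : (ι → ℝ) →L[ℝ] (ι → ℝ) := LinearMap.toContinuousLinearMap (Matrix.toLin' B)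
  let L' : (ι → ℝ) →L[ℝ] (ι → ℝ) := LinearMap.toContinuousLinearMap (Matrix.toLin' B⁻¹)
  have hL : ∀ v, L v = B.mulVec v := fun v => rfl
  have hL' : ∀ v, L' v = B⁻¹.mulVec v := fun v => rfl
  set Φ₀ := Function.invFun Ψ with hΦ₀
  have hleft : ∀ v, Φ₀ (Ψ v) = v := Function.leftInverse_invFun hinj
  have hright : ∀ x ∈ U, Ψ (Φ₀ x) = x := by
    intro x hx
    obtain ⟨v, rfl⟩ := hsurj x hx
    rw [hleft]
  have hΦs : ContDiffOn ℝ ∞ Φ₀ U := by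
    intro x hx
    obtain ⟨v, rfl⟩ := hsurj x hx
    obtain ⟨e, he⟩ := hequiv v
    have hd : HasFDerivAt Ψ (e : (ι → ℝ) →L[ℝ] (ι → ℝ)) v := by
      rw [he]; exact (hs.differentiable (by simp) v).hasFDerivAt
    have hst := hs.contDiffAt.hasStrictFDerivAt' hd (by simp)
    have h1 := hs.contDiffAt.to_localInverse hd (by simp)
    -- A right inverse of the injective `Ψ` agrees with `Φ₀` wherever it is one, so `Φ₀` inherits
    -- the smoothness of the local inverse.
    refine (h1.congr_of_eventuallyEq ?_).contDiffWithinAt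
    filter_upwards [hst.eventually_right_inverse] with y hy
    have h2 : Ψ (hs.contDiffAt.localInverse hd (by simp) y) = y := hy
    conv_lhs => rw [← h2]
    rw [hleft]
  have hdΨ : ∀ v a, fderiv ℝ (fun v => Ψ (L' v)) v a = fderiv ℝ Ψ (L' v) (L' a) := by
    intro v a
    have := ((hs.differentiable (by simp) (L' v)).hasFDerivAt).comp v L'.hasFDerivAt
    exact congrArg (fun A : (ι → ℝ) →L[ℝ] (ι → ℝ) => A a) this.fderiv
  refine ⟨c, fun x => L (Φ₀ x), fun v => Ψ (L' v), ?_, hc, ?_, fun x hx => ?_, fun v a b => ?_⟩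
  · exact
    { smooth := L.contDiff.comp_contDiffOn hΦs
      smooth_inv := (hs.comp L'.contDiff).contDiffOn
      mapsTo := fun _ _ => mem_univ _
      mapsTo_inv := fun v _ => hΨU _
      left_inv := fun x hx => by
        simp only [hL, hL', hBB']
        exact hright x hx
      right_inv := fun v _ => by
        simp only [hleft]
        rw [hL, hL', hBB] }
  · have : Φ₀ c = 0 := by rw [← h0, hleft]
    simp only [this, map_zero]
  · have h1 := hf (Φ₀ x)
    rw [hright x hx] at h1
    have h2 := hGc (L (Φ₀ x)) (L (Φ₀ x))
    rw [hL, hBB'] at h2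
    rw [h1, h2, hL, dotProduct]
    simp only [pow_two]
    ring
  · rw [hdΨ, hdΨ]
    exact (hiso (L' v) (L' a) (L' b)).trans (hGc a b)

namespace IsGaussianChart

variable {U : Set (ι → ℝ)} {g : (ι → ℝ) → Matrix ι ι ℝ} {f : (ι → ℝ) → ℝ} {c : ι → ℝ}
  {Φ Ψ : (ι → ℝ) → (ι → ℝ)} (h : IsGaussianChart U g f c Φ Ψ)
include h

lemma apply_symm (v : ι → ℝ) : Φ (Ψ v) = v := h.change.right_inv v (mem_univ v)

lemma symm_apply {x : ι → ℝ} (hx : x ∈ U) : Ψ (Φ x) = x := h.change.left_inv x hx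

lemma symm_mem (v : ι → ℝ) : Ψ v ∈ U := h.change.mapsTo_inv (mem_univ v)

lemma image_symm : Ψ '' univ = U :=
  Subset.antisymm (by rintro _ ⟨v, -, rfl⟩; exact h.symm_mem v)
    fun x hx => ⟨Φ x, mem_univ _, h.symm_apply hx⟩

lemma injective_symm : Function.Injective Ψ :=
  Function.LeftInverse.injective h.apply_symm

lemma contDiff_symm : ContDiff ℝ ∞ Ψ := contDiffOn_univ.1 h.change.smooth_inv

lemma hasFDerivAt_symm (v : ι → ℝ) : HasFDerivAt Ψ (fderiv ℝ Ψ v) v :=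
  (h.contDiff_symm.differentiable (by simp) v).hasFDerivAt

lemma isPreconnected : IsPreconnected U := by
  rw [← h.image_symm]
  exact isPreconnected_univ.image _ h.contDiff_symm.continuous.continuousOn

lemma potential_symm (v : ι → ℝ) : f (Ψ v) = f c + 1 / 2 * ∑ k, v k ^ 2 := by
  rw [h.potential _ (h.symm_mem v), h.apply_symm]

lemma potential_lt {x : ι → ℝ} (hx : x ∈ U) (hxc : x ≠ c) : f c < f x := by
  rw [h.potential x hx, lt_add_iff_pos_right]
  refine mul_pos (by norm_num) (lt_of_le_of_ne (Finset.sum_nonneg fun k _ => sq_nonneg _) ?_)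
  intro h0
  refine hxc ?_
  rw [← h.symm_apply hx, ← h.symm_apply h.center_mem, h.center]
  congr 1
  funext k
  have := (Finset.sum_eq_zero_iff_of_nonneg fun k _ => sq_nonneg (Φ x k)).1 h0.symm k
    (Finset.mem_univ k)
  simpa using this

variable (hU : IsOpen U)
include hU

lemma hasFDerivAt {x : ι → ℝ} (hx : x ∈ U) : HasFDerivAt Φ (fderiv ℝ Φ x) x :=
  (differentiableAt_of_contDiffOn hU h.change.smooth hx).hasFDerivAt

lemma fderiv_fderiv_symm {x : ι → ℝ} (hx : x ∈ U) (a : ι → ℝ) :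
    fderiv ℝ Ψ (Φ x) (fderiv ℝ Φ x a) = a := by
  have h1 := (h.hasFDerivAt_symm (Φ x)).comp x (h.hasFDerivAt hU hx)
  have h2 : (Ψ ∘ Φ) =ᶠ[𝓝 x] id := by
    filter_upwards [hU.mem_nhds hx] with y hy using h.symm_apply hy
  have := h1.unique ((hasFDerivAt_id x).congr_of_eventuallyEq h2)
  exact congrArg (fun A : (ι → ℝ) →L[ℝ] (ι → ℝ) => A a) this

lemma metricForm_eq {x : ι → ℝ} (hx : x ∈ U) (a b : ι → ℝ) :
    metricForm g x a b = fderiv ℝ Φ x a ⬝ᵥ fderiv ℝ Φ x b := by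
  have := h.metric (Φ x) (fderiv ℝ Φ x a) (fderiv ℝ Φ x b)
  rwa [h.fderiv_fderiv_symm hU hx, h.fderiv_fderiv_symm hU hx, h.symm_apply hx] at this

end IsGaussianChart

end GaussianChart

/-! ### Volume, distance and the gaussian distribution in a gaussian chart. -/

section Gaussian

set_option linter.unusedSectionVars false
set_option maxSynthPendingDepth 3

variable {ι : Type*} [Fintype ι] [DecidableEq ι]

lemma pderiv_apply_eq {ψ : (ι → ℝ) → (ι → ℝ)} {y : ι → ℝ} (hψ : DifferentiableAt ℝ ψ y) (k i : ι) :
    pderiv k (fun z => ψ z i) y = fderiv ℝ ψ y (Pi.single k 1) i := by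
  rw [pderiv, fderiv_apply hψ]
  rfl

lemma changeMetric_eq_metricForm {ψ : (ι → ℝ) → (ι → ℝ)} {y : ι → ℝ}
    (hψ : DifferentiableAt ℝ ψ y) (g : (ι → ℝ) → Matrix ι ι ℝ) (k l : ι) :
    changeMetric ψ g y k l
      = metricForm g (ψ y) (fderiv ℝ ψ y (Pi.single k 1)) (fderiv ℝ ψ y (Pi.single l 1)) := by
  rw [metricForm_apply]
  refine Finset.sum_congr rfl fun i _ => Finset.sum_congr rfl fun j _ => ?_
  rw [pderiv_apply_eq hψ, pderiv_apply_eq hψ]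
  ring

lemma metricForm_changeMetric {ψ : (ι → ℝ) → (ι → ℝ)} {y : ι → ℝ}
    (hψ : DifferentiableAt ℝ ψ y) (g : (ι → ℝ) → Matrix ι ι ℝ) (a b : ι → ℝ) :
    metricForm (changeMetric ψ g) y a b
      = metricForm g (ψ y) (fderiv ℝ ψ y a) (fderiv ℝ ψ y b) := by
  have : metricForm (changeMetric ψ g) y
      = (ContinuousLinearMap.compL ℝ (ι → ℝ) (ι → ℝ) ℝ).flip (fderiv ℝ ψ y) ∘L
        (metricForm g (ψ y) ∘L fderiv ℝ ψ y) := by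
    refine bilin_ext fun i j => ?_
    rw [metricForm_single, changeMetric_eq_metricForm hψ]
    rfl
  rw [this]
  rfl

lemma volDensity_changeMetric {ψ : (ι → ℝ) → (ι → ℝ)} {y : ι → ℝ}
    (hψ : DifferentiableAt ℝ ψ y) (g : (ι → ℝ) → Matrix ι ι ℝ) :
    volDensity (changeMetric ψ g) y = volDensity g (ψ y) * |(fderiv ℝ ψ y).det| := by
  set M := LinearMap.toMatrix' (fderiv ℝ ψ y : (ι → ℝ) →ₗ[ℝ] (ι → ℝ)) with hM
  have hMe : ∀ i k, M i k = fderiv ℝ ψ y (Pi.single k 1) i := fun i k =>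
    LinearMap.toMatrix'_apply _ i k
  have h1 : changeMetric ψ g y = M.transpose * g (ψ y) * M := by
    ext k l
    rw [changeMetric_eq_metricForm hψ, metricForm_apply, Finset.sum_comm, Matrix.mul_apply]
    refine Finset.sum_congr rfl fun j _ => ?_
    rw [Matrix.mul_apply, Finset.sum_mul]
    refine Finset.sum_congr rfl fun i _ => ?_
    rw [Matrix.transpose_apply, hMe, hMe]
    ring
  have h2 : (fderiv ℝ ψ y).det = M.det := by
    rw [hM, LinearMap.det_toMatrix']
  rw [volDensity, volDensity, h1, h2, ← Real.sqrt_sq_eq_abs, ← Real.sqrt_mul' _ (sq_nonneg _),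
    Matrix.det_smul, Matrix.det_smul, Matrix.det_mul, Matrix.det_mul, Matrix.det_transpose]
  congr 1
  ring

lemma gaussianPDFReal_zero_one (t : ℝ) :
    ProbabilityTheory.gaussianPDFReal 0 1 t = (√(2 * Real.pi))⁻¹ * Real.exp (-(1 / 2) * t ^ 2) := by
  rw [ProbabilityTheory.gaussianPDFReal]
  simp only [NNReal.coe_one, mul_one, sub_zero]
  congr 2
  ring

/-- The normalising constant is written as the volume density of the identity metric, the form in
which it appears after passing to a gaussian chart. -/
lemma prod_gaussianPDFReal (v : ι → ℝ) :
    ∏ k, ProbabilityTheory.gaussianPDFReal 0 1 (v k)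
      = Real.exp (-(1 / 2 * ∑ k, v k ^ 2)) * volDensity (fun _ => (1 : Matrix ι ι ℝ)) 0 := by
  simp only [gaussianPDFReal_zero_one]
  rw [Finset.prod_mul_distrib, ← Real.exp_sum, Finset.prod_const, Finset.card_univ, volDensity,
    Matrix.det_smul, Matrix.det_one, mul_one, ← Finset.mul_sum, mul_comm, neg_mul]
  congr 1
  symm
  rw [← Real.sqrt_inv, Real.sqrt_eq_iff_mul_self_eq_of_pos (by positivity), ← mul_pow,
    Real.mul_self_sqrt (by positivity)]

lemma isLineDensity_gaussian : IsLineDensity univ (ProbabilityTheory.gaussianPDFReal 0 1) where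
  isOpen := isOpen_univ
  interval := ordConnected_univ
  smooth := by
    rw [funext gaussianPDFReal_zero_one]
    fun_prop
  pos := fun t _ => ProbabilityTheory.gaussianPDFReal_pos 0 1 t one_ne_zero
  integral := by
    rw [Measure.restrict_univ]
    exact ProbabilityTheory.integral_gaussianPDFReal_eq_one 0 one_ne_zero

namespace IsGaussianChart

variable {U : Set (ι → ℝ)} {g : (ι → ℝ) → Matrix ι ι ℝ} {f : (ι → ℝ) → ℝ} {c : ι → ℝ}
  {Φ Ψ : (ι → ℝ) → (ι → ℝ)} (h : IsGaussianChart U g f c Φ Ψ)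
include h

lemma changeMetric_eq (v : ι → ℝ) : changeMetric Ψ g v = 1 := by
  ext k l
  rw [changeMetric_eq_metricForm (h.hasFDerivAt_symm v).differentiableAt, h.metric]
  simp [Matrix.one_apply, Pi.single_apply, eq_comm]

lemma volDensity_mul_det (v : ι → ℝ) : volDensity g (Ψ v) * |(fderiv ℝ Ψ v).det|
    = volDensity (fun _ => (1 : Matrix ι ι ℝ)) 0 := by
  rw [← volDensity_changeMetric (h.hasFDerivAt_symm v).differentiableAt, volDensity, volDensity,
    h.changeMetric_eq]

/-- In the chart the integrand becomes the standard normal density; the factor `2π` built into the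
volume element makes the integral exactly one. -/
lemma integral_exp : ∫ x in U, Real.exp (-(f x - f c)) * volDensity g x = 1 := by
  have h1 := integral_image_eq_integral_abs_det_fderiv_smul (volume : Measure (ι → ℝ))
    MeasurableSet.univ (fun v _ => (h.hasFDerivAt_symm v).hasFDerivWithinAt)
    h.injective_symm.injOn (fun x => Real.exp (-(f x - f c)) * volDensity g x)
  rw [h.image_symm, Measure.restrict_univ] at h1
  rw [h1]
  have h2 : ∀ v, |(fderiv ℝ Ψ v).det| • (Real.exp (-(f (Ψ v) - f c)) * volDensity g (Ψ v))
      = ∏ k, ProbabilityTheory.gaussianPDFReal 0 1 (v k) := by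
    intro v
    rw [prod_gaussianPDFReal, ← h.volDensity_mul_det v, h.potential_symm, smul_eq_mul]
    ring_nf
  simp only [h2]
  rw [integral_fintype_prod_volume_eq_prod]
  simp [ProbabilityTheory.integral_gaussianPDFReal_eq_one]

lemma contDiffOn_potential : ContDiffOn ℝ ∞ f U := by
  have hΦ := contDiffOn_pi.1 h.change.smooth
  exact (contDiffOn_const.add (contDiffOn_const.mul
    (ContDiffOn.sum fun k _ => (hΦ k).pow 2))).congr h.potential

variable (hU : IsOpen U)
include hU

/-- The Riemannian length of `γ` is the Euclidean length of `Φ ∘ γ`, which is at least that of the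
chord. -/
lemma le_curveLength {γ : ℝ → ι → ℝ} (hγ : ContDiff ℝ 1 γ)
    (hγU : ∀ t ∈ Icc (0 : ℝ) 1, γ t ∈ U) :
    √(∑ k, (Φ (γ 1) k - Φ (γ 0) k) ^ 2) ≤ curveLength g γ := by
  -- Functions `ι → ℝ` carry the sup norm; the integral inequality is needed for the Euclidean one.
  let E2 := (PiLp.continuousLinearEquiv 2 ℝ (fun _ : ι => ℝ)).symm
  have hd : ∀ t ∈ uIcc (0 : ℝ) 1,
      HasDerivAt (fun t => E2 (Φ (γ t))) (E2 (fderiv ℝ Φ (γ t) (deriv γ t))) t := by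
    intro t ht
    rw [uIcc_of_le zero_le_one] at ht
    have h1 := (hγ.differentiable (by simp) t).hasDerivAt
    have h2 := (h.hasFDerivAt hU (hγU t ht)).comp_hasDerivAt t h1
    exact E2.hasFDerivAt.comp_hasDerivAt t h2
  have hcont : ContinuousOn (fun t => E2 (fderiv ℝ Φ (γ t) (deriv γ t))) (uIcc 0 1) := by
    rw [uIcc_of_le zero_le_one]
    refine E2.continuous.comp_continuousOn (ContinuousOn.clm_apply ?_ ?_)
    · exact (h.change.smooth.continuousOn_fderiv_of_isOpen hU (by simp)).comp
        hγ.continuous.continuousOn hγU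
    · exact (hγ.continuous_deriv (by simp)).continuousOn
  have hftc := intervalIntegral.integral_eq_sub_of_hasDerivAt hd hcont.intervalIntegrable
  have hle := intervalIntegral.norm_integral_le_integral_norm (μ := volume)
    (f := fun t => E2 (fderiv ℝ Φ (γ t) (deriv γ t))) (zero_le_one' ℝ)
  rw [hftc, ← map_sub, EuclideanSpace.norm_eq] at hle
  have e1 : ∀ w : ι → ℝ, ∀ k, (E2 w) k = w k := fun w k => rfl
  simp only [e1, Pi.sub_apply, Real.norm_eq_abs, sq_abs] at hle
  refine hle.trans (le_of_eq ?_)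
  refine intervalIntegral.integral_congr fun t ht => ?_
  rw [uIcc_of_le zero_le_one] at ht
  simp only [EuclideanSpace.norm_eq, e1, Real.norm_eq_abs, sq_abs]
  rw [← metricForm_apply, h.metricForm_eq hU (hγU t ht), dotProduct]
  simp only [pow_two]

/-- The squared distance to the centre is twice the potential. -/
lemma sepDist_sq {x : ι → ℝ} (hx : x ∈ U) : sepDist U g x c ^ 2 = 2 * (f x - f c) := by
  have hΨ0 : Ψ 0 = c := by rw [← h.center, h.symm_apply h.center_mem]
  have key : sepDist U g x c = √(∑ k, Φ x k ^ 2) := by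
    have hmem : √(∑ k, Φ x k ^ 2) ∈ {L | ∃ γ : ℝ → (ι → ℝ), ContDiff ℝ 1 γ ∧ γ 0 = x ∧ γ 1 = c ∧
        (∀ t ∈ Icc (0 : ℝ) 1, γ t ∈ U) ∧ L = curveLength g γ} := by
      -- The straight segment in the chart attains the infimum.
      refine ⟨fun t => Ψ ((1 - t) • Φ x), ?_, ?_, ?_, fun t _ => h.symm_mem _, ?_⟩
      · exact (h.contDiff_symm.of_le (by simp)).comp (by fun_prop)
      · simp [h.symm_apply hx]
      · simp [hΨ0]
      · have hd : ∀ t : ℝ, HasDerivAt (fun t : ℝ => Ψ ((1 - t) • Φ x))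
            (fderiv ℝ Ψ ((1 - t) • Φ x) (-Φ x)) t := by
          intro t
          have h1 : HasDerivAt (fun t : ℝ => (1 - t) • Φ x) (-Φ x) t := by
            simpa using ((hasDerivAt_id t).const_sub 1).smul_const (Φ x)
          exact (h.hasFDerivAt_symm _).comp_hasDerivAt t h1
        have h2 : ∀ t : ℝ, √(∑ i, ∑ j, g (Ψ ((1 - t) • Φ x)) i j
            * deriv (fun t : ℝ => Ψ ((1 - t) • Φ x)) t i
            * deriv (fun t : ℝ => Ψ ((1 - t) • Φ x)) t j) = √(∑ k, Φ x k ^ 2) := by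
          intro t
          rw [← metricForm_apply, (hd t).deriv, h.metric]
          simp [dotProduct, pow_two]
        simp only [curveLength, h2]
        simp
    refine le_antisymm (csInf_le ⟨0, ?_⟩ hmem) (le_csInf ⟨_, hmem⟩ ?_)
    · rintro L ⟨γ, -, -, -, -, rfl⟩
      exact intervalIntegral.integral_nonneg zero_le_one fun t _ => Real.sqrt_nonneg _
    · rintro L ⟨γ, hγ, h0, h1, hγU, rfl⟩
      have := h.le_curveLength hU hγ hγU
      rw [h0, h1, h.center] at this
      simpa using this
  rw [key, Real.sq_sqrt (Finset.sum_nonneg fun k _ => sq_nonneg _), h.potential x hx]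
  ring

lemma gaussZ_eq_one : gaussZ U g c = 1 := by
  rw [← h.integral_exp, gaussZ]
  refine setIntegral_congr_fun hU.measurableSet fun x hx => ?_
  simp only [h.sepDist_sq hU hx]
  ring_nf

lemma gaussPotential_eq_zero : gaussPotential U g c = 0 := by
  simp [gaussPotential, h.gaussZ_eq_one hU]

lemma gaussDensity_eq {x : ι → ℝ} (hx : x ∈ U) :
    gaussDensity U g c x = Real.exp (-(f x - f c)) * volDensity g x := by
  rw [gaussDensity, h.gaussZ_eq_one hU, h.sepDist_sq hU hx]
  ring_nf

lemma weight_gaussDensity (hg : IsRiemannianMetric U g) {x : ι → ℝ} (hx : x ∈ U) :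
    weight (gaussDensity U g c) g x = Real.exp (-(f x - f c)) := by
  have h1 := hg.weight_mul_volDensity hx (gaussDensity U g c)
  rw [h.gaussDensity_eq hU hx] at h1
  exact mul_right_cancel₀ (hg.volDensity_pos hx).ne' h1

lemma infoPotential_gaussDensity (hg : IsRiemannianMetric U g) {x : ι → ℝ} (hx : x ∈ U) :
    infoPotential (gaussDensity U g c) g x = -(f x - f c) := by
  rw [infoPotential, h.weight_gaussDensity hU hg hx, Real.log_exp]

/-- The weight is `exp(-½|Φ|²)`, so the set where it is at least `ε` is the image under `Ψ` of a
closed bounded set of the Euclidean space. -/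
lemma tendsto_weight (hg : IsRiemannianMetric U g) :
    Tendsto (fun x : U => weight (gaussDensity U g c) g (x : ι → ℝ)) (cocompact U) (𝓝 0) := by
  rw [Metric.tendsto_nhds]
  intro ε hε
  refine Filter.mem_cocompact.2 ⟨(fun v => (⟨Ψ v, h.symm_mem v⟩ : U)) ''
    {v | ε ≤ Real.exp (-(1 / 2 * ∑ k, v k ^ 2))}, ?_, ?_⟩
  · refine IsCompact.image ?_ (h.contDiff_symm.continuous.subtype_mk _)
    refine Metric.isCompact_of_isClosed_isBounded (isClosed_le continuous_const (by fun_prop)) ?_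
    refine (Metric.isBounded_closedBall (x := (0 : ι → ℝ)) (r := √(-2 * Real.log ε))).subset ?_
    intro v hv
    rw [mem_closedBall_zero_iff, pi_norm_le_iff_of_nonneg (Real.sqrt_nonneg _)]
    intro k
    refine Real.le_sqrt_of_sq_le ?_
    have h2 : Real.log ε ≤ -(1 / 2 * ∑ k, v k ^ 2) := by
      rw [← Real.log_exp (-(1 / 2 * ∑ k, v k ^ 2))]
      exact Real.log_le_log hε hv
    have h3 : v k ^ 2 ≤ ∑ k, v k ^ 2 :=
      Finset.single_le_sum (f := fun k => v k ^ 2) (fun k _ => sq_nonneg _) (Finset.mem_univ k)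
    rw [Real.norm_eq_abs, sq_abs]
    linarith
  · intro x hx
    by_contra hn
    refine hx ⟨Φ x, ?_, Subtype.ext (h.symm_apply x.2)⟩
    simp only [mem_ofPred_eq, Real.dist_eq, sub_zero, not_lt] at hn
    rw [h.weight_gaussDensity hU hg x.2, Real.abs_exp, h.potential x x.2] at hn
    simpa using hn

/-- A region with a gaussian chart, endowed with its gaussian distribution, is a statistical
manifold. -/
lemma isStatisticalManifold (hg : IsRiemannianMetric U g) :
    IsStatisticalManifold U (gaussDensity U g c) g := by
  have hpos : ∀ x ∈ U, 0 < gaussDensity U g c x := fun x hx => by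
    rw [h.gaussDensity_eq hU hx]
    exact mul_pos (Real.exp_pos _) (hg.volDensity_pos hx)
  have hsm : ContDiffOn ℝ ∞ (gaussDensity U g c) U :=
    (((h.contDiffOn_potential.sub contDiffOn_const).neg.exp).mul hg.contDiffOn_volDensity).congr
      fun x hx => h.gaussDensity_eq hU hx
  exact
    { isOpen := hU
      diffeo := ⟨Φ, Ψ, h.change⟩
      density_smooth := hsm
      density_pos := hpos
      density_integral := by
        rw [← h.integral_exp]
        exact setIntegral_congr_fun hU.measurableSet fun x hx => h.gaussDensity_eq hU hx
      metric := hg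
      metric_eq := fun x hx => by
        refine (hg.hessianEq_iff hU hpos hsm hx).1 ?_
        have hfc : ∀ y ∈ U, f c + 1 / 2 * ∑ k, Φ y k ^ 2 - f c
            = -infoPotential (gaussDensity U g c) g y := fun y hy => by
          rw [h.infoPotential_gaussDensity hU hg hy, h.potential y hy]
          ring
        -- The additive constant `0` is the right one, since minus the information potential of the
        -- gaussian distribution is `½|Φ|²`.
        have h2 := hg.hessianEq_of_isometry hU h.change.smooth (fun y hy i j => by
          rw [← metricForm_single g, h.metricForm_eq hU hy, dotProduct]
          refine Finset.sum_congr rfl fun k _ => ?_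
          rw [pderiv_apply_eq (h.hasFDerivAt hU hy).differentiableAt,
            pderiv_apply_eq (h.hasFDerivAt hU hy).differentiableAt]) hx 0
        refine HessianEq.congr hU (fun y hy => ?_) hx h2
        rw [← hfc y hy]
        ring
      weight_boundary := h.tendsto_weight hU hg }

end IsGaussianChart

end Gaussian

/-! ### Linear algebra of blocks of coordinates. -/

section Blocks

set_option linter.unusedSectionVars false
set_option maxSynthPendingDepth 3

variable {ι : Type*} [Fintype ι] [DecidableEq ι] {l : ℕ} (b : ι → Fin l) (k : Fin l)

/-- Extension by zero of the coordinates of the `k`-th block. -/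
def blockIncl : ({i // b i = k} → ℝ) →L[ℝ] (ι → ℝ) :=
  ContinuousLinearMap.pi fun i =>
    if h : b i = k then ContinuousLinearMap.proj (φ := fun _ : {i // b i = k} => ℝ) ⟨i, h⟩ else 0

/-- The projection that annihilates the coordinates of the `k`-th block. -/
def blockCompl : (ι → ℝ) →L[ℝ] (ι → ℝ) :=
  ContinuousLinearMap.pi fun i =>
    if b i = k then 0 else ContinuousLinearMap.proj (φ := fun _ : ι => ℝ) i

/-- The coordinates of the `k`-th block as a continuous linear map. -/
def blockProj : (ι → ℝ) →L[ℝ] ({i // b i = k} → ℝ) :=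
  ContinuousLinearMap.pi fun i => ContinuousLinearMap.proj (φ := fun _ : ι => ℝ) i

/-- The point with `k`-th block `a`, the other coordinates being those of `z`. -/
def insertBlock (z : ι → ℝ) (a : {i // b i = k} → ℝ) : ι → ℝ := blockCompl b k z + blockIncl b k a

variable {b k}

lemma blockProj_apply (y : ι → ℝ) : blockProj b k y = block b k y := rfl

lemma blockIncl_apply_of_eq (a : {i // b i = k} → ℝ) {i : ι} (hi : b i = k) :
    blockIncl b k a i = a ⟨i, hi⟩ := by simp [blockIncl, hi]

lemma blockIncl_apply_of_ne (a : {i // b i = k} → ℝ) {i : ι} (hi : b i ≠ k) :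
    blockIncl b k a i = 0 := by simp [blockIncl, hi]

lemma blockCompl_apply_of_eq (z : ι → ℝ) {i : ι} (hi : b i = k) : blockCompl b k z i = 0 := by
  simp [blockCompl, hi]

lemma blockCompl_apply_of_ne (z : ι → ℝ) {i : ι} (hi : b i ≠ k) : blockCompl b k z i = z i := by
  simp [blockCompl, hi]

lemma insertBlock_apply_of_eq (z : ι → ℝ) (a : {i // b i = k} → ℝ) {i : ι} (hi : b i = k) :
    insertBlock b k z a i = a ⟨i, hi⟩ := by
  rw [insertBlock, Pi.add_apply, blockCompl_apply_of_eq _ hi, blockIncl_apply_of_eq _ hi, zero_add]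

lemma insertBlock_apply_of_ne (z : ι → ℝ) (a : {i // b i = k} → ℝ) {i : ι} (hi : b i ≠ k) :
    insertBlock b k z a i = z i := by
  rw [insertBlock, Pi.add_apply, blockCompl_apply_of_ne _ hi, blockIncl_apply_of_ne _ hi, add_zero]

lemma block_insertBlock (z : ι → ℝ) (a : {i // b i = k} → ℝ) :
    block b k (insertBlock b k z a) = a :=
  funext fun i => insertBlock_apply_of_eq z a i.2

lemma block_insertBlock_of_ne (z : ι → ℝ) (a : {i // b i = k} → ℝ) {k' : Fin l} (hk : k' ≠ k) :
    block b k' (insertBlock b k z a) = block b k' z :=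
  funext fun i => insertBlock_apply_of_ne z a (by rw [i.2]; exact hk)

lemma insertBlock_block (z y : ι → ℝ) (h : ∀ i, b i ≠ k → y i = z i) :
    insertBlock b k z (block b k y) = y := by
  funext i
  by_cases hi : b i = k
  · rw [insertBlock_apply_of_eq _ _ hi]; rfl
  · rw [insertBlock_apply_of_ne _ _ hi, h i hi]

lemma blockIncl_single (i : {i // b i = k}) :
    blockIncl b k (Pi.single i 1) = Pi.single (i : ι) 1 := by
  funext j
  by_cases hj : b j = k
  · rw [blockIncl_apply_of_eq _ hj]
    simp [Pi.single_apply, Subtype.ext_iff]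
  · rw [blockIncl_apply_of_ne _ hj, Pi.single_apply, if_neg]
    rintro rfl
    exact hj i.2

lemma blockCompl_single_of_eq {i : ι} (hi : b i = k) :
    blockCompl b k (Pi.single i 1) = 0 := by
  funext j
  by_cases hj : b j = k
  · rw [blockCompl_apply_of_eq _ hj]; rfl
  · rw [blockCompl_apply_of_ne _ hj, Pi.single_apply, if_neg]
    · rfl
    · rintro rfl
      exact hj hi

lemma blockCompl_single_of_ne {i : ι} (hi : b i ≠ k) :
    blockCompl b k (Pi.single i 1) = Pi.single i 1 := by
  funext j
  by_cases hj : b j = k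
  · rw [blockCompl_apply_of_eq _ hj, Pi.single_apply, if_neg]
    rintro rfl
    exact hi hj
  · rw [blockCompl_apply_of_ne _ hj]

lemma blockProj_single_of_ne {i : ι} (hi : b i ≠ k) : blockProj b k (Pi.single i 1) = 0 := by
  funext j
  have : (j : ι) ≠ i := by
    intro h
    exact hi (h ▸ j.2)
  simp [blockProj, this]

lemma blockProj_single (i : {i // b i = k}) :
    blockProj b k (Pi.single (i : ι) 1) = Pi.single i 1 := by
  funext j
  simp [blockProj, Pi.single_apply, Subtype.ext_iff]

lemma hasFDerivAt_insertBlock (z : ι → ℝ) (a : {i // b i = k} → ℝ) :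
    HasFDerivAt (insertBlock b k z) (blockIncl b k) a :=
  (blockIncl b k).hasFDerivAt.const_add _

lemma hasFDerivAt_insertBlock_left (z : ι → ℝ) (a : {i // b i = k} → ℝ) :
    HasFDerivAt (fun z => insertBlock b k z a) (blockCompl b k) z :=
  (blockCompl b k).hasFDerivAt.add_const _

lemma contDiff_insertBlock (z : ι → ℝ) : ContDiff ℝ ∞ (insertBlock b k z) :=
  contDiff_const.add (blockIncl b k).contDiff

end Blocks

/-! ### Splitting of the metric and of the potential along a Cartesian decomposition. -/

namespace CartesianDecomposition

section Decomposition

set_option linter.unusedSectionVars false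
set_option maxSynthPendingDepth 3

variable {ι : Type*} [Fintype ι] [DecidableEq ι] {U : Set (ι → ℝ)}
  {g : (ι → ℝ) → Matrix ι ι ℝ} (D : CartesianDecomposition U g)

/-- The product of the coordinate representations of the factors. -/
def domain : Set (ι → ℝ) := {y | ∀ k, block D.b k y ∈ D.W k}

lemma isOpen_domain : IsOpen D.domain := by
  have : D.domain = ⋂ k, blockProj D.b k ⁻¹' D.W k := by
    ext y
    simp [domain, blockProj_apply]
  rw [this]
  exact isOpen_iInter_of_finite fun k => (D.W_open k).preimage (blockProj D.b k).continuous

lemma insertBlock_mem {z : ι → ℝ} (hz : z ∈ D.domain) {k : Fin D.l} {a : {i // D.b i = k} → ℝ}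
    (ha : a ∈ D.W k) : insertBlock D.b k z a ∈ D.domain := by
  intro k'
  by_cases hk : k' = k
  · subst hk
    rwa [block_insertBlock]
  · rw [block_insertBlock_of_ne _ _ hk]
    exact hz k'

lemma hasFDerivAt_symm {y : ι → ℝ} (hy : y ∈ D.domain) : HasFDerivAt D.ψ (fderiv ℝ D.ψ y) y :=
  (differentiableAt_of_contDiffOn D.isOpen_domain D.change.smooth_inv hy).hasFDerivAt

lemma fderiv_symm_injective (hU : IsOpen U) {y : ι → ℝ} (hy : y ∈ D.domain) {a : ι → ℝ}
    (ha : fderiv ℝ D.ψ y a = 0) : a = 0 := by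
  have h0 : D.ψ y ∈ U := D.change.mapsTo_inv hy
  have h1 := ((differentiableAt_of_contDiffOn hU D.change.smooth h0).hasFDerivAt).comp y
    (D.hasFDerivAt_symm hy)
  have h2 : (D.φ ∘ D.ψ) =ᶠ[𝓝 y] id := by
    filter_upwards [D.isOpen_domain.mem_nhds hy] with z hz using D.change.right_inv z hz
  have := congrArg (fun A : (ι → ℝ) →L[ℝ] (ι → ℝ) => A a)
    (h1.unique ((hasFDerivAt_id y).congr_of_eventuallyEq h2))
  simpa [ha] using this.symm

lemma metric_block {y : ι → ℝ} (hy : y ∈ D.domain) (k : Fin D.l) (i j : {i // D.b i = k}) :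
    changeMetric D.ψ g y i j = D.G k (block D.b k y) i j := by
  obtain ⟨i, rfl⟩ := i
  rw [D.metric_eq y hy, dif_pos j.2]

lemma metric_of_ne {y : ι → ℝ} (hy : y ∈ D.domain) {i j : ι} (hij : D.b i ≠ D.b j) :
    changeMetric D.ψ g y i j = 0 := by
  rw [D.metric_eq y hy, dif_neg (Ne.symm hij)]

lemma isRiemannianMetric (hU : IsOpen U) (hg : IsRiemannianMetric U g) :
    IsRiemannianMetric D.domain (changeMetric D.ψ g) where
  smooth := fun i j => by
    by_cases hij : D.b j = D.b i
    · refine (((D.G_metric (D.b i)).smooth ⟨i, rfl⟩ ⟨j, hij⟩).comp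
        (blockProj D.b (D.b i)).contDiff.contDiffOn (show MapsTo (blockProj D.b (D.b i)) D.domain
          (D.W (D.b i)) from fun y hy => hy (D.b i))).congr fun y hy => ?_
      exact D.metric_block hy (D.b i) ⟨i, rfl⟩ ⟨j, hij⟩
    · exact (contDiffOn_const (c := (0 : ℝ))).congr fun y hy => D.metric_of_ne hy (Ne.symm hij)
  posDef := fun y hy => by
    have hd := (D.hasFDerivAt_symm hy).differentiableAt
    have h0 : D.ψ y ∈ U := D.change.mapsTo_inv hy
    refine Matrix.PosDef.of_dotProduct_mulVec_pos ?_ fun a ha => ?_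
    · ext i j
      rw [Matrix.conjTranspose_apply, star_trivial, changeMetric_eq_metricForm hd,
        changeMetric_eq_metricForm hd, hg.metricForm_symm h0]
    · rw [star_trivial, ← metricForm_eq_dotProduct, metricForm_changeMetric hd]
      exact hg.metricForm_pos h0 _ fun h => ha (D.fderiv_symm_injective hU hy h)

/-- The invariant volume element of the product is the product of those of the factors. -/
lemma volDensity_eq_prod {y : ι → ℝ} (hy : y ∈ D.domain) :
    volDensity (changeMetric D.ψ g) y = ∏ k, volDensity (D.G k) (block D.b k y) := by
  -- The block form of the metric reduces the determinant to those of the diagonal blocks, and the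
  -- power of `2π` splits with it.
  have ht : Matrix.BlockTriangular ((2 * Real.pi)⁻¹ • changeMetric D.ψ g y) D.b := by
    intro i j hij
    rw [Matrix.smul_apply, D.metric_of_ne hy hij.ne', smul_zero]
  have hb : ∀ k, Matrix.toSquareBlock ((2 * Real.pi)⁻¹ • changeMetric D.ψ g y) D.b k
      = (2 * Real.pi)⁻¹ • D.G k (block D.b k y) := by
    intro k
    ext i j
    rw [Matrix.toSquareBlock_def, Matrix.of_apply, Matrix.smul_apply, Matrix.smul_apply,
      D.metric_block hy]
  have hpos : ∀ k, 0 ≤ ((2 * Real.pi)⁻¹ • D.G k (block D.b k y)).det := fun k =>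
    (Real.sqrt_pos.1 ((D.G_metric k).volDensity_pos (hy k))).le
  simp only [volDensity]
  rw [ht.det_fintype, Real.sqrt_eq_iff_mul_self_eq (Finset.prod_nonneg fun k _ => by
    rw [hb]; exact hpos k) (Finset.prod_nonneg fun k _ => Real.sqrt_nonneg _),
    ← Finset.prod_mul_distrib]
  refine Finset.prod_congr rfl fun k _ => ?_
  rw [hb, Real.mul_self_sqrt (hpos k)]

section Potential

variable {f : (ι → ℝ) → ℝ} {c : ι → ℝ} {Φ Ψ : (ι → ℝ) → (ι → ℝ)}
  (h : IsGaussianChart U g f c Φ Ψ) (hU : IsOpen U) (hg : IsRiemannianMetric U g)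
include h

lemma isPreconnected_domain : IsPreconnected D.domain := by
  have : D.domain = D.φ '' U := Subset.antisymm
    (fun y hy => ⟨D.ψ y, D.change.mapsTo_inv hy, D.change.right_inv y hy⟩)
    (by rintro _ ⟨x, hx, rfl⟩; exact D.change.mapsTo hx)
  rw [this]
  exact h.isPreconnected.image _ D.change.smooth.continuousOn

lemma contDiffOn_comp : ContDiffOn ℝ ∞ (fun y => f (D.ψ y)) D.domain :=
  h.contDiffOn_potential.comp D.change.smooth_inv D.change.mapsTo_inv

include hU hg

/-- The map `Φ ∘ ψ` is an isometry of the product onto the Euclidean space, so the equation in the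
new coordinates comes from `hessianEq_of_isometry`, with no transformation law for the Levi-Civita
symbols. -/
lemma hessianEq {y : ι → ℝ} (hy : y ∈ D.domain) :
    HessianEq (changeMetric D.ψ g) (fun y => f (D.ψ y)) y := by
  refine HessianEq.congr D.isOpen_domain
    (fun z hz => (h.potential _ (D.change.mapsTo_inv hz)).symm) hy
    ((D.isRiemannianMetric hU hg).hessianEq_of_isometry (Θ := fun z => Φ (D.ψ z)) D.isOpen_domain
      (h.change.smooth.comp D.change.smooth_inv D.change.mapsTo_inv) (fun z hz i j => ?_) hy (f c))
  have h0 : D.ψ z ∈ U := D.change.mapsTo_inv hz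
  have hd : HasFDerivAt (fun z => Φ (D.ψ z)) ((fderiv ℝ Φ (D.ψ z)).comp (fderiv ℝ D.ψ z)) z :=
    (h.hasFDerivAt hU h0).comp z (D.hasFDerivAt_symm hz)
  rw [changeMetric_eq_metricForm (D.hasFDerivAt_symm hz).differentiableAt,
    h.metricForm_eq hU h0, dotProduct]
  refine Finset.sum_congr rfl fun k _ => ?_
  rw [pderiv_apply_eq hd.differentiableAt, pderiv_apply_eq hd.differentiableAt, hd.fderiv]
  rfl

lemma pderiv_metric_of_ne {y : ι → ℝ} (hy : y ∈ D.domain) {i j : ι} (hij : D.b i ≠ D.b j)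
    (m : ι) : pderiv i (fun z => changeMetric D.ψ g z j m) y = 0 := by
  by_cases hm : D.b m = D.b j
  · have hG : HasFDerivAt (fun z => D.G (D.b j) (blockProj D.b (D.b j) z) ⟨j, rfl⟩ ⟨m, hm⟩)
        ((fderiv ℝ (fun a => D.G (D.b j) a ⟨j, rfl⟩ ⟨m, hm⟩) (blockProj D.b (D.b j) y)).comp
          (blockProj D.b (D.b j))) y :=
      ((D.G_metric (D.b j)).hasFDerivAt (D.W_open _) (hy (D.b j)) ⟨j, rfl⟩ ⟨m, hm⟩).comp y
        (blockProj D.b (D.b j)).hasFDerivAt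
    rw [pderiv_congr D.isOpen_domain (fun z hz => D.metric_block hz (D.b j) ⟨j, rfl⟩ ⟨m, hm⟩) hy,
      pderiv]
    simp only [← blockProj_apply]
    rw [hG.fderiv, ContinuousLinearMap.comp_apply, blockProj_single_of_ne hij, map_zero]
  · rw [pderiv_congr D.isOpen_domain (g := fun _ => 0)
      (fun z hz => D.metric_of_ne hz (Ne.symm hm)) hy, pderiv]
    simp

/-- The mixed second derivatives of the potential vanish. -/
lemma pderiv_pderiv_of_ne {y : ι → ℝ} (hy : y ∈ D.domain) {i j : ι} (hij : D.b i ≠ D.b j) :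
    pderiv i (pderiv j (fun y => f (D.ψ y))) y = 0 := by
  -- For `i`, `j` in different blocks `g_ij` vanishes identically and the other two metric
  -- derivatives in the symbol are taken across blocks, so the Hessian equation reduces to the
  -- claim.
  have h1 := D.hessianEq h hU hg hy i j
  have h2 : ∀ k, christoffel (changeMetric D.ψ g) k i j y = 0 := by
    intro k
    refine Finset.sum_eq_zero fun m _ => ?_
    rw [D.pderiv_metric_of_ne h hU hg hy hij, D.pderiv_metric_of_ne h hU hg hy (Ne.symm hij),
      pderiv_congr D.isOpen_domain (g := fun _ => 0) (fun z hz => D.metric_of_ne hz hij) hy]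
    simp [pderiv]
  rw [D.metric_of_ne hy hij] at h1
  simp only [h2, zero_mul, Finset.sum_const_zero, sub_zero] at h1
  exact h1.symm

/-- The derivatives of the potential along a block depend on the coordinates of the block only. -/
lemma pderiv_insertBlock {y z : ι → ℝ} (hy : y ∈ D.domain) (hz : z ∈ D.domain) (j : ι) :
    pderiv j (fun y => f (D.ψ y)) (insertBlock D.b (D.b j) z (block D.b (D.b j) y))
      = pderiv j (fun y => f (D.ψ y)) y := by
  set F := fun y => f (D.ψ y)
  have hF : ContDiffOn ℝ ∞ (pderiv j F) D.domain :=
    contDiffOn_pderiv D.isOpen_domain (D.contDiffOn_comp h) j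
  -- With the block of `j` frozen, directions in that block contribute nothing and the others
  -- contribute mixed second derivatives; hence constancy in `w`.
  have hd : ∀ w ∈ D.domain, HasFDerivAt
      (fun w => pderiv j F (insertBlock D.b (D.b j) w (block D.b (D.b j) y))) (0 : (ι → ℝ) →L[ℝ] ℝ) w := by
    intro w hw
    have hm := D.insertBlock_mem hw (hy (D.b j))
    have h1 := ((differentiableAt_of_contDiffOn D.isOpen_domain hF hm).hasFDerivAt).comp w
      (hasFDerivAt_insertBlock_left w (block D.b (D.b j) y))
    refine h1.congr_fderiv (ContinuousLinearMap.coe_injective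
      (LinearMap.pi_ext' fun i => LinearMap.ext_ring ?_))
    change fderiv ℝ (pderiv j F) _ (blockCompl D.b (D.b j) (Pi.single i 1)) = 0
    by_cases hi : D.b i = D.b j
    · rw [blockCompl_single_of_eq hi, map_zero]
    · rw [blockCompl_single_of_ne hi]
      exact D.pderiv_pderiv_of_ne h hU hg hm hi
  have := D.isOpen_domain.is_const_of_fderiv_eq_zero (D.isPreconnected_domain h)
    (fun w hw => (hd w hw).differentiableAt.differentiableWithinAt)
    (fun w hw => (hd w hw).fderiv) hz hy
  rw [this, insertBlock_block _ _ fun _ _ => rfl]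

omit hU hg in
lemma center_mem_domain : D.φ c ∈ D.domain := D.change.mapsTo h.center_mem

omit hg in
lemma pderiv_center (j : ι) : pderiv j (fun y => f (D.ψ y)) (D.φ c) = 0 := by
  have hl : IsLocalMin (fun y => f (D.ψ y)) (D.φ c) := by
    filter_upwards [D.isOpen_domain.mem_nhds (D.center_mem_domain h)] with y hy
    rw [D.change.left_inv c h.center_mem, h.potential _ (D.change.mapsTo_inv hy)]
    have : 0 ≤ ∑ k, Φ (D.ψ y) k ^ 2 := Finset.sum_nonneg fun k _ => sq_nonneg _
    linarith
  rw [pderiv, hl.fderiv_eq_zero]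
  rfl

omit h hU hg in
/-- The potential of the `k`-th factor. -/
def factorPotential (f : (ι → ℝ) → ℝ) (c : ι → ℝ) (k : Fin D.l) (a : {i // D.b i = k} → ℝ) : ℝ :=
  f (D.ψ (insertBlock D.b k (D.φ c) a))

omit hU hg in
lemma contDiffOn_factorPotential (k : Fin D.l) :
    ContDiffOn ℝ ∞ (D.factorPotential f c k) (D.W k) :=
  (D.contDiffOn_comp h).comp (contDiff_insertBlock _).contDiffOn
    fun _ ha => D.insertBlock_mem (D.center_mem_domain h) ha

omit hU hg in
lemma hasFDerivAt_factorPotential {k : Fin D.l} {a : {i // D.b i = k} → ℝ} (ha : a ∈ D.W k) :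
    HasFDerivAt (D.factorPotential f c k) ((fderiv ℝ (fun y => f (D.ψ y))
      (insertBlock D.b k (D.φ c) a)).comp (blockIncl D.b k)) a :=
  ((differentiableAt_of_contDiffOn D.isOpen_domain (D.contDiffOn_comp h)
    (D.insertBlock_mem (D.center_mem_domain h) ha)).hasFDerivAt).comp a
    (hasFDerivAt_insertBlock (D.φ c) a)

omit hU hg in
lemma factorPotential_center (k : Fin D.l) :
    D.factorPotential f c k (block D.b k (D.φ c)) = f c := by
  rw [factorPotential, insertBlock_block _ _ fun _ _ => rfl, D.change.left_inv c h.center_mem]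

/-- The potential is the sum of the potentials of the factors. -/
lemma potential_eq_sum {y : ι → ℝ} (hy : y ∈ D.domain) :
    f (D.ψ y) - f c = ∑ k, (D.factorPotential f c k (block D.b k y) - f c) := by
  have hc := D.center_mem_domain h
  -- In the direction `j` only the block of `j` contributes to the sum, and `pderiv_insertBlock`
  -- equates its derivative on the slice through the centre with that at `z`.
  have hd : ∀ z ∈ D.domain, HasFDerivAt (fun z => f (D.ψ z)
      - ∑ k, (D.factorPotential f c k (blockProj D.b k z) - f c)) (0 : (ι → ℝ) →L[ℝ] ℝ) z := by
    intro z hz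
    have h1 := (differentiableAt_of_contDiffOn D.isOpen_domain
      (D.contDiffOn_comp h) hz).hasFDerivAt.sub (HasFDerivAt.fun_sum (u := Finset.univ) fun k _ =>
        ((D.hasFDerivAt_factorPotential h (hz k)).comp z
          (blockProj D.b k).hasFDerivAt).sub_const (f c))
    refine h1.congr_fderiv (ContinuousLinearMap.coe_injective
      (LinearMap.pi_ext' fun j => LinearMap.ext_ring ?_))
    change (fderiv ℝ (fun y => f (D.ψ y)) z - ∑ k, _) (Pi.single j 1) = 0
    rw [sub_apply, sum_apply, Finset.sum_eq_single (D.b j)]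
    · rw [ContinuousLinearMap.comp_apply, ContinuousLinearMap.comp_apply,
        blockProj_single (⟨j, rfl⟩ : {i // D.b i = D.b j}), blockIncl_single]
      have := D.pderiv_insertBlock h hU hg hz hc j
      rw [pderiv, pderiv] at this
      rw [this, sub_self]
    · intro k _ hk
      rw [ContinuousLinearMap.comp_apply, blockProj_single_of_ne (Ne.symm hk), map_zero]
    · intro hn
      exact (hn (Finset.mem_univ _)).elim
  have := D.isOpen_domain.is_const_of_fderiv_eq_zero (D.isPreconnected_domain h)
    (fun w hw => (hd w hw).differentiableAt.differentiableWithinAt)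
    (fun w hw => (hd w hw).fderiv) hy hc
  simp only [blockProj_apply, D.factorPotential_center h, D.change.left_inv c h.center_mem,
    sub_self, Finset.sum_const_zero] at this
  linarith

end Potential
end Decomposition
end CartesianDecomposition

/-! ### The factors as slices through the centre. -/

namespace CartesianDecomposition

section Factors

set_option linter.unusedSectionVars false
set_option maxSynthPendingDepth 3

variable {ι : Type*} [Fintype ι] [DecidableEq ι] {U : Set (ι → ℝ)}
  {g : (ι → ℝ) → Matrix ι ι ℝ} (D : CartesianDecomposition U g)
  {f : (ι → ℝ) → ℝ} {c : ι → ℝ} {Φ Ψ : (ι → ℝ) → (ι → ℝ)}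
  (h : IsGaussianChart U g f c Φ Ψ) (hU : IsOpen U) (hg : IsRiemannianMetric U g)
include h

lemma metricForm_factor {k : Fin D.l} {a : {i // D.b i = k} → ℝ} (ha : a ∈ D.W k)
    (u w : {i // D.b i = k} → ℝ) :
    metricForm (D.G k) a u w = metricForm (changeMetric D.ψ g) (insertBlock D.b k (D.φ c) a)
      (blockIncl D.b k u) (blockIncl D.b k w) := by
  have hm := D.insertBlock_mem (D.center_mem_domain h) ha
  have : metricForm (D.G k) a = (ContinuousLinearMap.compL ℝ ({i // D.b i = k} → ℝ) (ι → ℝ) ℝ).flip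
      (blockIncl D.b k) ∘L (metricForm (changeMetric D.ψ g) (insertBlock D.b k (D.φ c) a) ∘L
        blockIncl D.b k) := by
    refine bilin_ext fun i j => ?_
    change _ = metricForm (changeMetric D.ψ g) (insertBlock D.b k (D.φ c) a)
      (blockIncl D.b k (Pi.single i 1)) (blockIncl D.b k (Pi.single j 1))
    rw [metricForm_single, blockIncl_single, blockIncl_single, metricForm_single,
      D.metric_block hm, block_insertBlock]
  rw [this]
  rfl

lemma fderiv_fderiv_factorPotential {k : Fin D.l} {a : {i // D.b i = k} → ℝ} (ha : a ∈ D.W k)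
    (u w : {i // D.b i = k} → ℝ) :
    fderiv ℝ (fderiv ℝ (D.factorPotential f c k)) a u w
      = fderiv ℝ (fderiv ℝ (fun y => f (D.ψ y))) (insertBlock D.b k (D.φ c) a)
        (blockIncl D.b k u) (blockIncl D.b k w) := by
  have hm := D.insertBlock_mem (D.center_mem_domain h) ha
  have h1 := ((differentiableAt_of_contDiffOn D.isOpen_domain ((D.contDiffOn_comp h).fderiv_of_isOpen
    D.isOpen_domain (m := ∞) (by simp)) hm).hasFDerivAt.comp a
    (hasFDerivAt_insertBlock (D.φ c) a)).clm_apply (hasFDerivAt_const (blockIncl D.b k w) a)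
  have h2 := (differentiableAt_of_contDiffOn (D.W_open k) ((D.contDiffOn_factorPotential h k
    ).fderiv_of_isOpen (D.W_open k) (m := ∞) (by simp)) ha).hasFDerivAt.clm_apply
    (hasFDerivAt_const w a)
  have h3 : (fun a => fderiv ℝ (D.factorPotential f c k) a w) =ᶠ[𝓝 a] fun a =>
      fderiv ℝ (fun y => f (D.ψ y)) (insertBlock D.b k (D.φ c) a) (blockIncl D.b k w) := by
    filter_upwards [(D.W_open k).mem_nhds ha] with a' ha'
    rw [(D.hasFDerivAt_factorPotential h ha').fderiv]
    rfl
  have := congrArg (fun A : ({i // D.b i = k} → ℝ) →L[ℝ] ℝ => A u)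
    (h2.unique (h1.congr_of_eventuallyEq h3))
  simpa using this

include hU hg

lemma fderiv_metricForm_factor {k : Fin D.l} {a : {i // D.b i = k} → ℝ} (ha : a ∈ D.W k)
    (v u w : {i // D.b i = k} → ℝ) :
    fderiv ℝ (metricForm (D.G k)) a v u w
      = fderiv ℝ (metricForm (changeMetric D.ψ g)) (insertBlock D.b k (D.φ c) a)
        (blockIncl D.b k v) (blockIncl D.b k u) (blockIncl D.b k w) := by
  have hm := D.insertBlock_mem (D.center_mem_domain h) ha
  have h1 := ((((differentiableAt_of_contDiffOn D.isOpen_domain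
    (D.isRiemannianMetric hU hg).contDiffOn_metricForm hm).hasFDerivAt).comp a
    (hasFDerivAt_insertBlock (D.φ c) a)).clm_apply
      (hasFDerivAt_const (blockIncl D.b k u) a)).clm_apply
      (hasFDerivAt_const (blockIncl D.b k w) a)
  have h2 := ((differentiableAt_of_contDiffOn (D.W_open k)
    (D.G_metric k).contDiffOn_metricForm ha).hasFDerivAt.clm_apply
    (hasFDerivAt_const u a)).clm_apply (hasFDerivAt_const w a)
  have h3 : (fun a => metricForm (D.G k) a u w) =ᶠ[𝓝 a] fun a =>
      metricForm (changeMetric D.ψ g) (insertBlock D.b k (D.φ c) a)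
      (blockIncl D.b k u) (blockIncl D.b k w) := by
    filter_upwards [(D.W_open k).mem_nhds ha] with a' ha' using D.metricForm_factor h ha' u w
  have := congrArg (fun A : ({i // D.b i = k} → ℝ) →L[ℝ] ℝ => A v)
    (h2.unique (h1.congr_of_eventuallyEq h3))
  simpa using this

/-- The slices of the product are totally geodesic: the potential of a factor is a metric
potential. -/
lemma isMetricPotential_factor (hcpt : ∀ r, IsCompact {x ∈ U | f x ≤ r}) (k : Fin D.l) :
    IsMetricPotential (D.W k) (metricForm (D.G k)) (D.factorPotential f c k) where
  isOpen := D.W_open k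
  preconnected := by
    have : D.W k = blockProj D.b k '' D.domain := Subset.antisymm
      (fun a ha => ⟨insertBlock D.b k (D.φ c) a, D.insertBlock_mem (D.center_mem_domain h) ha,
        block_insertBlock _ _⟩)
      (by rintro _ ⟨y, hy, rfl⟩; exact hy k)
    rw [this]
    exact (D.isPreconnected_domain h).image _ (blockProj D.b k).continuous.continuousOn
  nonempty := ⟨_, D.center_mem_domain h k⟩
  smooth_metric := (D.G_metric k).contDiffOn_metricForm
  smooth := D.contDiffOn_factorPotential h k
  symm := fun _ ha => (D.G_metric k).metricForm_symm ha
  pos := fun _ ha => (D.G_metric k).metricForm_pos ha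
  hess := fun a ha X hX u w => by
    have hm := D.insertBlock_mem (D.center_mem_domain h) ha
    -- The gradient of the whole potential is tangent to the slice: transverse derivatives do not
    -- depend on the position in the slice and vanish at the centre. Hence the Hessian equation of
    -- the product restricts to the slice.
    have hX' : ∀ e, metricForm (changeMetric D.ψ g) (insertBlock D.b k (D.φ c) a)
        (blockIncl D.b k X) e
        = fderiv ℝ (fun y => f (D.ψ y)) (insertBlock D.b k (D.φ c) a) e := by
      intro e
      refine congrArg (fun A : (ι → ℝ) →L[ℝ] ℝ => A e) (ContinuousLinearMap.coe_injective
        (LinearMap.pi_ext' fun j => LinearMap.ext_ring ?_))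
      change metricForm (changeMetric D.ψ g) (insertBlock D.b k (D.φ c) a)
        (blockIncl D.b k X) (Pi.single j 1)
        = fderiv ℝ (fun y => f (D.ψ y)) (insertBlock D.b k (D.φ c) a) (Pi.single j 1)
      by_cases hj : D.b j = k
      · rw [← blockIncl_single (⟨j, hj⟩ : {i // D.b i = k}), ← D.metricForm_factor h ha, hX,
          (D.hasFDerivAt_factorPotential h ha).fderiv]
        rfl
      · have h1 := D.pderiv_insertBlock h hU hg hm (D.center_mem_domain h) j
        rw [block_insertBlock_of_ne _ _ hj, insertBlock_block _ _ fun _ _ => rfl,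
          D.pderiv_center h hU] at h1
        rw [pderiv] at h1
        rw [← h1, metricForm_apply]
        refine Finset.sum_eq_zero fun i _ => Finset.sum_eq_zero fun m _ => ?_
        by_cases hm' : m = j
        · subst hm'
          by_cases hi : D.b i = k
          · rw [D.metric_of_ne hm (by rw [hi]; exact Ne.symm hj)]
            ring
          · rw [blockIncl_apply_of_ne _ hi]
            ring
        · rw [Pi.single_eq_of_ne hm', mul_zero]
    have h2 := (D.hessianEq h hU hg hm).metricForm_eq D.isOpen_domain (D.isRiemannianMetric hU hg)
      (D.contDiffOn_comp h) hm hX' (blockIncl D.b k u) (blockIncl D.b k w)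
    rwa [← D.metricForm_factor h ha, ← D.fderiv_metricForm_factor h hU hg ha,
      ← D.fderiv_metricForm_factor h hU hg ha, ← D.fderiv_metricForm_factor h hU hg ha,
      ← D.fderiv_fderiv_factorPotential h ha] at h2
  compact := fun r => by
    -- A sublevel set of the factor is the projection of a compact sublevel set of the product cut
    -- by the closed slice.
    have hcl : IsClosed {y : ι → ℝ | ∀ i, D.b i ≠ k → y i = D.φ c i} := by
      simp only [ofPred_forall]
      exact isClosed_iInter fun i => isClosed_iInter fun _ =>
        isClosed_eq (continuous_apply i) continuous_const
    have h1 := (((hcpt r).image_of_continuousOn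
      (D.change.smooth.continuousOn.mono fun x hx => hx.1)).inter_right hcl).image
      (blockProj D.b k).continuous
    refine (congrArg IsCompact (Set.ext fun a => ⟨?_, ?_⟩)).mpr h1
    · rintro ⟨ha, har⟩
      have hm := D.insertBlock_mem (D.center_mem_domain h) ha
      exact ⟨_, ⟨⟨_, ⟨D.change.mapsTo_inv hm, har⟩, D.change.right_inv _ hm⟩,
        fun i hi => insertBlock_apply_of_ne _ _ hi⟩, block_insertBlock _ _⟩
    · rintro ⟨_, ⟨⟨x, ⟨hx, hxr⟩, rfl⟩, hy⟩, rfl⟩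
      refine ⟨D.change.mapsTo hx k, ?_⟩
      rw [factorPotential, blockProj_apply, insertBlock_block _ _ hy, D.change.left_inv x hx]
      exact hxr

/-- The centre of a gaussian chart is the strict minimum of its potential; the factor potential is a
restriction of `f`, so it cannot be smaller anywhere than at the block of `φ c`, where it equals `f
c`. -/
lemma exists_chart_factor (hcpt : ∀ r, IsCompact {x ∈ U | f x ≤ r}) (k : Fin D.l) :
    ∃ Φk Ψk, IsGaussianChart (D.W k) (D.G k) (D.factorPotential f c k) (block D.b k (D.φ c)) Φk Ψk := by
  obtain ⟨ck, Φk, Ψk, hk⟩ := exists_gaussianChart (D.G_metric k)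
    (D.isMetricPotential_factor h hU hg hcpt k)
  have hck : block D.b k (D.φ c) = ck := by
    by_contra hne
    have h1 := hk.potential_lt (D.center_mem_domain h k) hne
    rw [D.factorPotential_center h, factorPotential, h.potential _ (D.change.mapsTo_inv
      (D.insertBlock_mem (D.center_mem_domain h) hk.center_mem))] at h1
    have : 0 ≤ ∑ i, Φ (D.ψ (insertBlock D.b k (D.φ c) ck)) i ^ 2 :=
      Finset.sum_nonneg fun i _ => sq_nonneg _
    linarith
  exact ⟨Φk, Ψk, hck ▸ hk⟩

end Factors
end CartesianDecomposition

/-! ### Consequences for statistical manifolds. -/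

section StatisticalManifold

set_option linter.unusedSectionVars false

namespace IsStatisticalManifold

variable {ι : Type*} [Fintype ι] [DecidableEq ι] {U : Set (ι → ℝ)} {ρ : (ι → ℝ) → ℝ}
  {g : (ι → ℝ) → Matrix ι ι ℝ} (h : IsStatisticalManifold U ρ g)
include h

/-- The condition `-S ≤ r` means that the weight is at least `exp(-r)`, which by the boundary
condition happens only inside a compact set; closedness follows from continuity. -/
lemma isCompact_sublevel (r : ℝ) : IsCompact {x ∈ U | -infoPotential ρ g x ≤ r} := by
  have h1 := h.weight_boundary.eventually (gt_mem_nhds (Real.exp_pos (-r)))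
  obtain ⟨t, ht, hts⟩ := Filter.mem_cocompact.1 h1
  have hcont : Continuous fun x : U => -infoPotential ρ g (x : ι → ℝ) :=
    (continuousOn_iff_continuous_domRestrict.1
      (h.metric.contDiffOn_infoPotential h.density_pos h.density_smooth).continuousOn).neg
  have h2 : IsCompact {x : U | -infoPotential ρ g (x : ι → ℝ) ≤ r} := by
    refine ht.of_isClosed_subset (isClosed_le hcont continuous_const) fun x hx => ?_
    by_contra hn
    have h3 : weight ρ g (x : ι → ℝ) < Real.exp (-r) := hts hn
    have h4 := (Real.log_lt_iff_lt_exp (h.metric.weight_pos x.2 (h.density_pos x x.2))).2 h3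
    have h5 : -Real.log (weight ρ g (x : ι → ℝ)) ≤ r := hx
    linarith
  have h3 := h2.image continuous_subtype_val
  convert h3 using 1
  ext x
  simp [and_comm]

lemma isMetricPotential :
    IsMetricPotential U (metricForm g) (fun x => -infoPotential ρ g x) := by
  obtain ⟨φ, ψ, hφ⟩ := h.diffeo
  have hUe : U = ψ '' univ := Subset.antisymm
    (fun x hx => ⟨φ x, mem_univ _, hφ.left_inv x hx⟩)
    (by rintro _ ⟨y, hy, rfl⟩; exact hφ.mapsTo_inv hy)
  have hs : ContDiffOn ℝ ∞ (fun x => -infoPotential ρ g x) U :=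
    (h.metric.contDiffOn_infoPotential h.density_pos h.density_smooth).neg
  exact
    { isOpen := h.isOpen
      preconnected := by
        rw [hUe]
        exact isPreconnected_univ.image _ hφ.smooth_inv.continuousOn
      nonempty := ⟨ψ 0, hφ.mapsTo_inv (mem_univ 0)⟩
      smooth_metric := h.metric.contDiffOn_metricForm
      smooth := hs
      symm := fun _ hx => h.metric.metricForm_symm hx
      pos := fun _ hx => h.metric.metricForm_pos hx
      hess := fun x hx X hX a b => HessianEq.metricForm_eq
        ((h.metric.hessianEq_iff h.isOpen h.density_pos h.density_smooth hx).2 (h.metric_eq x hx))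
        h.isOpen h.metric hs hx hX a b
      compact := h.isCompact_sublevel }

lemma density_eq {x : ι → ℝ} (hx : x ∈ U) :
    ρ x = Real.exp (infoPotential ρ g x) * volDensity g x := by
  rw [infoPotential, Real.exp_log (h.metric.weight_pos hx (h.density_pos x hx)),
    h.metric.weight_mul_volDensity hx]

/-- A statistical manifold has a gaussian chart, centred at the maximum of the information
potential, where the latter vanishes. -/
lemma exists_chart : ∃ c Φ Ψ, IsGaussianChart U g (fun x => -infoPotential ρ g x) c Φ Ψ ∧
    infoPotential ρ g c = 0 := by
  obtain ⟨c, Φ, Ψ, hc⟩ := exists_gaussianChart h.metric h.isMetricPotential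
  refine ⟨c, Φ, Ψ, hc, ?_⟩
  -- The density is `exp(S(c))` times a gaussian of total mass one; both integrals being one, `S(c)
  -- = 0`.
  have h1 : ∫ x in U, ρ x = ∫ x in U, Real.exp (infoPotential ρ g c)
      * (Real.exp (-(-infoPotential ρ g x - -infoPotential ρ g c)) * volDensity g x) := by
    refine setIntegral_congr_fun h.isOpen.measurableSet fun x hx => ?_
    rw [h.density_eq hx, ← mul_assoc, ← Real.exp_add]
    congr 2
    ring
  rw [integral_const_mul, hc.integral_exp, h.density_integral, mul_one] at h1
  exact Real.exp_eq_one_iff _ |>.1 h1.symm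

lemma changeDensity_eq {V : Set (ι → ℝ)} {φ ψ : (ι → ℝ) → (ι → ℝ)} (hV : IsOpen V)
    (hφ : IsCoordChange U V φ ψ) {y : ι → ℝ} (hy : y ∈ V) :
    changeDensity ψ ρ y
      = Real.exp (infoPotential ρ g (ψ y)) * volDensity (changeMetric ψ g) y := by
  rw [changeDensity, h.density_eq (hφ.mapsTo_inv hy),
    volDensity_changeMetric (differentiableAt_of_contDiffOn hV hφ.smooth_inv hy), mul_assoc]

/-- The coordinates of the gaussian chart are independent standard normal variables. -/
lemma hasReducibleDependence : HasReducibleDependence U ρ := by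
  obtain ⟨c, Φ, Ψ, hc, h0⟩ := h.exists_chart
  refine ⟨univ, Φ, Ψ, fun _ => univ, fun _ => ProbabilityTheory.gaussianPDFReal 0 1, hc.change,
    fun _ => isLineDensity_gaussian, (pi_univ univ).symm, fun y hy => ?_⟩
  have h1 := hc.potential_symm y
  have h2 : volDensity (changeMetric Ψ g) y = volDensity (fun _ => (1 : Matrix ι ι ℝ)) 0 := by
    rw [volDensity, volDensity, hc.changeMetric_eq]
  rw [h.changeDensity_eq isOpen_univ hc.change hy, prod_gaussianPDFReal, h2]
  congr 2
  simp only [h0] at h1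
  linarith

end IsStatisticalManifold

/-- The metric is the identity in the gaussian chart, so each coordinate forms a block by itself;
the bound on `n` is what provides two factors. -/
lemma nonempty_cartesianDecomposition {n : ℕ} (hn : 2 ≤ n) {U : Set (Fin n → ℝ)}
    {ρ : (Fin n → ℝ) → ℝ} {g : (Fin n → ℝ) → Matrix (Fin n) (Fin n) ℝ}
    (h : IsStatisticalManifold U ρ g) : Nonempty (CartesianDecomposition U g) := by
  obtain ⟨c, Φ, Ψ, hc, -⟩ := h.exists_chart
  have hV : {y : Fin n → ℝ | ∀ k, block id k y ∈ (univ : Set ({i : Fin n // id i = k} → ℝ))}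
      = univ := by ext; simp
  exact ⟨{
    l := n
    two_le := hn
    b := id
    surj := Function.surjective_id
    W := fun _ => univ
    W_open := fun _ => isOpen_univ
    G := fun _ _ => 1
    G_metric := fun _ => ⟨fun _ _ => contDiffOn_const, fun _ _ => Matrix.PosDef.one⟩
    φ := Φ
    ψ := Ψ
    change := by rw [hV]; exact hc.change
    metric_eq := fun y _ i j => by
      rw [hc.changeMetric_eq, Matrix.one_apply]
      by_cases hij : i = j
      · subst hij
        simp
      · rw [if_neg hij]
        split_ifs with hji
        · exact absurd (Eq.symm hji) hij
        · rfl }⟩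

end StatisticalManifold

end FluctuationGeometry

end

/-! ### The proposition. -/

open FluctuationGeometry in
theorem proposition1 {Θ : Type*} (n : ℕ) (hn : 2 ≤ n) (U : Set (Fin n → ℝ))
    (ρ : Θ → (Fin n → ℝ) → ℝ) (g : Θ → (Fin n → ℝ) → Matrix (Fin n) (Fin n) ℝ)
    (hM : ∀ θ, IsStatisticalManifold U (ρ θ) (g θ)) (θ : Θ) :
    (HasReducibleDependence U (ρ θ) ↔ Nonempty (CartesianDecomposition U (g θ))) ∧
    ∀ D : CartesianDecomposition U (g θ), ∃ c ∈ U,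
      -- `c` is the unique point of maximum of the information potential
      (∀ x ∈ U, x ≠ c → infoPotential (ρ θ) (g θ) x < infoPotential (ρ θ) (g θ) c) ∧
      -- each factor, with its gaussian distribution, is a statistical manifold
      (∀ k, IsStatisticalManifold (D.W k)
        (gaussDensity (D.W k) (D.G k) (block D.b k (D.φ c))) (D.G k)) ∧
      -- the squared distance to `c` is additive
      (∀ x ∈ U, sepDist U (g θ) x c ^ 2 =
        ∑ k, sepDist (D.W k) (D.G k) (block D.b k (D.φ x)) (block D.b k (D.φ c)) ^ 2) ∧
      -- the invariant volume element factorizes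
      (∀ y, (∀ k, block D.b k y ∈ D.W k) →
        volDensity (changeMetric D.ψ (g θ)) y = ∏ k, volDensity (D.G k) (block D.b k y)) ∧
      -- the distribution factorizes
      (∀ y, (∀ k, block D.b k y ∈ D.W k) →
        changeDensity D.ψ (ρ θ) y =
          ∏ k, gaussDensity (D.W k) (D.G k) (block D.b k (D.φ c)) (block D.b k y)) ∧
      -- the gaussian partition function factorizes
      gaussZ U (g θ) c = ∏ k, gaussZ (D.W k) (D.G k) (block D.b k (D.φ c)) ∧
      -- the gaussian potential is additive
      gaussPotential U (g θ) c =
        ∑ k, gaussPotential (D.W k) (D.G k) (block D.b k (D.φ c)) ∧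
      -- the information potentials of the factors
      (∀ k, ∀ a ∈ D.W k,
        infoPotential (gaussDensity (D.W k) (D.G k) (block D.b k (D.φ c))) (D.G k) a =
          gaussPotential (D.W k) (D.G k) (block D.b k (D.φ c))
            - 1 / 2 * sepDist (D.W k) (D.G k) a (block D.b k (D.φ c)) ^ 2) ∧
      -- the information potential is additive
      (∀ x ∈ U, infoPotential (ρ θ) (g θ) x =
        ∑ k, infoPotential (gaussDensity (D.W k) (D.G k) (block D.b k (D.φ c))) (D.G k)
          (block D.b k (D.φ x))) := by
  have h := hM θ
  -- Each side of the equivalence holds outright, so neither implication uses its premise.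
  refine ⟨⟨fun _ => nonempty_cartesianDecomposition hn h, fun _ => h.hasReducibleDependence⟩,
    fun D => ?_⟩
  obtain ⟨c, Φ, Ψ, hc, h0⟩ := h.exists_chart
  choose Φk Ψk hk using fun k => D.exists_chart_factor hc h.isOpen h.metric h.isCompact_sublevel k
  set S := infoPotential (ρ θ) (g θ) with hS
  set F := fun k => D.factorPotential (fun x => -S x) c k with hF
  -- Since `S(c) = 0`, the factor potentials vanish at their centres; all the additive constants
  -- disappear and `F k` is half the squared distance in the factor.
  have hF0 : ∀ k, F k (block D.b k (D.φ c)) = 0 := fun k => by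
    rw [hF]
    simp only [D.factorPotential_center hc k, h0, neg_zero]
  have hsum : ∀ y ∈ D.domain, -S (D.ψ y) = ∑ k, F k (block D.b k y) := fun y hy => by
    have := D.potential_eq_sum hc h.isOpen h.metric hy
    simpa [h0] using this
  have hsumU : ∀ x ∈ U, -S x = ∑ k, F k (block D.b k (D.φ x)) := fun x hx => by
    rw [← hsum _ (D.change.mapsTo hx), D.change.left_inv x hx]
  have hdist : ∀ k, ∀ a ∈ D.W k,
      sepDist (D.W k) (D.G k) a (block D.b k (D.φ c)) ^ 2 = 2 * F k a := fun k a ha => by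
    have := (hk k).sepDist_sq (D.W_open k) ha
    rwa [show D.factorPotential (fun x => -S x) c k (block D.b k (D.φ c)) = 0 from hF0 k,
      sub_zero] at this
  have hinfo : ∀ k, ∀ a ∈ D.W k,
      infoPotential (gaussDensity (D.W k) (D.G k) (block D.b k (D.φ c))) (D.G k) a = -F k a :=
    fun k a ha => by
      have := (hk k).infoPotential_gaussDensity (D.W_open k) (D.G_metric k) ha
      rwa [show D.factorPotential (fun x => -S x) c k (block D.b k (D.φ c)) = 0 from hF0 k,
        sub_zero] at this
  refine ⟨c, hc.center_mem, fun x hx hxc => neg_lt_neg_iff.1 (hc.potential_lt hx hxc),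
    fun k => (hk k).isStatisticalManifold (D.W_open k) (D.G_metric k), fun x hx => ?_,
    fun y hy => D.volDensity_eq_prod hy, fun y hy => ?_, ?_, ?_, fun k a ha => ?_, fun x hx => ?_⟩
  · rw [hc.sepDist_sq h.isOpen hx, h0, neg_zero, sub_zero, hsumU x hx, Finset.mul_sum]
    exact Finset.sum_congr rfl fun k _ => (hdist k _ (D.change.mapsTo hx k)).symm
  · rw [h.changeDensity_eq D.isOpen_domain D.change hy, D.volDensity_eq_prod hy,
      show infoPotential (ρ θ) (g θ) (D.ψ y) = ∑ k, -F k (block D.b k y) by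
        rw [Finset.sum_neg_distrib, ← hsum y hy, neg_neg], Real.exp_sum, ← Finset.prod_mul_distrib]
    refine Finset.prod_congr rfl fun k _ => ?_
    rw [(hk k).gaussDensity_eq (D.W_open k) (hy k),
      show D.factorPotential (fun x => -S x) c k (block D.b k (D.φ c)) = 0 from hF0 k, sub_zero]
  -- All the partition functions involved are equal to one.
  · rw [hc.gaussZ_eq_one h.isOpen]
    exact (Finset.prod_eq_one fun k _ => (hk k).gaussZ_eq_one (D.W_open k)).symm
  · rw [hc.gaussPotential_eq_zero h.isOpen]
    exact (Finset.sum_eq_zero fun k _ => (hk k).gaussPotential_eq_zero (D.W_open k)).symm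
  · rw [hinfo k a ha, hdist k a ha, (hk k).gaussPotential_eq_zero (D.W_open k)]
    ring
  · rw [Finset.sum_congr rfl fun k _ => hinfo k _ (D.change.mapsTo hx k),
      Finset.sum_neg_distrib, ← hsumU x hx, neg_neg]
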